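/- **Conventions.** $\|\cdot\|$ is the $\infty$-norm of vectors and the induced matrix norm, $|\cdot|_2$ the Euclidean norm, $\|\cdot\|_2$ the spectral norm, $\|G\|_{\mathcal L_1}$ the $\mathcal L_1$-norm of a stable proper transfer matrix (maximal row sum of the total variations of the impulse responses of the entries), $N^\dagger=(N^\top N)^{-1}N^\top$. A product $G(s)v(s)$ denotes the response of $G$, started at rest, to the signal $v(t)$. $\lambda_{\min},\lambda_{\max}$ are extreme eigenvalues of symmetric matrices. **Plant.** $\dot x=A_mx+B_m(\omega u+f(x,t))$, $y=C_mx$, $x(0)=x_0$, $\|x_0\|\le\rho_0$, $u(t)\in\mathbb R^m$, $m\ge1$. Here $A_m$ is Hurwitz, $(A_m,B_m,C_m)$ is a minimal realization of $M(s)=C_m(s-A_m)^{-1}B_m$, $M$ has full normal column rank $m$, and (A1) $M$ has no transmission zeros in the closed right half-plane; (A2) $\omega\in\mathcal C_\omega=[\omega_l,\omega_u]$, $0<\omega_l<\omega_u$, and $1\in\mathcal C_\omega$; (A3) $f$ is differentiable in $x$ and in $t$, $\|f(0,t)\|<b_0$ for $t\ge0$, and for every $\delta>0$, $\|\partial f/\partial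 x\|\le d_\delta$ and $\|\partial f/\partial t\|\le b_\delta$ for all $\|x\|<\delta$, $t\ge0$, with known constants $b_0,d_\delta,b_\delta>0$. The reference command $r$ is measurable and bounded on $[0,\infty)$; $K_g$ is a constant matrix. **Design.** Let $\rho_0,\bar\gamma,\rho_r>0$, $\rho_x=\rho_r+\bar\gamma$, $L=\frac{\rho_x}{\rho_r}d_{\rho_x}$. Let $Z(s)=C_z(s-A_z)^{-1}B_z+D_z$ be minimal with $A_z$ Hurwitz and $\det\begin{bmatrix}-s+A_z&B_z\\C_z&D_z\end{bmatrix}\ne0$ for all $s\in\mathbb C$, such that $\lim_{s\to\infty}sM(s)Z^{-1}(s)$ exists and has full column rank, and let $T_z$ (of full column rank) and $\bar B$ satisfy $A_mT_z=T_zA_z+\bar BC_z$, $C_mA_mT_z=C_m\bar BC_z$, $B_m=T_zB_z+\bar BD_z$, $C_mB_m=C_m\bar BD_z$. Put $H=\bar B(C_m\bar B)^\dagger$ and let $K_v$ make $A_v=(I-HC_m)A_m+K_vC_m$ Hurwitz. Let $P_y,Q$ be positive definite, $P_v$ positive definite with $A_v^\top P_v+P_vA_v=-Q$, $0<\epsilon_q<\lambda_{\min}(Q)$,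 $\bar P_v=(I-HC_m)^\top P_v(I-HC_m)$, $\kappa_m=\sup_{t\ge0}\|e^{A_mt}\|$, $\kappa_y=\sqrt{n\lambda_{\max}(\bar P_v)/\lambda_{\min}(P_y)}$, $\kappa_v=\sqrt{n\lambda_{\max}(\bar P_v)/\lambda_{\min}(P_v)}$. With $T_g=[I,\ \omega T_z]$ and $T(s)=T_z(s-A_z)^{-1}B_z$ put $$\bar d=\max_{\omega\in\mathcal C_\omega}\big(\|C_zT_z^\dagger T_g\|+\|D_z\|\|T_g\|d_{\rho_x}\big),$$ $$\bar b=\|C_zT_z^\dagger\|\rho_x+\|D_z\|\|T\|_{\mathcal L_1}d_{\rho_x}^2\rho_x+\|D_z\|(\|T\|_{\mathcal L_1}d_{\rho_x}+1)b_0 .$$ Let $\alpha>0$ satisfy $\alpha_y=2\alpha-\frac{m\bar d^2}{\epsilon_q}\|\sqrt{P_y}C_m\bar B\|_2^2>0$, where $\sqrt{P_y}$ is the Cholesky factor, $P_y=\sqrt{P_y}^\top\sqrt{P_y}$. Let $D(s)$ be an $m\times m$ rational matrix such that for every $\omega\in\mathcal C_\omega$, with $C_0=D(I+\omega D)^{-1}$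 and $C=\omega C_0$: $C$ is stable, $C(0)=I$, $CZ^{-1}$ is strictly proper. Put $H_0=(s-A_m)^{-1}B_m$, $H_r=H_0CK_g$, $G=H_0(I-C)$, $C_1=(s+\alpha)C_0Z^{-1}(C_m\bar B)^\dagger$, $C_2=C_0Z^{-1}(C_m\bar B)^\dagger C_mA_m$, $H_i=\omega H_0C_i$, $$\rho_{ext}=\|H_r\|_{\mathcal L_1}\|r\|_{\mathcal L_\infty}+\|G\|_{\mathcal L_1}b_0,\quad \kappa_x=\|H_1\|_{\mathcal L_1}\kappa_y+\|H_2\|_{\mathcal L_1}\kappa_v,\quad \rho_{int}=(\kappa_m+\kappa_x)\rho_0,$$ and assume $\|G\|_{\mathcal L_1}<(\rho_r-\rho_{ext}-\rho_{int})/(L\rho_r)$ for all $\omega\in\mathcal C_\omega$. Further put $q=1-\|G\|_{\mathcal L_1}L$ and $$\gamma_{x_0}=\frac{\kappa_x+\kappa_m}{q},\qquad \gamma_{u_0}=\|C_0\|_{\mathcal L_1}L\gamma_{x_0}+\|C_1\|_{\mathcal L_1}\kappa_y+\|C_2\|_{\mathcal L_1}\kappa_v,$$ $$\gamma_x=\frac1q\Big(\frac{\|H_1\|_{\mathcal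 L_1}}{\sqrt{\lambda_{\min}(P_y)}}+\frac{\|H_2\|_{\mathcal L_1}}{\sqrt{\lambda_{\min}(P_v)}}\Big),\qquad \gamma_u=\|C_0\|_{\mathcal L_1}L\gamma_x+\frac{\|C_1\|_{\mathcal L_1}}{\sqrt{\lambda_{\min}(P_y)}}+\frac{\|C_2\|_{\mathcal L_1}}{\sqrt{\lambda_{\min}(P_v)}},$$ $$\rho_{rx}=\rho_r-\frac{\rho_{int}}q,\qquad \rho_{ru}=\|C_0\|_{\mathcal L_1}(L\rho_{rx}+b_0)+\|C_0K_g\|_{\mathcal L_1}\|r\|_{\mathcal L_\infty},$$ $$\rho_{dx}=\gamma_{x_0}\rho_0+\bar\gamma,\qquad \rho_{du}=\gamma_{u_0}\rho_0+\bar\gamma,\qquad \rho_u=\rho_{ru}+\rho_{du},$$ and let $\epsilon_\gamma>0$ satisfy $\gamma_x\epsilon_\gamma<\bar\gamma$, $\gamma_u\epsilon_\gamma<\bar\gamma$ for all $\omega\in\mathcal C_\omega$. Let $\lambda_1=\min\big(\lambda_{\min}(Q-\epsilon_qI)/\lambda_{\max}(P_v),\alpha_y\big)$ and $$\theta_1=4(\omega_u^2+m\bar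 d^2+m\bar b^2)+4m\,\frac{\bar d\,\bar l_\theta+\bar b\,\bar l_\sigma}{\lambda_1}.$$ Here $\bar l_\theta,\bar l_\sigma\ge0$ are *rate bounds*: whenever $\tau>0$ and, on $[0,\tau]$, $u$ is continuous, $\dot x_u=A_zx_u+B_zu$, $\dot x_f=A_zx_f+B_zf(x,t)$, $\dot x_v=A_mx_v+\bar B(\omega(C_zx_u+D_zu)+\bar f)$ with $x_u(0)=x_f(0)=0$, $x_g=[x_v^\top,x_u^\top]^\top$, $x=T_gx_g+T_zx_f$, $\bar f=C_zx_f+D_zf(x,t)$, $\|x\|\le\rho_x$ and $\|u\|\le\rho_u$, there are $\theta,\sigma$ on $[0,\tau]$, Lipschitz with constants $\bar l_\theta,\bar l_\sigma$, with $\bar f=\theta\|x_g\|+\sigma$, $\|\theta\|\le\bar d$, $\|\sigma\|\le\bar b$. **Controller.** $u(s)=-D(s)Z^{-1}(s)\big(\hat\eta_t(s)-Z(s)K_gr(s)\big)$, $\hat\eta_t=\hat\omega u_z+\hat\theta\|\hat x_g\|+\hat\sigma$, where $\dot x_u=A_zx_u+B_zu$, $u_z=C_zx_u+D_zu$, $x_u(0)=0$,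 $\hat x_g=[\hat x_v^\top,x_u^\top]^\top$, $\hat x_v=\hat v+Hy$, $\tilde y=\hat y-y$, $e_y=\bar B^\top C_m^\top P_y\tilde y$, $$\dot{\hat v}=A_v\hat x_v-K_vy-P_v^{-1}A_m^\top C_m^\top P_y\tilde y,\qquad \dot{\hat y}=-\alpha\tilde y+C_mA_m\hat x_v+C_m\bar B\hat\eta_t,\qquad \hat v(0)=0,\ \hat y(0)=C_mx_0,$$ $$\dot{\hat\omega}=\Gamma_\omega\mathrm{Proj}(\hat\omega,-u_z^\top e_y),\quad \dot{\hat\theta}=\Gamma_\theta\mathrm{Proj}(\hat\theta,-\|\hat x_g\|e_y),\quad \dot{\hat\sigma}=\Gamma_\sigma\mathrm{Proj}(\hat\sigma,-e_y),\quad \hat\omega(0)=1,\ \hat\theta(0)=0,\ \hat\sigma(0)=0 .$$ $\mathrm{Proj}$ is the smooth projection operator for the balls $[\omega_l,\omega_u]$, $|\theta|_2\le\sqrt m\,\bar d$, $|\sigma|_2\le\sqrt m\,\bar b$ respectively: for centre $c$, radius $\varrho$, layer width $\epsilon>0$ and $h(z)=(|z-c|_2^2-\varrho^2)/(\epsilon\varrho^2)$,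 $\mathrm{Proj}(z,y)=y-h(z)\frac{(z-c)^\top y}{|z-c|_2^2}(z-c)$ if $h(z)>0$ and $(z-c)^\top y>0$, and $\mathrm{Proj}(z,y)=y$ otherwise. The layer widths satisfy $0<\epsilon\le3\omega_u^2/\theta_1$. **Reference system.** $\dot x_{ref}=A_mx_{ref}+B_m(\omega u_{ref}+f(x_{ref},t))$, $x_{ref}(0)=0$, $y_{ref}=C_mx_{ref}$, $u_{ref}(s)=C_0(s)(K_gr(s)-\eta_{ref}(s))$ with $\eta_{ref}(t)=f(x_{ref}(t),t)$. **Theorem 2.** Let $\omega\in\mathcal C_\omega$. Rate bounds $\bar l_\theta,\bar l_\sigma$ exist, uniformly in $f$ subject to (A3). For any $\bar l_\theta,\bar l_\sigma\ge0$ there are constants $\gamma_{dx},\gamma_{dy}>0$ and strictly decreasing functions $v_{dx},v_{dy}$ on $[0,\infty)$ with limit $0$ at infinity such that, for every $f$ subject to (A3) that has $\bar l_\theta,\bar l_\sigma$ as rate bounds, all adaptation gains with $\Gamma=\min(\Gamma_\omega,\Gamma_\theta,\Gamma_\sigma)>\theta_1/\epsilon_\gamma^2$, and every $x_0$ with $\|x_0\|\le\rho_0$,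 the solutions of the closed loop and of the reference system satisfy, at all times $t\ge0$ (on any interval $[0,T)$, $T\le\infty$, on which they exist), $$\|x_{ref}-x\|\le\rho_{dx},\quad \|u_{ref}-u\|\le\rho_{du},\quad \|y_{ref}-y\|\le\|C_m\|\rho_{dx},\quad \|x\|\le\rho_x,\quad \|u\|\le\rho_u,$$ $$\|x_{ref}(t)-x(t)\|\le v_{dx}(t)\|x_0\|+\frac{\gamma_{dx}}{\sqrt\Gamma},\qquad \|y_{ref}(t)-y(t)\|\le v_{dy}(t)\|x_0\|+\frac{\gamma_{dy}}{\sqrt\Gamma}.$$ -/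

import Mathlib

open Set Filter Topology MeasureTheory Matrix

noncomputable section

namespace L1Control

/-! ### Matrices

Vectors `Fin k → ℝ` carry the supremum norm `‖·‖`. -/

/-- The matrix `∞`-norm (maximal absolute row sum), induced by the supremum norm on vectors. -/
def infNorm {ι κ : Type} [Fintype ι] [Fintype κ] (A : Matrix ι κ ℝ) : ℝ :=
  (Matrix.linftyOpNormedAddCommGroup : NormedAddCommGroup (Matrix ι κ ℝ)).norm A

/-- The spectral norm of a matrix, induced by the Euclidean norms. -/
def twoNorm {a b : ℕ} (A : Matrix (Fin a) (Fin b) ℝ) : ℝ :=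
  (Matrix.instL2OpNormedAddCommGroup : NormedAddCommGroup (Matrix (Fin a) (Fin b) ℝ)).norm A

/-- Smallest eigenvalue of a symmetric matrix. -/
def lamMin {k : ℕ} (P : Matrix (Fin k) (Fin k) ℝ) : ℝ := sInf (spectrum ℝ P)

/-- Largest eigenvalue of a symmetric matrix. -/
def lamMax {k : ℕ} (P : Matrix (Fin k) (Fin k) ℝ) : ℝ := sSup (spectrum ℝ P)

/-- The generalized (Moore-Penrose) left inverse of a matrix of full column rank. -/
def pinv {a b : ℕ} (N : Matrix (Fin a) (Fin b) ℝ) : Matrix (Fin b) (Fin a) ℝ :=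
  (Nᵀ * N)⁻¹ * Nᵀ

/-- All eigenvalues lie in the open left half-plane. -/
def Hurwitz {k : ℕ} (A : Matrix (Fin k) (Fin k) ℝ) : Prop :=
  ∀ z ∈ spectrum ℂ (A.map ((↑) : ℝ → ℂ)), z.re < 0

/-- The columns of `B, AB, …, A^{k-1}B` span the state space. -/
def Controllable {k a : ℕ} (A : Matrix (Fin k) (Fin k) ℝ) (B : Matrix (Fin k) (Fin a) ℝ) : Prop :=
  Submodule.span ℝ {v : Fin k → ℝ | ∃ i < k, ∃ j, v = (A ^ i * B).col j} = ⊤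

/-- The common kernel of `C, CA, …, CA^{k-1}` is trivial. -/
def Observable {k a : ℕ} (A : Matrix (Fin k) (Fin k) ℝ) (C : Matrix (Fin a) (Fin k) ℝ) : Prop :=
  ∀ v : Fin k → ℝ, (∀ i < k, (C * A ^ i) *ᵥ v = 0) → v = 0

/-- `z` is a transmission zero of `C (s - A)⁻¹ B`, where `(A, B, C)` is minimal and the transfer
matrix has full normal column rank: the Rosenbrock matrix loses column rank at `z`. -/
def TransmissionZero {k a b : ℕ} (A : Matrix (Fin k) (Fin k) ℝ) (B : Matrix (Fin k) (Fin a) ℝ)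
    (C : Matrix (Fin b) (Fin k) ℝ) (z : ℂ) : Prop :=
  (Matrix.fromBlocks (z • (1 : Matrix (Fin k) (Fin k) ℂ) - A.map ((↑) : ℝ → ℂ))
    (B.map ((↑) : ℝ → ℂ)) (-(C.map ((↑) : ℝ → ℂ))) 0).rank < k + a

/-! ### Transfer matrices -/

/-- Transfer matrices: matrices of real rational functions of the Laplace variable `s`. -/
abbrev TM (a b : ℕ) := Matrix (Fin a) (Fin b) (RatFunc ℝ)

/-- A constant matrix as a transfer matrix. -/
def const {a b : ℕ} (A : Matrix (Fin a) (Fin b) ℝ) : TM a b := A.map (RatFunc.C : ℝ →+* RatFunc ℝ)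

/-- The resolvent `(s - A)⁻¹`. -/
def resolvent {k : ℕ} (A : Matrix (Fin k) (Fin k) ℝ) : TM k k :=
  ((RatFunc.X : RatFunc ℝ) • (1 : TM k k) - const A)⁻¹

/-- The transfer matrix `C (s - A)⁻¹ B + D`. -/
def ss {k a b : ℕ} (A : Matrix (Fin k) (Fin k) ℝ) (B : Matrix (Fin k) (Fin a) ℝ)
    (C : Matrix (Fin b) (Fin k) ℝ) (D : Matrix (Fin b) (Fin a) ℝ) : TM b a :=
  const C * resolvent A * const B + const D

/-- Every entry has numerator degree smaller than denominator degree. -/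
def StrictlyProper {a b : ℕ} (G : TM a b) : Prop :=
  ∀ i j, (G i j).num.degree < (G i j).denom.degree

/-- All poles lie in the open left half-plane. -/
def Stable {a b : ℕ} (G : TM a b) : Prop :=
  ∀ i j, ∀ z : ℂ, Polynomial.aeval z (G i j).denom = 0 → z.re < 0

/-- The value of a transfer matrix at a real point which is not a pole. -/
def evalAt {a b : ℕ} (G : TM a b) (s : ℝ) : Matrix (Fin a) (Fin b) ℝ :=
  G.map (RatFunc.eval (RingHom.id ℝ) s)

/-- `W` is a right interactor of `M₀`: the limit of `M₀(s) W(s)` for `s → ∞` exists and has full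
column rank. -/
def IsRightInteractor {a b : ℕ} (M₀ : TM a b) (W : TM b b) : Prop :=
  ∃ N : Matrix (Fin a) (Fin b) ℝ, Tendsto (fun s : ℝ => evalAt (M₀ * W) s) atTop (𝓝 N) ∧ N.rank = b

/-- Markov parameters: coefficients of the expansion `g(s) = ∑ₖ markov g k * s⁻ᵏ` at infinity of a
proper rational function `g`; substituting `s = 1/x` in `g = num / denom` and clearing powers of `x`
gives the quotient of the two reflected polynomials. -/
def markov (g : RatFunc ℝ) (k : ℕ) : ℝ :=
  PowerSeries.coeff k
    (((g.num.reflect g.denom.natDegree : Polynomial ℝ) : PowerSeries ℝ) *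
      ((g.denom.reflect g.denom.natDegree : Polynomial ℝ) : PowerSeries ℝ)⁻¹)

/-- The function part of the impulse response of a proper rational function: `s⁻ᵏ⁻¹` is the Laplace
transform of `tᵏ / k!`. The constant `markov g 0` is the weight of the Dirac part. -/
def impulse (g : RatFunc ℝ) (t : ℝ) : ℝ := ∑' k : ℕ, markov g (k + 1) * t ^ k / (k.factorial : ℝ)

/-- The `L₁`-norm of a proper stable transfer matrix: maximal row sum of the total variations of
the impulse responses of the entries. -/
def l1Norm {a b : ℕ} (G : TM a b) : ℝ :=
  ⨆ i, ∑ j, (|markov (G i j) 0| + ∫ t in Ioi (0 : ℝ), |impulse (G i j) t|)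

/-- The output at time `t` of the proper transfer matrix `G`, started at rest at time `0` and driven
by `v`; this is the time-domain form of `G(s) v(s)`. -/
def response {a b : ℕ} (G : TM a b) (v : ℝ → Fin b → ℝ) (t : ℝ) : Fin a → ℝ := fun i =>
  ∑ j, (markov (G i j) 0 * v t j + ∫ τ in (0 : ℝ)..t, impulse (G i j) (t - τ) * v τ j)

/-! ### The projection operator -/

/-- The smooth projection operator for the ball with centre `c` and radius `ϱ` in the Euclidean
norm, with the convex function `h z = (|z - c|² - ϱ²) / (ε ϱ²)`: the outward radial component
of `y` is damped by the factor `1 - h z` in the layer where `h z > 0`; it vanishes where `h z = 1`. -/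
def proj {k : ℕ} (c : Fin k → ℝ) (ϱ ε : ℝ) (z y : Fin k → ℝ) : Fin k → ℝ :=
  let w := z - c
  let h := (w ⬝ᵥ w - ϱ ^ 2) / (ε * ϱ ^ 2)
  open Classical in if 0 < h ∧ 0 < w ⬝ᵥ y then y - (h * (w ⬝ᵥ y) / (w ⬝ᵥ w)) • w else y

/-- The projection operator for scalars. -/
def projScalar (c ϱ ε z y : ℝ) : ℝ :=
  proj (k := 1) (fun _ => c) ϱ ε (fun _ => z) (fun _ => y) 0

/-! ### The design data -/

/-- Plant matrices, known bounds, reference command, and the choices made in the design. -/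
structure Design (n m p nz mr : ℕ) where
  /-- desired dynamics -/
  Am : Matrix (Fin n) (Fin n) ℝ
  Bm : Matrix (Fin n) (Fin m) ℝ
  Cm : Matrix (Fin p) (Fin n) ℝ
  /-- the input gain lies in `[ωl, ωu]` -/
  ωl : ℝ
  ωu : ℝ
  /-- bounds on the uncertainty: `b₀`, and `d_δ`, `b_δ` as functions of `δ` -/
  b0 : ℝ
  d : ℝ → ℝ
  b : ℝ → ℝ
  /-- feed-forward gain and reference command -/
  Kg : Matrix (Fin m) (Fin mr) ℝ
  r : ℝ → Fin mr → ℝ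
  /-- bound on the initial state, and the small constant `γ̄` -/
  ρ0 : ℝ
  γbar : ℝ
  /-- realization of `Z(s)` and the associated matrices `T_z`, `B̄` -/
  Az : Matrix (Fin nz) (Fin nz) ℝ
  Bz : Matrix (Fin nz) (Fin m) ℝ
  Cz : Matrix (Fin m) (Fin nz) ℝ
  Dz : Matrix (Fin m) (Fin m) ℝ
  Tz : Matrix (Fin n) (Fin nz) ℝ
  Bbar : Matrix (Fin n) (Fin m) ℝ
  /-- predictor: stabilizing gain, Lyapunov matrices, Cholesky factor of `P_y` -/
  Kv : Matrix (Fin n) (Fin p) ℝ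
  Py : Matrix (Fin p) (Fin p) ℝ
  sqrtPy : Matrix (Fin p) (Fin p) ℝ
  Pv : Matrix (Fin n) (Fin n) ℝ
  Q : Matrix (Fin n) (Fin n) ℝ
  εq : ℝ
  α : ℝ
  /-- the filter `D(s)`, and the constants `ρ_r`, `ε_γ` -/
  D : TM m m
  ρr : ℝ
  εγ : ℝ

namespace Design

variable {n m p nz mr : ℕ} (S : Design n m p nz mr)

/-- The compact set of input gains. -/
def Cω : Set ℝ := Icc S.ωl S.ωu

/-- `L_δ` -/
def L (δ : ℝ) : ℝ := (δ + S.γbar) / δ * S.d (δ + S.γbar)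

/-- `ρ_x` -/
def ρx : ℝ := S.ρr + S.γbar

/-- `M(s)` -/
def M : TM p m := ss S.Am S.Bm S.Cm 0

/-- `Z(s)` -/
def Z : TM m m := ss S.Az S.Bz S.Cz S.Dz

/-- `(C_m B̄)†` -/
def CBdag : Matrix (Fin m) (Fin p) ℝ := pinv (S.Cm * S.Bbar)

/-- `H` -/
def H : Matrix (Fin n) (Fin p) ℝ := S.Bbar * S.CBdag

/-- `A_H` -/
def AH : Matrix (Fin n) (Fin n) ℝ := (1 - S.H * S.Cm) * S.Am

/-- `A_v` -/
def Av : Matrix (Fin n) (Fin n) ℝ := S.AH + S.Kv * S.Cm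

/-- `P̄_v` -/
def Pvbar : Matrix (Fin n) (Fin n) ℝ := (1 - S.H * S.Cm)ᵀ * S.Pv * (1 - S.H * S.Cm)

/-- `κ_m` -/
def κm : ℝ := sSup ((fun t : ℝ => infNorm (NormedSpace.exp (t • S.Am))) '' Ici 0)

/-- `κ_y` -/
def κy : ℝ := √(n * (lamMax S.Pvbar / lamMin S.Py))

/-- `κ_v` -/
def κv : ℝ := √(n * (lamMax S.Pvbar / lamMin S.Pv))

/-- `C₀(s)` -/
def C0 (ω : ℝ) : TM m m := S.D * (1 + RatFunc.C ω • S.D)⁻¹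

/-- `C(s)` -/
def C (ω : ℝ) : TM m m := RatFunc.C ω • S.C0 ω

/-- `C₁(s)` -/
def C1 (ω : ℝ) : TM m p :=
  ((RatFunc.X : RatFunc ℝ) + RatFunc.C S.α) • (S.C0 ω * S.Z⁻¹ * const S.CBdag)

/-- `C₂(s)` -/
def C2 (ω : ℝ) : TM m n := S.C0 ω * S.Z⁻¹ * const (S.CBdag * S.Cm * S.Am)

/-- `H₀(s)` -/
def H0 : TM n m := resolvent S.Am * const S.Bm

/-- `H_r(s)` -/
def Hr (ω : ℝ) : TM n mr := S.H0 * S.C ω * const S.Kg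

/-- `H₁(s)` -/
def H1 (ω : ℝ) : TM n p := RatFunc.C ω • (S.H0 * S.C1 ω)

/-- `H₂(s)` -/
def H2 (ω : ℝ) : TM n n := RatFunc.C ω • (S.H0 * S.C2 ω)

/-- `G(s)` -/
def G (ω : ℝ) : TM n m := S.H0 * (1 - S.C ω)

/-- The `L_∞`-norm of the reference command over `[0, ∞)`. -/
def rNorm : ℝ := (eLpNorm S.r ⊤ (volume.restrict (Ici 0))).toReal

/-- `ρ_ext` -/
def ρext (ω : ℝ) : ℝ := l1Norm (S.Hr ω) * S.rNorm + l1Norm (S.G ω) * S.b0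

/-- `κ_x` -/
def κx (ω : ℝ) : ℝ := l1Norm (S.H1 ω) * S.κy + l1Norm (S.H2 ω) * S.κv

/-- `ρ_int` -/
def ρint (ω : ℝ) : ℝ := (S.κm + S.κx ω) * S.ρ0

/-- `T_g = [1, ω T_z]` -/
def Tg (ω : ℝ) : Matrix (Fin n) (Fin n ⊕ Fin nz) ℝ := Matrix.fromCols 1 (ω • S.Tz)

/-- `T(s)` -/
def T : TM n m := const S.Tz * resolvent S.Az * const S.Bz

/-- `d̄_{ρ_x}` -/
def dbar : ℝ :=
  sSup ((fun ω : ℝ => infNorm (S.Cz * pinv S.Tz * S.Tg ω) +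
    infNorm S.Dz * infNorm (S.Tg ω) * S.d S.ρx) '' S.Cω)

/-- `b̄_{ρ_x}` -/
def bbar : ℝ :=
  infNorm (S.Cz * pinv S.Tz) * S.ρx + infNorm S.Dz * l1Norm S.T * S.d S.ρx ^ 2 * S.ρx +
    infNorm S.Dz * (l1Norm S.T * S.d S.ρx + 1) * S.b0

/-- `α_φ` -/
def αφ : ℝ := m * S.dbar ^ 2 / S.εq * twoNorm (S.sqrtPy * (S.Cm * S.Bbar)) ^ 2

/-- `α_y` -/
def αy : ℝ := 2 * S.α - S.αφ

/-- `ρ_rx` -/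
def ρrx (ω : ℝ) : ℝ := S.ρr - S.ρint ω / (1 - l1Norm (S.G ω) * S.L S.ρr)

/-- `ρ_ru` -/
def ρru (ω : ℝ) : ℝ :=
  l1Norm (S.C0 ω) * (S.L S.ρr * S.ρrx ω + S.b0) + l1Norm (S.C0 ω * const S.Kg) * S.rNorm

/-- `γ_{x₀}` -/
def γx0 (ω : ℝ) : ℝ := (S.κx ω + S.κm) / (1 - l1Norm (S.G ω) * S.L S.ρr)

/-- `γ_{u₀}` -/
def γu0 (ω : ℝ) : ℝ :=
  l1Norm (S.C0 ω) * S.L S.ρr * S.γx0 ω + (l1Norm (S.C1 ω) * S.κy + l1Norm (S.C2 ω) * S.κv)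

/-- `γ_x` -/
def γx (ω : ℝ) : ℝ :=
  (l1Norm (S.H1 ω) / √(lamMin S.Py) + l1Norm (S.H2 ω) / √(lamMin S.Pv)) /
    (1 - l1Norm (S.G ω) * S.L S.ρr)

/-- `γ_u` -/
def γu (ω : ℝ) : ℝ :=
  l1Norm (S.C0 ω) * S.L S.ρr * S.γx ω + l1Norm (S.C1 ω) / √(lamMin S.Py) +
    l1Norm (S.C2 ω) / √(lamMin S.Pv)

/-- `ρ_dx` -/
def ρdx (ω : ℝ) : ℝ := S.γx0 ω * S.ρ0 + S.γbar

/-- `ρ_du` -/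
def ρdu (ω : ℝ) : ℝ := S.γu0 ω * S.ρ0 + S.γbar

/-- `ρ_u` -/
def ρu (ω : ℝ) : ℝ := S.ρru ω + S.ρdu ω

/-- `λ₁` -/
def lam1 : ℝ := min (lamMin (S.Q - S.εq • 1) / lamMax S.Pv) S.αy

/-- `θ₀` -/
def θ0 : ℝ := 4 * (S.ωu ^ 2 + m * S.dbar ^ 2 + m * S.bbar ^ 2)

/-- `θ₁`, for rate bounds `l̄_θ`, `l̄_σ` -/
def θ1 (lθ lσ : ℝ) : ℝ := S.θ0 + 4 * m * ((S.dbar * lθ + S.bbar * lσ) / S.lam1)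

/-- The assumptions on the known data and the design constraints. -/
structure Admissible : Prop where
  m_pos : 0 < m
  -- desired dynamics
  hurwitz_Am : Hurwitz S.Am
  controllable : Controllable S.Am S.Bm
  observable : Observable S.Am S.Cm
  full_rank : S.M.rank = m
  minimum_phase : ∀ z : ℂ, TransmissionZero S.Am S.Bm S.Cm z → z.re < 0
  -- known bounds
  ωl_pos : 0 < S.ωl
  ωl_lt : S.ωl < S.ωu
  one_mem : (1 : ℝ) ∈ S.Cω
  b0_pos : 0 < S.b0
  d_pos : ∀ δ > 0, 0 < S.d δ
  b_pos : ∀ δ > 0, 0 < S.b δ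
  r_bounded : MemLp S.r ⊤ (volume.restrict (Ici 0))
  ρ0_pos : 0 < S.ρ0
  γbar_pos : 0 < S.γbar
  -- the right interactor
  hurwitz_Az : Hurwitz S.Az
  controllable_z : Controllable S.Az S.Bz
  observable_z : Observable S.Az S.Cz
  no_zeros : ∀ s : ℂ, (Matrix.fromBlocks (-(s • (1 : Matrix (Fin nz) (Fin nz) ℂ)) +
    S.Az.map ((↑) : ℝ → ℂ)) (S.Bz.map ((↑) : ℝ → ℂ)) (S.Cz.map ((↑) : ℝ → ℂ))
    (S.Dz.map ((↑) : ℝ → ℂ))).det ≠ 0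
  interactor : IsRightInteractor ((RatFunc.X : RatFunc ℝ) • S.M) S.Z⁻¹
  Tz_rank : S.Tz.rank = nz
  AmTz : S.Am * S.Tz = S.Tz * S.Az + S.Bbar * S.Cz
  CmAmTz : S.Cm * S.Am * S.Tz = S.Cm * S.Bbar * S.Cz
  Bm_eq : S.Bm = S.Tz * S.Bz + S.Bbar * S.Dz
  CmBm : S.Cm * S.Bm = S.Cm * S.Bbar * S.Dz
  -- the predictor
  hurwitz_Av : Hurwitz S.Av
  Py_posDef : S.Py.PosDef
  sqrtPy_upper : ∀ i j, j < i → S.sqrtPy i j = 0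
  sqrtPy_diag : ∀ i, 0 < S.sqrtPy i i
  sqrtPy_sq : S.Py = S.sqrtPyᵀ * S.sqrtPy
  Pv_posDef : S.Pv.PosDef
  Q_posDef : S.Q.PosDef
  lyapunov : S.Avᵀ * S.Pv + S.Pv * S.Av = -S.Q
  εq_pos : 0 < S.εq
  εq_lt : S.εq < lamMin S.Q
  α_pos : 0 < S.α
  αy_pos : 0 < S.αy
  -- the filter
  stable : ∀ ω ∈ S.Cω, Stable (S.C ω)
  dc_gain : ∀ ω ∈ S.Cω, evalAt (S.C ω) 0 = 1
  strictly_proper : ∀ ω ∈ S.Cω, StrictlyProper (S.C ω * S.Z⁻¹)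
  ρr_pos : 0 < S.ρr
  small_gain : ∀ ω ∈ S.Cω,
    l1Norm (S.G ω) < (S.ρr - S.ρext ω - S.ρint ω) / (S.L S.ρr * S.ρr)
  -- the accuracy constant
  εγ_pos : 0 < S.εγ
  εγ_x : ∀ ω ∈ S.Cω, S.γx ω * S.εγ < S.γbar
  εγ_u : ∀ ω ∈ S.Cω, S.γu ω * S.εγ < S.γbar

/-- The assumptions on the unknown function `f(x, t)`, for times `t ≥ 0`. -/
structure Uncertainty (f : (Fin n → ℝ) → ℝ → Fin m → ℝ) : Prop where
  zero : ∀ t, 0 ≤ t → ‖f 0 t‖ < S.b0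
  diff_x : ∀ x t, 0 ≤ t → DifferentiableAt ℝ (fun z => f z t) x
  diff_t : ∀ x t, 0 ≤ t → DifferentiableWithinAt ℝ (f x) (Ici 0) t
  bound_x : ∀ δ > 0, ∀ x t, ‖x‖ < δ → 0 ≤ t → ‖fderiv ℝ (fun z => f z t) x‖ ≤ S.d δ
  bound_t : ∀ δ > 0, ∀ x t, ‖x‖ < δ → 0 ≤ t → ‖derivWithin (f x) (Ici 0) t‖ ≤ S.b δ

/-- `l̄_θ`, `l̄_σ` are valid rate bounds in the parametrization of the lumped uncertainty: along every
trajectory of the cascaded system on some `[0, τ]` with `‖x‖ ≤ ρ_x` and `‖u‖ ≤ ρ_u`,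
`f̄ = C_z x_f + D_z f(x, t)` can be written as `θ ‖x_g‖ + σ` with `‖θ‖ ≤ d̄`, `‖σ‖ ≤ b̄` and
`θ`, `σ` changing at rates at most `l̄_θ`, `l̄_σ` (Lipschitz constants). -/
def RateBounds (ω : ℝ) (f : (Fin n → ℝ) → ℝ → Fin m → ℝ) (lθ lσ : ℝ) : Prop :=
  ∀ τ : ℝ, 0 < τ → ∀ (u : ℝ → Fin m → ℝ) (xv x : ℝ → Fin n → ℝ) (xu xf : ℝ → Fin nz → ℝ)
    (fbar : ℝ → Fin m → ℝ),
    ContinuousOn u (Icc 0 τ) → xu 0 = 0 → xf 0 = 0 →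
    (∀ t ∈ Icc 0 τ,
      x t = S.Tg ω *ᵥ Sum.elim (xv t) (xu t) + S.Tz *ᵥ xf t ∧
      fbar t = S.Cz *ᵥ xf t + S.Dz *ᵥ f (x t) t ∧
      HasDerivWithinAt xu (S.Az *ᵥ xu t + S.Bz *ᵥ u t) (Icc 0 τ) t ∧
      HasDerivWithinAt xf (S.Az *ᵥ xf t + S.Bz *ᵥ f (x t) t) (Icc 0 τ) t ∧
      HasDerivWithinAt xv (S.Am *ᵥ xv t +
        S.Bbar *ᵥ (ω • (S.Cz *ᵥ xu t + S.Dz *ᵥ u t) + fbar t)) (Icc 0 τ) t ∧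
      ‖x t‖ ≤ S.ρx ∧ ‖u t‖ ≤ S.ρu ω) →
    ∃ θ σ : ℝ → Fin m → ℝ,
      (∀ t ∈ Icc 0 τ, fbar t = ‖(Sum.elim (xv t) (xu t) : Fin n ⊕ Fin nz → ℝ)‖ • θ t + σ t ∧
        ‖θ t‖ ≤ S.dbar ∧ ‖σ t‖ ≤ S.bbar) ∧
      ∀ s ∈ Icc 0 τ, ∀ t ∈ Icc 0 τ,
        ‖θ s - θ t‖ ≤ lθ * |s - t| ∧ ‖σ s - σ t‖ ≤ lσ * |s - t|

end Design

/-! ### The closed loop -/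

/-- Adaptation gains, and the relative layer widths of the three projection operators. -/
structure Gains where
  Γω : ℝ
  Γθ : ℝ
  Γσ : ℝ
  εω : ℝ
  εθ : ℝ
  εσ : ℝ

/-- `Γ` -/
def Gains.Γ (K : Gains) : ℝ := min K.Γω (min K.Γθ K.Γσ)

/-- The gains and layer widths are positive, `Γ > θ₁ / ε_γ²`, and the layers are thin. -/
structure Gains.Admissible {n m p nz mr : ℕ} (K : Gains) (S : Design n m p nz mr) (lθ lσ : ℝ) :
    Prop where
  Γω_pos : 0 < K.Γω
  Γθ_pos : 0 < K.Γθ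
  Γσ_pos : 0 < K.Γσ
  large : S.θ1 lθ lσ / S.εγ ^ 2 < K.Γ
  εω_mem : K.εω ∈ Ioc 0 (3 * S.ωu ^ 2 / S.θ1 lθ lσ)
  εθ_mem : K.εθ ∈ Ioc 0 (3 * S.ωu ^ 2 / S.θ1 lθ lσ)
  εσ_mem : K.εσ ∈ Ioc 0 (3 * S.ωu ^ 2 / S.θ1 lθ lσ)

/-- The signals of the closed loop: plant state, input, input filter state, predictor states and
adaptive estimates. -/
structure Signals (n m p nz : ℕ) where
  x : ℝ → Fin n → ℝ
  u : ℝ → Fin m → ℝ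
  xu : ℝ → Fin nz → ℝ
  vhat : ℝ → Fin n → ℝ
  yhat : ℝ → Fin p → ℝ
  ωhat : ℝ → ℝ
  θhat : ℝ → Fin m → ℝ
  σhat : ℝ → Fin m → ℝ

/-- The time interval `[0, T)`, `T ≤ ∞`. -/
def timeDom (T : EReal) : Set ℝ := {t | 0 ≤ t ∧ (t : EReal) < T}

namespace Signals

variable {n m p nz mr : ℕ} (c : Signals n m p nz) (S : Design n m p nz mr)

/-- `y` -/
def y (t : ℝ) : Fin p → ℝ := S.Cm *ᵥ c.x t

/-- `ỹ` -/
def ytil (t : ℝ) : Fin p → ℝ := c.yhat t - c.y S t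

/-- `x̂_v` -/
def xvhat (t : ℝ) : Fin n → ℝ := c.vhat t + S.H *ᵥ c.y S t

/-- `x̂_g` -/
def xghat (t : ℝ) : Fin n ⊕ Fin nz → ℝ := Sum.elim (c.xvhat S t) (c.xu t)

/-- `u_z` -/
def uz (t : ℝ) : Fin m → ℝ := S.Cz *ᵥ c.xu t + S.Dz *ᵥ c.u t

/-- `η̂_t` -/
def ηhat (t : ℝ) : Fin m → ℝ := c.ωhat t • c.uz S t + ‖c.xghat S t‖ • c.θhat t + c.σhat t

/-- `e_y` -/
def ey (t : ℝ) : Fin m → ℝ := S.Bbarᵀ *ᵥ (S.Cmᵀ *ᵥ (S.Py *ᵥ c.ytil S t))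

/-- The signals form a solution on `[0, T)` of the plant with initial state `x₀` under the adaptive
output feedback controller. The projection operators act with respect to the known sets
`ω ∈ [ωl, ωu]`, `|θ|₂ ≤ √m d̄`, `|σ|₂ ≤ √m b̄`. -/
structure IsClosedLoop (K : Gains) (ω : ℝ) (f : (Fin n → ℝ) → ℝ → Fin m → ℝ) (x0 : Fin n → ℝ)
    (T : EReal) : Prop where
  x_init : c.x 0 = x0
  x_ode : ∀ t ∈ timeDom T,
    HasDerivWithinAt c.x (S.Am *ᵥ c.x t + S.Bm *ᵥ (ω • c.u t + f (c.x t) t)) (Ici 0) t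
  u_cont : ContinuousOn c.u (timeDom T)
  u_law : ∀ t ∈ timeDom T, c.u t = -response (S.D * S.Z⁻¹)
    (fun τ => c.ηhat S τ - response S.Z (fun τ' => S.Kg *ᵥ S.r τ') τ) t
  xu_init : c.xu 0 = 0
  xu_ode : ∀ t ∈ timeDom T, HasDerivWithinAt c.xu (S.Az *ᵥ c.xu t + S.Bz *ᵥ c.u t) (Ici 0) t
  vhat_init : c.vhat 0 = 0
  vhat_ode : ∀ t ∈ timeDom T, HasDerivWithinAt c.vhat
    (S.Av *ᵥ c.xvhat S t - S.Kv *ᵥ c.y S t - (S.Pv⁻¹ * S.Amᵀ * S.Cmᵀ * S.Py) *ᵥ c.ytil S t)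
    (Ici 0) t
  yhat_init : c.yhat 0 = S.Cm *ᵥ x0
  yhat_ode : ∀ t ∈ timeDom T, HasDerivWithinAt c.yhat
    (-(S.α • c.ytil S t) + (S.Cm * S.Am) *ᵥ c.xvhat S t + (S.Cm * S.Bbar) *ᵥ c.ηhat S t) (Ici 0) t
  ωhat_init : c.ωhat 0 = 1
  ωhat_ode : ∀ t ∈ timeDom T, HasDerivWithinAt c.ωhat
    (K.Γω * projScalar ((S.ωl + S.ωu) / 2) ((S.ωu - S.ωl) / 2) K.εω (c.ωhat t)
      (-(c.uz S t ⬝ᵥ c.ey S t))) (Ici 0) t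
  θhat_init : c.θhat 0 = 0
  θhat_ode : ∀ t ∈ timeDom T, HasDerivWithinAt c.θhat
    (K.Γθ • proj 0 (√m * S.dbar) K.εθ (c.θhat t) (-(‖c.xghat S t‖ • c.ey S t))) (Ici 0) t
  σhat_init : c.σhat 0 = 0
  σhat_ode : ∀ t ∈ timeDom T, HasDerivWithinAt c.σhat
    (K.Γσ • proj 0 (√m * S.bbar) K.εσ (c.σhat t) (-(c.ey S t))) (Ici 0) t

end Signals

/-- `(xref, uref)` is a solution on `[0, T)` of the closed-loop reference system. -/
structure IsReference {n m p nz mr : ℕ} (S : Design n m p nz mr) (ω : ℝ)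
    (f : (Fin n → ℝ) → ℝ → Fin m → ℝ) (xref : ℝ → Fin n → ℝ) (uref : ℝ → Fin m → ℝ)
    (T : EReal) : Prop where
  x_init : xref 0 = 0
  x_ode : ∀ t ∈ timeDom T,
    HasDerivWithinAt xref (S.Am *ᵥ xref t + S.Bm *ᵥ (ω • uref t + f (xref t) t)) (Ici 0) t
  u_law : ∀ t ∈ timeDom T,
    uref t = response (S.C0 ω) (fun τ => S.Kg *ᵥ S.r τ - f (xref τ) τ) t

end L1Control

end


noncomputable section

namespace L1Control

/-! ### The Borel transform of a power series -/

section Borel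

variable {𝕜 : Type*} [RCLike 𝕜]

/-- The inverse Laplace transform of the function part of `∑ₖ aₖ s⁻ᵏ`. -/
def borel (a : PowerSeries 𝕜) (t : ℝ) : 𝕜 :=
  ∑' k : ℕ, (t ^ k / (k.factorial : ℝ)) • PowerSeries.coeff (k + 1) a

/-- The coefficients grow at most geometrically. -/
def GeomBounded (a : PowerSeries 𝕜) : Prop :=
  ∃ M R : ℝ, 0 ≤ M ∧ 0 ≤ R ∧ ∀ k, ‖PowerSeries.coeff k a‖ ≤ M * R ^ k

theorem GeomBounded.exists_bound {a : PowerSeries 𝕜} (ha : GeomBounded a) (T : ℝ) :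
    ∃ w : ℕ → ℝ, Summable w ∧ (∀ k, 0 ≤ w k) ∧ ∀ k, ∀ t : ℝ, |t| ≤ T →
      ‖(t ^ k / (k.factorial : ℝ)) • PowerSeries.coeff (k + 1) a‖ ≤ w k := by
  obtain ⟨M, R, hM, hR, h⟩ := ha
  refine ⟨fun k => (M * R) * ((|T| * R) ^ k / (k.factorial : ℝ)),
    (Real.summable_pow_div_factorial _).mul_left _, fun k => by positivity, fun k t ht => ?_⟩
  rw [norm_smul, norm_div, norm_pow, Real.norm_eq_abs, Real.norm_natCast]
  calc |t| ^ k / (k.factorial : ℝ) * ‖PowerSeries.coeff (k + 1) a‖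
      ≤ |T| ^ k / (k.factorial : ℝ) * (M * R ^ (k + 1)) := by
        have := ht.trans (le_abs_self T)
        have := h (k + 1)
        have : |t| ^ k ≤ |T| ^ k := pow_le_pow_left₀ (abs_nonneg t) ‹_› k
        gcongr
    _ = _ := by ring

theorem GeomBounded.summable {a : PowerSeries 𝕜} (ha : GeomBounded a) (t : ℝ) :
    Summable fun k : ℕ => ‖(t ^ k / (k.factorial : ℝ)) • PowerSeries.coeff (k + 1) a‖ := by
  obtain ⟨w, hw, -, h⟩ := ha.exists_bound |t|
  exact Summable.of_nonneg_of_le (fun _ => norm_nonneg _) (fun k => h k t le_rfl) hw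

theorem GeomBounded.continuous_borel {a : PowerSeries 𝕜} (ha : GeomBounded a) :
    Continuous (borel a) := by
  rw [continuous_iff_continuousAt]
  intro t₀
  obtain ⟨w, hw, -, h⟩ := ha.exists_bound (|t₀| + 1)
  have hc : ContinuousOn (borel a) (Metric.ball t₀ 1) := by
    unfold borel
    refine continuousOn_tsum (fun k => by fun_prop) hw fun k t ht => h k t ?_
    rw [Metric.mem_ball, Real.dist_eq] at ht
    have := abs_sub_abs_le_abs_sub t t₀
    linarith
  exact hc.continuousAt (Metric.ball_mem_nhds _ one_pos)

theorem integral_sub_pow_mul_pow_div_factorial (t : ℝ) (i j : ℕ) :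
    ∫ τ in (0 : ℝ)..t, (t - τ) ^ i / (i.factorial : ℝ) * (τ ^ j / (j.factorial : ℝ)) =
      t ^ (i + j + 1) / ((i + j + 1).factorial : ℝ) := by
  induction i generalizing j with
  | zero =>
    simp only [pow_zero, Nat.factorial_zero, Nat.cast_one, div_one, one_mul,
      intervalIntegral.integral_div, integral_pow, zero_add]
    rw [Nat.factorial_succ]
    push_cast
    field_simp
    simp
  | succ i ih =>
    have hd : ∀ τ : ℝ, HasDerivAt
        (fun τ : ℝ => (t - τ) ^ (i + 1) / ((i + 1).factorial : ℝ) *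
          (τ ^ (j + 1) / ((j + 1).factorial : ℝ)))
        ((t - τ) ^ (i + 1) / ((i + 1).factorial : ℝ) * (τ ^ j / (j.factorial : ℝ)) -
          (t - τ) ^ i / (i.factorial : ℝ) * (τ ^ (j + 1) / ((j + 1).factorial : ℝ))) τ := by
      intro τ
      have h1 : HasDerivAt (fun τ : ℝ => t - τ) (-1) τ := by
        simpa using (hasDerivAt_id τ).const_sub t
      have h2 := ((h1.pow (i + 1)).div_const ((i + 1).factorial : ℝ)).mul
        (((hasDerivAt_id τ).pow (j + 1)).div_const ((j + 1).factorial : ℝ))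
      refine h2.congr_deriv ?_
      have := Nat.factorial_ne_zero i
      have := Nat.factorial_ne_zero j
      simp only [Nat.factorial_succ, id, add_tsub_cancel_right]
      push_cast
      field_simp
      simp
      ring
    have h3 := intervalIntegral.integral_eq_sub_of_hasDerivAt (a := 0) (b := t)
      (fun τ _ => hd τ) (Continuous.intervalIntegrable (by fun_prop) _ _)
    rw [intervalIntegral.integral_sub (Continuous.intervalIntegrable (by fun_prop) _ _)
      (Continuous.intervalIntegrable (by fun_prop) _ _), ih (j + 1)] at h3
    simp only [sub_self, ne_eq, Nat.add_eq_zero_iff, one_ne_zero, and_false, not_false_eq_true,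
      zero_pow, zero_div, zero_mul, mul_zero] at h3
    rw [show i + 1 + j + 1 = i + (j + 1) + 1 by ring]
    linarith

theorem hasSum_integral_borel_mul_borel {a b : PowerSeries 𝕜} (ha : GeomBounded a)
    (hb : GeomBounded b) (t : ℝ) (ht : 0 ≤ t) :
    HasSum (fun k : ℕ => (t ^ (k + 1) / ((k + 1).factorial : ℝ)) •
      ∑ q ∈ Finset.HasAntidiagonal.antidiagonal k,
        PowerSeries.coeff (q.1 + 1) a * PowerSeries.coeff (q.2 + 1) b)
      (∫ τ in (0 : ℝ)..t, borel a (t - τ) * borel b τ) := by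
  obtain ⟨wa, hwa, hwa0, hA⟩ := ha.exists_bound t
  obtain ⟨wb, hwb, hwb0, hB⟩ := hb.exists_bound t
  have habs : ∀ τ ∈ Set.uIoc (0 : ℝ) t, |t - τ| ≤ t ∧ |τ| ≤ t := by
    intro τ hτ
    rw [uIoc_of_le ht, mem_Ioc] at hτ
    constructor <;> rw [abs_le] <;> constructor <;> linarith [hτ.1, hτ.2]
  let F : ℕ × ℕ → ℝ → 𝕜 := fun q τ =>
    (((t - τ) ^ q.1 / (q.1.factorial : ℝ)) • PowerSeries.coeff (q.1 + 1) a) *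
      ((τ ^ q.2 / (q.2.factorial : ℝ)) • PowerSeries.coeff (q.2 + 1) b)
  have hlim : ∀ τ, HasSum (fun q => F q τ) (borel a (t - τ) * borel b τ) := by
    intro τ
    have e1 := ha.summable (t - τ)
    have e2 := hb.summable τ
    have e3 := summable_mul_of_summable_norm e1 e2
    have e4 := e1.of_norm.hasSum.mul e2.of_norm.hasSum e3
    rw [borel, borel]
    exact e4
  have hbound : ∀ q, ∀ τ ∈ Set.uIoc (0 : ℝ) t, ‖F q τ‖ ≤ wa q.1 * wb q.2 := fun q τ hτ =>
    (norm_mul_le _ _).trans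
      (mul_le_mul (hA _ _ (habs τ hτ).1) (hB _ _ (habs τ hτ).2) (norm_nonneg _) (hwa0 _))
  have hF : ∀ i j, ∫ τ in (0 : ℝ)..t, F (i, j) τ = (t ^ (i + j + 1) / ((i + j + 1).factorial : ℝ)) •
      (PowerSeries.coeff (i + 1) a * PowerSeries.coeff (j + 1) b) := fun i j => by
    simp only [F, smul_mul_smul_comm]
    rw [intervalIntegral.integral_smul_const, integral_sub_pow_mul_pow_div_factorial]
  have h1 : HasSum (fun q => ∫ τ in (0 : ℝ)..t, F q τ)
      (∫ τ in (0 : ℝ)..t, borel a (t - τ) * borel b τ) :=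
    intervalIntegral.hasSum_integral_of_dominated_convergence (fun q _ => wa q.1 * wb q.2)
      (fun q => Continuous.aestronglyMeasurable (by fun_prop))
      (fun q => Eventually.of_forall (hbound q))
      (Eventually.of_forall fun τ _ => hwa.mul_of_nonneg hwb hwa0 hwb0)
      (by simp) (Eventually.of_forall fun τ _ => hlim τ)
  rw [← Finset.HasAntidiagonal.sigmaAntidiagonalEquivProd.hasSum_iff] at h1
  have h2 := h1.sigma fun k => hasSum_fintype _
  refine h2.congr_fun fun k => ?_
  rw [Finset.smul_sum, ← Finset.sum_coe_sort]
  refine Finset.sum_congr rfl fun q _ => ?_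
  obtain ⟨⟨i, j⟩, hq⟩ := q
  have hij : i + j = k := by simpa using hq
  simp only [Function.comp, Finset.HasAntidiagonal.sigmaAntidiagonalEquivProd_apply, hF, hij]

theorem borel_mul {a b : PowerSeries 𝕜} (ha : GeomBounded a) (hb : GeomBounded b) (t : ℝ)
    (ht : 0 ≤ t) :
    borel (a * b) t = PowerSeries.coeff 0 a * borel b t + PowerSeries.coeff 0 b * borel a t +
      ∫ τ in (0 : ℝ)..t, borel a (t - τ) * borel b τ := by
  have h1 := (ha.summable t).of_norm.hasSum.mul_left (PowerSeries.coeff 0 b)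
  have h2 := (hb.summable t).of_norm.hasSum.mul_left (PowerSeries.coeff 0 a)
  have h3 := hasSum_integral_borel_mul_borel ha hb t ht
  set F : ℕ → 𝕜 := fun k => Nat.casesOn k 0 fun k => (t ^ (k + 1) / ((k + 1).factorial : ℝ)) •
      ∑ q ∈ Finset.HasAntidiagonal.antidiagonal k,
        PowerSeries.coeff (q.1 + 1) a * PowerSeries.coeff (q.2 + 1) b with hF
  have h4 : HasSum F (∫ τ in (0 : ℝ)..t, borel a (t - τ) * borel b τ) := by
    rw [← hasSum_nat_add_iff' 1]
    simpa [hF] using h3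
  refine (((h2.add h1).add h4).congr_fun fun k => ?_).tsum_eq
  cases k with
  | zero =>
    simp [hF, PowerSeries.coeff_mul, Finset.Nat.antidiagonal_succ]
    ring
  | succ k =>
    rw [PowerSeries.coeff_mul, Finset.Nat.antidiagonal_succ_succ']
    simp only [hF, Finset.sum_cons, Finset.sum_map, Function.Embedding.coe_prodMap,
      Function.Embedding.coeFn_mk, Prod.map, smul_add, mul_smul_comm, Nat.succ_eq_add_one]
    rw [mul_comm (PowerSeries.coeff (k + 2) a), ← add_assoc]

theorem exists_coeff_bound (P : Polynomial 𝕜) : ∃ c : ℝ, 0 ≤ c ∧ ∀ k, ‖P.coeff k‖ ≤ c := by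
  refine ⟨∑ k ∈ P.support, ‖P.coeff k‖, Finset.sum_nonneg fun _ _ => norm_nonneg _, fun k => ?_⟩
  by_cases hk : k ∈ P.support
  · exact Finset.single_le_sum (f := fun k => ‖P.coeff k‖) (fun _ _ => norm_nonneg _) hk
  · rw [Polynomial.notMem_support_iff.1 hk, norm_zero]
    exact Finset.sum_nonneg fun _ _ => norm_nonneg _

theorem GeomBounded.of_mul_eq {a : PowerSeries 𝕜} {P Q : Polynomial 𝕜} (hQ : Q.coeff 0 ≠ 0)
    (h : a * (Q : PowerSeries 𝕜) = (P : PowerSeries 𝕜)) : GeomBounded a := by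
  obtain ⟨cP, hcP, hP⟩ := exists_coeff_bound P
  obtain ⟨cQ, hcQ, hQb⟩ := exists_coeff_bound Q
  set q : ℝ := ‖Q.coeff 0‖ with hq
  have hq0 : 0 < q := norm_pos_iff.2 hQ
  set c : ℝ := (cP + cQ) / q with hc
  have hc0 : 0 ≤ c := by positivity
  have hcq : c * q = cP + cQ := by rw [hc]; field_simp
  refine ⟨c, 1 + c, hc0, by linarith, fun k => ?_⟩
  induction k using Nat.strong_induction_on with
  | _ k ih =>
    rw [mul_comm] at h
    have hk := congrArg (PowerSeries.coeff k) h
    rw [PowerSeries.coeff_mul, Polynomial.coeff_coe] at hk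
    cases k with
    | zero =>
      simp only [Finset.Nat.antidiagonal_zero, Finset.sum_singleton, Polynomial.coeff_coe] at hk
      rw [pow_zero, mul_one]
      refine le_of_mul_le_mul_left (a := q) ?_ hq0
      rw [hq, ← norm_mul, hk, ← hq, mul_comm, hcq]
      linarith [hP 0]
    | succ k =>
      rw [Finset.Nat.sum_antidiagonal_succ] at hk
      simp only [Polynomial.coeff_coe] at hk
      have h1 : ‖∑ x ∈ Finset.HasAntidiagonal.antidiagonal k,
          Q.coeff (x.1 + 1) * PowerSeries.coeff x.2 a‖ ≤
            cQ * ∑ j ∈ Finset.range (k + 1), c * (1 + c) ^ j := by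
        rw [Finset.mul_sum, ← Finset.Nat.sum_antidiagonal_swap]
        refine (norm_sum_le _ _).trans ?_
        rw [Finset.Nat.sum_antidiagonal_eq_sum_range_succ_mk]
        refine Finset.sum_le_sum fun j hj => ?_
        simp only [Prod.fst_swap, Prod.snd_swap, norm_mul]
        exact mul_le_mul (hQb _) (ih j (by simpa [Nat.lt_succ_iff] using hj))
          (norm_nonneg _) hcQ
      have h2 : ∑ j ∈ Finset.range (k + 1), c * (1 + c) ^ j = (1 + c) ^ (k + 1) - 1 := by
        have := mul_geom_sum (1 + c) (k + 1)
        rw [← Finset.mul_sum]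
        linarith
      have h3 : 1 ≤ (1 + c) ^ (k + 1) := one_le_pow₀ (by linarith)
      refine le_of_mul_le_mul_left (a := q) ?_ hq0
      rw [hq, ← norm_mul, eq_sub_of_add_eq hk]
      refine (norm_sub_le _ _).trans ?_
      rw [h2] at h1
      rw [← hq]
      calc _ ≤ cP + cQ * ((1 + c) ^ (k + 1) - 1) := add_le_add (hP _) h1
        _ ≤ (c * q) * (1 + c) ^ (k + 1) := by rw [hcq]; nlinarith
        _ = _ := by ring

/-- Exponential decay on `[0, ∞)`. -/
def ExpDecay (φ : ℝ → 𝕜) : Prop :=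
  ∃ C β : ℝ, 0 ≤ C ∧ 0 < β ∧ ∀ t, 0 ≤ t → ‖φ t‖ ≤ C * Real.exp (-β * t)

theorem ExpDecay.mono_rate {φ : ℝ → 𝕜} {C β β' : ℝ} (hC : 0 ≤ C) (hβ : β' ≤ β)
    (h : ∀ t, 0 ≤ t → ‖φ t‖ ≤ C * Real.exp (-β * t)) :
    ∀ t, 0 ≤ t → ‖φ t‖ ≤ C * Real.exp (-β' * t) := fun t ht =>
  (h t ht).trans (mul_le_mul_of_nonneg_left (Real.exp_le_exp.2 (by nlinarith)) hC)

theorem ExpDecay.add {φ ψ : ℝ → 𝕜} (hφ : ExpDecay φ) (hψ : ExpDecay ψ) :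
    ExpDecay fun t => φ t + ψ t := by
  obtain ⟨C, β, hC, hβ, h⟩ := hφ
  obtain ⟨C', β', hC', hβ', h'⟩ := hψ
  refine ⟨C + C', min β β', by positivity, lt_min hβ hβ', fun t ht => ?_⟩
  rw [add_mul]
  exact (norm_add_le _ _).trans (add_le_add (mono_rate hC (min_le_left _ _) h t ht)
    (mono_rate hC' (min_le_right _ _) h' t ht))

theorem ExpDecay.const_mul {φ : ℝ → 𝕜} (c : 𝕜) (hφ : ExpDecay φ) : ExpDecay fun t => c * φ t := by
  obtain ⟨C, β, hC, hβ, h⟩ := hφ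
  refine ⟨‖c‖ * C, β, by positivity, hβ, fun t ht => ?_⟩
  rw [norm_mul, mul_assoc]
  exact mul_le_mul_of_nonneg_left (h t ht) (norm_nonneg _)

theorem ExpDecay.convolution {φ ψ : ℝ → 𝕜} (hφ : ExpDecay φ) (hψ : ExpDecay ψ) :
    ExpDecay fun t => ∫ τ in (0 : ℝ)..t, φ (t - τ) * ψ τ := by
  obtain ⟨C, β₁, hC, hβ₁, h⟩ := hφ
  obtain ⟨C', β₂, hC', hβ₂, h'⟩ := hψ
  set β := min β₁ β₂ with hβdef
  have hβ : 0 < β := lt_min hβ₁ hβ₂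
  have h := mono_rate hC (min_le_left β₁ β₂) h
  have h' := mono_rate hC' (min_le_right β₁ β₂) h'
  rw [← hβdef] at h h'
  refine ⟨C * C' * (2 / β), β / 2, by positivity, by positivity, fun t ht => ?_⟩
  have h1 : ∀ τ ∈ Set.uIoc 0 t, ‖φ (t - τ) * ψ τ‖ ≤ C * C' * Real.exp (-β * t) := by
    intro τ hτ
    rw [uIoc_of_le ht, mem_Ioc] at hτ
    rw [norm_mul]
    calc _ ≤ (C * Real.exp (-β * (t - τ))) * (C' * Real.exp (-β * τ)) :=
          mul_le_mul (h _ (by linarith)) (h' _ hτ.1.le) (norm_nonneg _) (by positivity)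
      _ = C * C' * (Real.exp (-β * (t - τ)) * Real.exp (-β * τ)) := by ring
      _ = _ := by rw [← Real.exp_add]; ring_nf
  have h2 := intervalIntegral.norm_integral_le_of_norm_le_const h1
  rw [sub_zero, abs_of_nonneg ht] at h2
  refine h2.trans ?_
  have h3 : β / 2 * t ≤ Real.exp (β / 2 * t) := by linarith [Real.add_one_le_exp (β / 2 * t)]
  have h4 : t ≤ 2 / β * Real.exp (β / 2 * t) := by
    rw [div_mul_eq_mul_div, le_div_iff₀ hβ]; linarith
  calc C * C' * Real.exp (-β * t) * t
      ≤ C * C' * Real.exp (-β * t) * (2 / β * Real.exp (β / 2 * t)) := by gcongr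
    _ = C * C' * (2 / β) * (Real.exp (-β * t) * Real.exp (β / 2 * t)) := by ring
    _ = _ := by rw [← Real.exp_add]; ring_nf

end Borel

/-! ### Exponential decay of stable impulse responses -/

/-- The expansion of `1 / (s - z)`. -/
def geomSeries (z : ℂ) : PowerSeries ℂ := PowerSeries.X * PowerSeries.mk fun k => z ^ k

theorem geomSeries_mul (z : ℂ) :
    geomSeries z * ((1 - Polynomial.C z * Polynomial.X : Polynomial ℂ) : PowerSeries ℂ) =
      ((Polynomial.X : Polynomial ℂ) : PowerSeries ℂ) := by
  have h : (PowerSeries.mk fun k => z ^ k) * (1 - PowerSeries.C z * PowerSeries.X) = 1 := by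
    ext k
    rw [mul_sub, mul_one, mul_left_comm, ← mul_assoc, map_sub]
    cases k with
    | zero => simp
    | succ k => simp [PowerSeries.coeff_succ_mul_X, pow_succ', PowerSeries.coeff_one]
  push_cast
  rw [geomSeries, mul_assoc, h, mul_one]

theorem borel_geomSeries (z : ℂ) (t : ℝ) : borel (geomSeries z) t = Complex.exp (z * t) := by
  rw [Complex.exp_eq_exp_ℂ, NormedSpace.exp_eq_tsum_div, borel]
  refine tsum_congr fun k => ?_
  rw [geomSeries, PowerSeries.coeff_succ_X_mul, PowerSeries.coeff_mk, Complex.real_smul]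
  push_cast
  ring

theorem geomBounded_geomSeries (z : ℂ) : GeomBounded (geomSeries z) :=
  GeomBounded.of_mul_eq (by simp) (geomSeries_mul z)

theorem expDecay_borel_geomSeries {z : ℂ} (hz : z.re < 0) : ExpDecay (borel (geomSeries z)) := by
  refine ⟨1, -z.re, zero_le_one, by linarith, fun t _ => ?_⟩
  rw [borel_geomSeries, Complex.norm_exp]
  simp

theorem borel_add {𝕜 : Type*} [RCLike 𝕜] {a b : PowerSeries 𝕜} (ha : GeomBounded a)
    (hb : GeomBounded b) (t : ℝ) : borel (a + b) t = borel a t + borel b t := by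
  rw [borel, borel, borel, ← (ha.summable t).of_norm.tsum_add (hb.summable t).of_norm]
  exact tsum_congr fun k => by rw [map_add, smul_add]

theorem natDegree_prod_X_sub_C (s : Multiset ℂ) :
    (s.map fun z => Polynomial.X - Polynomial.C z).prod.natDegree = Multiset.card s :=
  Polynomial.natDegree_multiset_prod_X_sub_C_eq_card s

theorem coeff_zero_reflect_prod (s : Multiset ℂ) :
    ((s.map fun z => Polynomial.X - Polynomial.C z).prod.reflect (Multiset.card s)).coeff 0 = 1 := by
  rw [Polynomial.coeff_reflect, Polynomial.revAt_zero, ← natDegree_prod_X_sub_C,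
    Polynomial.coeff_natDegree]
  exact (Polynomial.monic_multiset_prod_of_monic _ _ fun z _ => Polynomial.monic_X_sub_C z)

theorem coe_ne_zero_of_coeff_zero {Q : Polynomial ℂ} (hQ : Q.coeff 0 ≠ 0) :
    (Q : PowerSeries ℂ) ≠ 0 := by
  intro h
  apply hQ
  rw [← Polynomial.coeff_coe, h, map_zero]

theorem expDecay_borel_of_roots (s : Multiset ℂ) (hs : ∀ z ∈ s, z.re < 0) (P : Polynomial ℂ)
    (hP : P.natDegree ≤ Multiset.card s) (a : PowerSeries ℂ)
    (ha : a * (((s.map fun z => Polynomial.X - Polynomial.C z).prod.reflect (Multiset.card s) :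
      Polynomial ℂ) : PowerSeries ℂ) =
      ((P.reflect (Multiset.card s) : Polynomial ℂ) : PowerSeries ℂ)) :
    ExpDecay (borel a) := by
  induction s using Multiset.induction_on generalizing P a with
  | empty =>
    have hP0 : P.natDegree = 0 := by simpa using hP
    rw [Polynomial.eq_C_of_natDegree_eq_zero hP0] at ha
    simp at ha
    refine ⟨0, 1, le_rfl, one_pos, fun t _ => ?_⟩
    simp [borel, ha]
  | cons z s ih =>
    set N := Multiset.card s with hN
    set Q := (s.map fun z => Polynomial.X - Polynomial.C z).prod with hQ
    have hQ0 : (Q.reflect N).coeff 0 ≠ 0 := by rw [coeff_zero_reflect_prod]; exact one_ne_zero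
    have hQps := coe_ne_zero_of_coeff_zero hQ0
    have hQinv : ((Q.reflect N : Polynomial ℂ) : PowerSeries ℂ)⁻¹ *
        ((Q.reflect N : Polynomial ℂ) : PowerSeries ℂ) = 1 :=
      PowerSeries.inv_mul_cancel _ (by simpa using hQ0)
    have hlin : (Polynomial.X - Polynomial.C z).reflect 1 = 1 - Polynomial.C z * Polynomial.X := by
      simp
    set q := P /ₘ (Polynomial.X - Polynomial.C z) with hq
    set c := P.eval z with hc
    have hPq : P = (Polynomial.X - Polynomial.C z) * q + Polynomial.C c := by
      have := Polynomial.modByMonic_add_div P (Polynomial.X - Polynomial.C z)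
      rw [Polynomial.modByMonic_X_sub_C_eq_C_eval, add_comm] at this
      exact this.symm
    have hqdeg : q.natDegree ≤ N := by
      rw [hq, Polynomial.natDegree_divByMonic _ (Polynomial.monic_X_sub_C z),
        Polynomial.natDegree_X_sub_C]
      rw [Multiset.card_cons] at hP
      omega
    set aq : PowerSeries ℂ := ((q.reflect N : Polynomial ℂ) : PowerSeries ℂ) *
      ((Q.reflect N : Polynomial ℂ) : PowerSeries ℂ)⁻¹ with haq
    set b : PowerSeries ℂ := (((Polynomial.C c).reflect N : Polynomial ℂ) : PowerSeries ℂ) *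
      ((Q.reflect N : Polynomial ℂ) : PowerSeries ℂ)⁻¹ with hb
    have haq' : aq * ((Q.reflect N : Polynomial ℂ) : PowerSeries ℂ) =
        ((q.reflect N : Polynomial ℂ) : PowerSeries ℂ) := by rw [haq, mul_assoc, hQinv, mul_one]
    have hb' : b * ((Q.reflect N : Polynomial ℂ) : PowerSeries ℂ) =
        (((Polynomial.C c).reflect N : Polynomial ℂ) : PowerSeries ℂ) := by
      rw [hb, mul_assoc, hQinv, mul_one]
    have hlin0 : ((1 - Polynomial.C z * Polynomial.X : Polynomial ℂ)).coeff 0 ≠ 0 := by simp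
    have hsplit : a = aq + b * geomSeries z := by
      have hne : (((1 - Polynomial.C z * Polynomial.X : Polynomial ℂ) : PowerSeries ℂ) *
          ((Q.reflect N : Polynomial ℂ) : PowerSeries ℂ)) ≠ 0 :=
        mul_ne_zero (coe_ne_zero_of_coeff_zero hlin0) hQps
      apply mul_right_cancel₀ hne
      have h1 := ha
      rw [Multiset.map_cons, Multiset.prod_cons, Multiset.card_cons, ← hN, ← hQ, add_comm N 1,
        Polynomial.reflect_mul _ _ (Polynomial.natDegree_X_sub_C_le z) (natDegree_prod_X_sub_C s).le,
        hlin, Polynomial.coe_mul, hPq, Polynomial.reflect_add,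
        Polynomial.reflect_mul _ _ (Polynomial.natDegree_X_sub_C_le z) hqdeg, hlin] at h1
      rw [h1]
      have h2 : Polynomial.reflect (1 + N) (Polynomial.C c) =
          Polynomial.X * Polynomial.reflect N (Polynomial.C c) := by
        simp only [Polynomial.reflect_C]
        ring
      rw [h2, add_mul]
      push_cast
      have h3 := geomSeries_mul z
      push_cast at h3
      rw [← haq', ← hb']
      linear_combination -b * ((Q.reflect N : Polynomial ℂ) : PowerSeries ℂ) * h3
    have hgq : GeomBounded aq := GeomBounded.of_mul_eq hQ0 haq'
    have hgb : GeomBounded b := GeomBounded.of_mul_eq hQ0 hb'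
    have hdq : ExpDecay (borel aq) := ih (fun w hw => hs w (Multiset.mem_cons_of_mem hw)) q hqdeg aq haq'
    have hdb : ExpDecay (borel b) :=
      ih (fun w hw => hs w (Multiset.mem_cons_of_mem hw)) (Polynomial.C c) (by simp) b hb'
    have hde := expDecay_borel_geomSeries (hs z (Multiset.mem_cons_self z s))
    have hge := geomBounded_geomSeries z
    have hgm : GeomBounded (b * geomSeries z) := by
      refine GeomBounded.of_mul_eq (P := (Polynomial.C c).reflect N * Polynomial.X)
        (Q := Q.reflect N * (1 - Polynomial.C z * Polynomial.X)) ?_ ?_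
      · simpa [Polynomial.mul_coeff_zero] using hQ0
      · rw [Polynomial.coe_mul, Polynomial.coe_mul, mul_mul_mul_comm, hb', geomSeries_mul]
    obtain ⟨C, β, hC, hβ, h⟩ := hdq.add (((hde.const_mul (PowerSeries.coeff 0 b)).add
      (hdb.const_mul (PowerSeries.coeff 0 (geomSeries z)))).add (hdb.convolution hde))
    refine ⟨C, β, hC, hβ, fun t ht => ?_⟩
    rw [hsplit, borel_add hgq hgm, borel_mul hgb hge t ht]
    exact h t ht

end L1Control

end

noncomputable section

namespace L1Control

/-! ### Proper and stable rational functions -/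

/-- The expansion of a rational function at infinity in powers of `1 / s`. -/
def markovSeries (g : RatFunc ℝ) : PowerSeries ℝ :=
  ((g.num.reflect g.denom.natDegree : Polynomial ℝ) : PowerSeries ℝ) *
    ((g.denom.reflect g.denom.natDegree : Polynomial ℝ) : PowerSeries ℝ)⁻¹

theorem coeff_markovSeries (g : RatFunc ℝ) (k : ℕ) :
    PowerSeries.coeff k (markovSeries g) = markov g k := rfl

theorem coeff_zero_reflect_denom (g : RatFunc ℝ) :
    (g.denom.reflect g.denom.natDegree).coeff 0 = 1 := by
  rw [Polynomial.coeff_reflect, Polynomial.revAt_zero, Polynomial.coeff_natDegree]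
  exact g.monic_denom

theorem reflect_denom_ne_zero (g : RatFunc ℝ) :
    ((g.denom.reflect g.denom.natDegree : Polynomial ℝ) : PowerSeries ℝ) ≠ 0 := by
  intro h0
  have := coeff_zero_reflect_denom g
  rw [← Polynomial.coeff_coe, h0, map_zero] at this
  exact zero_ne_one this

theorem markovSeries_mul_reflect_denom (g : RatFunc ℝ) :
    markovSeries g * ((g.denom.reflect g.denom.natDegree : Polynomial ℝ) : PowerSeries ℝ) =
      ((g.num.reflect g.denom.natDegree : Polynomial ℝ) : PowerSeries ℝ) := by
  rw [markovSeries, mul_assoc, PowerSeries.inv_mul_cancel, mul_one]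
  rw [Polynomial.constantCoeff_coe, coeff_zero_reflect_denom]
  exact one_ne_zero

theorem markovSeries_eq_of_mul_eq {g : RatFunc ℝ} {a : PowerSeries ℝ}
    (h : a * ((g.denom.reflect g.denom.natDegree : Polynomial ℝ) : PowerSeries ℝ) =
      ((g.num.reflect g.denom.natDegree : Polynomial ℝ) : PowerSeries ℝ)) :
    markovSeries g = a := by
  exact mul_right_cancel₀ (reflect_denom_ne_zero g) ((markovSeries_mul_reflect_denom g).trans h.symm)

theorem geomBounded_markovSeries (g : RatFunc ℝ) : GeomBounded (markovSeries g) :=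
  GeomBounded.of_mul_eq (by rw [coeff_zero_reflect_denom]; exact one_ne_zero)
    (markovSeries_mul_reflect_denom g)

theorem impulse_eq_borel (g : RatFunc ℝ) : impulse g = borel (markovSeries g) := by
  funext t
  rw [impulse, borel]
  refine tsum_congr fun k => ?_
  rw [coeff_markovSeries, smul_eq_mul]
  ring

theorem continuous_impulse (g : RatFunc ℝ) : Continuous (impulse g) := by
  rw [impulse_eq_borel]
  exact (geomBounded_markovSeries g).continuous_borel

/-- The ring of proper rational functions. -/
def properRing : Subring (RatFunc ℝ) where
  carrier := {g | g.intDegree ≤ 0}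
  mul_mem' {a b} ha hb := by
    by_cases h1 : a = 0
    · simp [h1]
    by_cases h2 : b = 0
    · simp [h2]
    simp only [mem_ofPred_eq] at *
    rw [RatFunc.intDegree_mul h1 h2]
    linarith
  one_mem' := by simp
  add_mem' {a b} ha hb := by
    by_cases h1 : b = 0
    · simpa [h1] using ha
    by_cases h2 : a + b = 0
    · simp [h2]
    exact (RatFunc.intDegree_add_le h1 h2).trans (max_le ha hb)
  zero_mem' := by simp
  neg_mem' {a} ha := by simpa using ha

theorem mem_properRing {g : RatFunc ℝ} :
    g ∈ properRing ↔ g.num.natDegree ≤ g.denom.natDegree := by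
  change g.intDegree ≤ 0 ↔ _
  rw [RatFunc.intDegree]
  omega

theorem C_mem_properRing (c : ℝ) : RatFunc.C c ∈ properRing := by
  change RatFunc.intDegree _ ≤ 0
  simp

theorem X_inv_mem_properRing : (RatFunc.X : RatFunc ℝ)⁻¹ ∈ properRing := by
  change RatFunc.intDegree _ ≤ 0
  rw [RatFunc.intDegree_inv, RatFunc.intDegree_X]
  norm_num

theorem degree_num_lt_iff {g : RatFunc ℝ} :
    g.num.degree < g.denom.degree ↔ RatFunc.X * g ∈ properRing := by
  change _ ↔ RatFunc.intDegree _ ≤ 0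
  by_cases h : g = 0
  · simp [h]
  rw [RatFunc.intDegree_mul RatFunc.X_ne_zero h, RatFunc.intDegree_X, RatFunc.intDegree,
    Polynomial.degree_eq_natDegree (RatFunc.num_ne_zero h),
    Polynomial.degree_eq_natDegree g.denom_ne_zero, Nat.cast_lt]
  omega

theorem mem_properRing_of_X_mul {g : RatFunc ℝ} (h : RatFunc.X * g ∈ properRing) :
    g ∈ properRing := by
  have := properRing.mul_mem X_inv_mem_properRing h
  rwa [← mul_assoc, inv_mul_cancel₀ RatFunc.X_ne_zero, one_mul] at this

theorem markovSeries_mul_reflect {g : RatFunc ℝ} (hg : g ∈ properRing) {P Q : Polynomial ℝ}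
    (h : g.num * Q = P * g.denom) {N : ℕ} (hP : P.natDegree ≤ N) (hQ : Q.natDegree ≤ N) :
    markovSeries g * ((Q.reflect N : Polynomial ℝ) : PowerSeries ℝ) =
      ((P.reflect N : Polynomial ℝ) : PowerSeries ℝ) := by
  apply mul_right_cancel₀ (reflect_denom_ne_zero g)
  have h1 := congrArg (fun p => ((p.reflect (g.denom.natDegree + N) : Polynomial ℝ) :
    PowerSeries ℝ)) h
  beta_reduce at h1
  rw [Polynomial.reflect_mul _ _ (mem_properRing.1 hg) hQ, add_comm,
    Polynomial.reflect_mul _ _ hP le_rfl, Polynomial.coe_mul, Polynomial.coe_mul,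
    ← markovSeries_mul_reflect_denom] at h1
  rw [← h1]
  ring

theorem markovSeries_mul {g₁ g₂ : RatFunc ℝ} (h₁ : g₁ ∈ properRing) (h₂ : g₂ ∈ properRing) :
    markovSeries (g₁ * g₂) = markovSeries g₁ * markovSeries g₂ := by
  have h := markovSeries_mul_reflect (properRing.mul_mem h₁ h₂)
    (RatFunc.num_denom_mul g₁ g₂) (N := g₁.denom.natDegree + g₂.denom.natDegree)
    (Polynomial.natDegree_mul_le.trans (add_le_add (mem_properRing.1 h₁) (mem_properRing.1 h₂)))
    Polynomial.natDegree_mul_le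
  rw [Polynomial.reflect_mul _ _ le_rfl le_rfl,
    Polynomial.reflect_mul _ _ (mem_properRing.1 h₁) (mem_properRing.1 h₂), Polynomial.coe_mul,
    Polynomial.coe_mul, ← markovSeries_mul_reflect_denom, ← markovSeries_mul_reflect_denom g₂] at h
  apply mul_right_cancel₀ (mul_ne_zero (reflect_denom_ne_zero g₁) (reflect_denom_ne_zero g₂))
  rw [h]
  ring

theorem markovSeries_add {g₁ g₂ : RatFunc ℝ} (h₁ : g₁ ∈ properRing) (h₂ : g₂ ∈ properRing) :
    markovSeries (g₁ + g₂) = markovSeries g₁ + markovSeries g₂ := by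
  have hd1 := mem_properRing.1 h₁
  have hd2 := mem_properRing.1 h₂
  have e1 : (g₁.num * g₂.denom).natDegree ≤ g₁.denom.natDegree + g₂.denom.natDegree :=
    Polynomial.natDegree_mul_le.trans (add_le_add hd1 le_rfl)
  have e2 : (g₁.denom * g₂.num).natDegree ≤ g₁.denom.natDegree + g₂.denom.natDegree :=
    Polynomial.natDegree_mul_le.trans (add_le_add le_rfl hd2)
  have h := markovSeries_mul_reflect (properRing.add_mem h₁ h₂)
    (RatFunc.num_denom_add g₁ g₂) (N := g₁.denom.natDegree + g₂.denom.natDegree)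
    ((Polynomial.natDegree_add_le _ _).trans (max_le e1 e2))
    Polynomial.natDegree_mul_le
  rw [Polynomial.reflect_mul _ _ le_rfl le_rfl, Polynomial.reflect_add,
    Polynomial.reflect_mul _ _ hd1 le_rfl, Polynomial.reflect_mul _ _ le_rfl hd2,
    Polynomial.coe_mul, Polynomial.coe_add, Polynomial.coe_mul, Polynomial.coe_mul,
    ← markovSeries_mul_reflect_denom, ← markovSeries_mul_reflect_denom g₂] at h
  apply mul_right_cancel₀ (mul_ne_zero (reflect_denom_ne_zero g₁) (reflect_denom_ne_zero g₂))
  rw [h]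
  ring

theorem markovSeries_C (c : ℝ) : markovSeries (RatFunc.C c) = PowerSeries.C c := by
  apply markovSeries_eq_of_mul_eq
  simp [RatFunc.num_C, RatFunc.denom_C, Polynomial.natDegree_one]

theorem markovSeries_X_inv : markovSeries (RatFunc.X : RatFunc ℝ)⁻¹ = PowerSeries.X := by
  have h := markovSeries_mul_reflect X_inv_mem_properRing (P := 1) (Q := Polynomial.X) (N := 1)
    ?_ (by simp) (by simp)
  · have h1 : Polynomial.reflect 1 (1 : Polynomial ℝ) = Polynomial.X := by simp
    simpa [h1] using h
  · rw [RatFunc.num_mul_eq_mul_denom_iff Polynomial.X_ne_zero]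
    simp

theorem markov_zero_of_strict {g : RatFunc ℝ} (hg : RatFunc.X * g ∈ properRing) :
    markov g 0 = 0 := by
  have h : g = RatFunc.X⁻¹ * (RatFunc.X * g) := by
    rw [← mul_assoc, inv_mul_cancel₀ RatFunc.X_ne_zero, one_mul]
  rw [← coeff_markovSeries, h, markovSeries_mul X_inv_mem_properRing hg, markovSeries_X_inv]
  simp

theorem markov_succ_of_strict {g : RatFunc ℝ} (hg : RatFunc.X * g ∈ properRing) (k : ℕ) :
    markov g (k + 1) = markov (RatFunc.X * g) k := by
  have h : g = RatFunc.X⁻¹ * (RatFunc.X * g) := by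
    rw [← mul_assoc, inv_mul_cancel₀ RatFunc.X_ne_zero, one_mul]
  conv_lhs => rw [← coeff_markovSeries, h, markovSeries_mul X_inv_mem_properRing hg,
    markovSeries_X_inv, PowerSeries.coeff_succ_X_mul]
  rfl

theorem markov_add {g₁ g₂ : RatFunc ℝ} (h₁ : g₁ ∈ properRing) (h₂ : g₂ ∈ properRing) (k : ℕ) :
    markov (g₁ + g₂) k = markov g₁ k + markov g₂ k := by
  simp only [← coeff_markovSeries, markovSeries_add h₁ h₂, map_add]

theorem markov_zero_mul {g₁ g₂ : RatFunc ℝ} (h₁ : g₁ ∈ properRing) (h₂ : g₂ ∈ properRing) :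
    markov (g₁ * g₂) 0 = markov g₁ 0 * markov g₂ 0 := by
  simp only [← coeff_markovSeries, markovSeries_mul h₁ h₂]
  simp

theorem markov_C_mul (c : ℝ) {g : RatFunc ℝ} (h : g ∈ properRing) (k : ℕ) :
    markov (RatFunc.C c * g) k = c * markov g k := by
  rw [← coeff_markovSeries, markovSeries_mul (C_mem_properRing c) h, markovSeries_C]
  simp [coeff_markovSeries]

theorem impulse_add {g₁ g₂ : RatFunc ℝ} (h₁ : g₁ ∈ properRing) (h₂ : g₂ ∈ properRing) (t : ℝ) :
    impulse (g₁ + g₂) t = impulse g₁ t + impulse g₂ t := by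
  rw [impulse_eq_borel, impulse_eq_borel, impulse_eq_borel, markovSeries_add h₁ h₂]
  exact borel_add (geomBounded_markovSeries _) (geomBounded_markovSeries _) t

theorem impulse_mul {g₁ g₂ : RatFunc ℝ} (h₁ : g₁ ∈ properRing) (h₂ : g₂ ∈ properRing) {t : ℝ}
    (ht : 0 ≤ t) :
    impulse (g₁ * g₂) t = markov g₁ 0 * impulse g₂ t + markov g₂ 0 * impulse g₁ t +
      ∫ τ in (0 : ℝ)..t, impulse g₁ (t - τ) * impulse g₂ τ := by
  simp only [impulse_eq_borel, markovSeries_mul h₁ h₂, ← coeff_markovSeries]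
  exact borel_mul (geomBounded_markovSeries _) (geomBounded_markovSeries _) t ht

theorem impulse_C (c t : ℝ) : impulse (RatFunc.C c) t = 0 := by
  rw [impulse_eq_borel, markovSeries_C, borel]
  simp

theorem impulse_X_inv (t : ℝ) : impulse (RatFunc.X : RatFunc ℝ)⁻¹ t = 1 := by
  rw [impulse_eq_borel, markovSeries_X_inv, borel, tsum_eq_single 0]
  · simp
  · intro k hk
    simp [PowerSeries.coeff_X, hk]

/-- The ring of rational functions without poles in the closed right half-plane. -/
def stableRing : Subring (RatFunc ℝ) where
  carrier := {g | ∀ z : ℂ, Polynomial.aeval z g.denom = 0 → z.re < 0}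
  mul_mem' {a b} ha hb z hz := by
    obtain ⟨q, hq⟩ := RatFunc.denom_mul_dvd a b
    have h : Polynomial.aeval z (a.denom * b.denom) = 0 := by rw [hq, map_mul, hz, zero_mul]
    rw [map_mul, mul_eq_zero] at h
    exact h.elim (ha z) (hb z)
  one_mem' z hz := by simp at hz
  add_mem' {a b} ha hb z hz := by
    obtain ⟨q, hq⟩ := RatFunc.denom_add_dvd a b
    have h : Polynomial.aeval z (a.denom * b.denom) = 0 := by rw [hq, map_mul, hz, zero_mul]
    rw [map_mul, mul_eq_zero] at h
    exact h.elim (ha z) (hb z)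
  zero_mem' z hz := by simp at hz
  neg_mem' {a} ha z hz := by
    have h : (-a).denom = a.denom := by
      have h1 := RatFunc.denom_mul_dvd (RatFunc.C (-1)) a
      have h2 := RatFunc.denom_mul_dvd (RatFunc.C (-1)) (-a)
      rw [RatFunc.denom_C, one_mul, map_neg, map_one, neg_one_mul] at h1 h2
      rw [neg_neg] at h2
      exact Polynomial.eq_of_monic_of_associated (RatFunc.monic_denom _) (RatFunc.monic_denom _)
        (associated_of_dvd_dvd h1 h2)
    rw [h] at hz
    exact ha z hz

theorem polynomial_mem_stableRing (q : Polynomial ℝ) :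
    algebraMap (Polynomial ℝ) (RatFunc ℝ) q ∈ stableRing := by
  intro z hz
  rw [RatFunc.denom_algebraMap] at hz
  simp at hz

theorem C_mem_stableRing (c : ℝ) : RatFunc.C c ∈ stableRing := by
  have := polynomial_mem_stableRing (Polynomial.C c)
  rwa [RatFunc.algebraMap_C] at this

theorem X_mem_stableRing : (RatFunc.X : RatFunc ℝ) ∈ stableRing := by
  have := polynomial_mem_stableRing Polynomial.X
  rwa [RatFunc.algebraMap_X] at this

theorem borel_map_ofReal (a : PowerSeries ℝ) (t : ℝ) :
    borel (a.map Complex.ofRealHom) t = ((borel a t : ℝ) : ℂ) := by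
  rw [borel, borel, Complex.ofReal_tsum]
  refine tsum_congr fun k => ?_
  simp

theorem expDecay_impulse {g : RatFunc ℝ} (hp : g ∈ properRing) (hs : g ∈ stableRing) :
    ExpDecay (impulse g) := by
  set Q : Polynomial ℂ := g.denom.map Complex.ofRealHom with hQ
  have hsplit : Q = (Q.roots.map fun z => Polynomial.X - Polynomial.C z).prod :=
    (IsAlgClosed.splits Q).eq_prod_roots_of_monic (g.monic_denom.map _)
  have hcard : Multiset.card Q.roots = g.denom.natDegree := by
    rw [← natDegree_prod_X_sub_C, ← hsplit, hQ, Polynomial.natDegree_map]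
  have hmap : ∀ (N : ℕ) (p : Polynomial ℝ),
      ((p.map Complex.ofRealHom).reflect N : Polynomial ℂ) = (p.reflect N).map Complex.ofRealHom :=
    fun N p => by ext k; simp [Polynomial.coeff_reflect]
  have hcoe : ∀ p : Polynomial ℝ, ((p.map Complex.ofRealHom : Polynomial ℂ) : PowerSeries ℂ) =
      ((p : PowerSeries ℝ)).map Complex.ofRealHom := fun p => by ext k; simp
  have hroots : ∀ z ∈ Q.roots, z.re < 0 := fun z hz => by
    have := Polynomial.isRoot_of_mem_roots hz
    rw [Polynomial.IsRoot, hQ, Polynomial.eval_map] at this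
    exact hs z this
  obtain ⟨C, β, hC, hβ, h⟩ := expDecay_borel_of_roots Q.roots hroots
    (g.num.map Complex.ofRealHom) (by
      rw [Polynomial.natDegree_map, hcard]; exact mem_properRing.1 hp)
    ((markovSeries g).map Complex.ofRealHom) (by
      rw [← hsplit, hcard, hQ, hmap, hmap, hcoe, hcoe, ← map_mul, markovSeries_mul_reflect_denom])
  refine ⟨C, β, hC, hβ, fun t ht => ?_⟩
  have := h t ht
  rwa [borel_map_ofReal, Complex.norm_real, ← impulse_eq_borel] at this

end L1Control

end

noncomputable section

namespace L1Control

/-! ### Fubini on a triangle -/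

theorem integrable_triangle {K : ℝ × ℝ → ℝ} (hK : Continuous K) {v : ℝ → ℝ} {t : ℝ}
    (hv : IntegrableOn v (Ioc 0 t)) :
    Integrable (fun q : ℝ × ℝ => {q : ℝ × ℝ | q.2 ≤ q.1}.indicator K q * v q.2)
      ((volume.restrict (Ioc 0 t)).prod (volume.restrict (Ioc 0 t))) := by
  obtain ⟨c, hc⟩ := (isCompact_Icc.prod isCompact_Icc : IsCompact (Icc (0 : ℝ) t ×ˢ Icc (0 : ℝ) t))
    |>.exists_bound_of_continuousOn hK.continuousOn
  have hm : MeasurableSet {q : ℝ × ℝ | q.2 ≤ q.1} := measurableSet_le measurable_snd measurable_fst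
  refine Integrable.bdd_mul (c := c) (Integrable.comp_snd hv _)
    ((hK.measurable.indicator hm).aestronglyMeasurable) ?_
  rw [Measure.prod_restrict]
  refine (ae_restrict_iff' (measurableSet_Ioc.prod measurableSet_Ioc)).2
    (Eventually.of_forall fun q hq => ?_)
  refine (norm_indicator_le_norm_self _ _).trans (hc q ?_)
  exact ⟨Ioc_subset_Icc_self hq.1, Ioc_subset_Icc_self hq.2⟩

theorem integral_triangle_left (K : ℝ × ℝ → ℝ) (v : ℝ → ℝ) {t τ : ℝ} (hτ : τ ∈ Icc 0 t) :
    ∫ s in Ioc 0 t, {q : ℝ × ℝ | q.2 ≤ q.1}.indicator K (τ, s) * v s =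
      ∫ s in (0 : ℝ)..τ, K (τ, s) * v s := by
  rw [intervalIntegral.integral_of_le hτ.1]
  have : ∀ s, {q : ℝ × ℝ | q.2 ≤ q.1}.indicator K (τ, s) * v s =
      (Iic τ).indicator (fun s => K (τ, s) * v s) s := fun s => by
    by_cases h : s ≤ τ
    · rw [indicator_of_mem (by exact h), indicator_of_mem (by exact h)]
    · rw [indicator_of_notMem (by exact h), indicator_of_notMem (by exact h), zero_mul]
  simp_rw [this]
  rw [setIntegral_indicator measurableSet_Iic, Ioc_inter_Iic, inf_eq_right.2 hτ.2]

theorem integral_triangle_right (K : ℝ × ℝ → ℝ) (v : ℝ → ℝ) {t s : ℝ} (hs : s ∈ Ioc 0 t) :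
    ∫ τ in Ioc 0 t, {q : ℝ × ℝ | q.2 ≤ q.1}.indicator K (τ, s) * v s =
      (∫ τ in s..t, K (τ, s)) * v s := by
  rw [integral_mul_const, intervalIntegral.integral_of_le hs.2]
  have : ∀ τ, {q : ℝ × ℝ | q.2 ≤ q.1}.indicator K (τ, s) =
      (Ici s).indicator (fun τ => K (τ, s)) τ := fun τ => by
    by_cases h : s ≤ τ
    · rw [indicator_of_mem (by exact h), indicator_of_mem (by exact h)]
    · rw [indicator_of_notMem (by exact h), indicator_of_notMem (by exact h)]
  simp_rw [this]
  rw [setIntegral_indicator measurableSet_Ici]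
  have h2 : Ioc 0 t ∩ Ici s = Icc s t := by
    ext τ
    simp only [mem_inter_iff, mem_Ioc, mem_Ici, mem_Icc]
    constructor
    · rintro ⟨⟨_, h⟩, h'⟩; exact ⟨h', h⟩
    · rintro ⟨h, h'⟩; exact ⟨⟨lt_of_lt_of_le hs.1 h, h'⟩, h⟩
  rw [h2, integral_Icc_eq_integral_Ioc]

theorem integral_integral_triangle {K : ℝ × ℝ → ℝ} (hK : Continuous K) {v : ℝ → ℝ} {t : ℝ}
    (ht : 0 ≤ t) (hv : IntervalIntegrable v volume 0 t) :
    ∫ τ in (0 : ℝ)..t, ∫ s in (0 : ℝ)..τ, K (τ, s) * v s =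
      ∫ s in (0 : ℝ)..t, (∫ τ in s..t, K (τ, s)) * v s := by
  rw [intervalIntegrable_iff_integrableOn_Ioc_of_le ht] at hv
  rw [intervalIntegral.integral_of_le ht, intervalIntegral.integral_of_le ht]
  rw [← setIntegral_congr_fun measurableSet_Ioc fun τ hτ =>
      integral_triangle_left K v (Ioc_subset_Icc_self hτ),
    ← setIntegral_congr_fun measurableSet_Ioc fun s hs => integral_triangle_right K v hs]
  exact integral_integral_swap (integrable_triangle hK hv)

theorem intervalIntegrable_convolution {k : ℝ → ℝ} (hk : Continuous k) {v : ℝ → ℝ} {t : ℝ}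
    (ht : 0 ≤ t) (hv : IntervalIntegrable v volume 0 t) :
    IntervalIntegrable (fun τ => ∫ s in (0 : ℝ)..τ, k (τ - s) * v s) volume 0 t := by
  rw [intervalIntegrable_iff_integrableOn_Ioc_of_le ht] at hv ⊢
  have h := (integrable_triangle (K := fun q => k (q.1 - q.2)) (by fun_prop) hv).integral_prod_left
  refine (integrableOn_congr_fun (fun τ hτ => ?_) measurableSet_Ioc).1 h
  exact integral_triangle_left (fun q => k (q.1 - q.2)) v (Ioc_subset_Icc_self hτ)

/-! ### Responses of scalar systems -/

/-- The response of a proper rational function, started at rest. -/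
def resp (g : RatFunc ℝ) (v : ℝ → ℝ) (t : ℝ) : ℝ :=
  markov g 0 * v t + ∫ τ in (0 : ℝ)..t, impulse g (t - τ) * v τ

theorem intervalIntegrable_impulse_mul (g : RatFunc ℝ) {v : ℝ → ℝ} {t : ℝ}
    (hv : IntervalIntegrable v volume 0 t) :
    IntervalIntegrable (fun τ => impulse g (t - τ) * v τ) volume 0 t :=
  hv.continuousOn_mul ((continuous_impulse g).comp (continuous_const.sub continuous_id)).continuousOn

theorem intervalIntegrable_resp (g : RatFunc ℝ) {v : ℝ → ℝ} {t : ℝ} (ht : 0 ≤ t)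
    (hv : IntervalIntegrable v volume 0 t) : IntervalIntegrable (resp g v) volume 0 t :=
  (hv.const_mul _).add (intervalIntegrable_convolution (continuous_impulse g) ht hv)

theorem resp_add_right (g : RatFunc ℝ) {v w : ℝ → ℝ} {t : ℝ}
    (hv : IntervalIntegrable v volume 0 t) (hw : IntervalIntegrable w volume 0 t) :
    resp g (fun τ => v τ + w τ) t = resp g v t + resp g w t := by
  simp only [resp, mul_add]
  rw [intervalIntegral.integral_add (intervalIntegrable_impulse_mul g hv)
    (intervalIntegrable_impulse_mul g hw)]
  ring

theorem resp_const_mul_right (g : RatFunc ℝ) (c : ℝ) (v : ℝ → ℝ) (t : ℝ) :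
    resp g (fun τ => c * v τ) t = c * resp g v t := by
  simp only [resp]
  rw [mul_add, ← intervalIntegral.integral_const_mul]
  congr 1
  · ring
  · congr 1
    funext τ
    ring

theorem resp_zero_right (g : RatFunc ℝ) (t : ℝ) : resp g (fun _ => 0) t = 0 := by simp [resp]

theorem resp_sum_right {ι : Type*} (s : Finset ι) (g : RatFunc ℝ) (v : ι → ℝ → ℝ) {t : ℝ}
    (hv : ∀ i ∈ s, IntervalIntegrable (v i) volume 0 t) :
    resp g (fun τ => ∑ i ∈ s, v i τ) t = ∑ i ∈ s, resp g (v i) t := by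
  classical
  induction s using Finset.induction_on with
  | empty => simpa using resp_zero_right g t
  | insert a s ha ih =>
    simp only [Finset.sum_insert ha]
    rw [resp_add_right g (hv a (Finset.mem_insert_self a s)), ih]
    · exact fun i hi => hv i (Finset.mem_insert_of_mem hi)
    · have := IntervalIntegrable.sum s (fun i hi => hv i (Finset.mem_insert_of_mem hi))
      simpa [Finset.sum_fn] using this

theorem resp_add_left {g₁ g₂ : RatFunc ℝ} (h₁ : g₁ ∈ properRing) (h₂ : g₂ ∈ properRing)
    {v : ℝ → ℝ} {t : ℝ} (hv : IntervalIntegrable v volume 0 t) :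
    resp (g₁ + g₂) v t = resp g₁ v t + resp g₂ v t := by
  simp only [resp, markov_add h₁ h₂, impulse_add h₁ h₂, add_mul]
  rw [intervalIntegral.integral_add (intervalIntegrable_impulse_mul g₁ hv)
    (intervalIntegrable_impulse_mul g₂ hv)]
  ring

theorem resp_C (c : ℝ) (v : ℝ → ℝ) (t : ℝ) : resp (RatFunc.C c) v t = c * v t := by
  simp only [resp, impulse_C, zero_mul, intervalIntegral.integral_zero, add_zero,
    ← coeff_markovSeries, markovSeries_C]
  simp

theorem resp_zero_left (v : ℝ → ℝ) (t : ℝ) : resp 0 v t = 0 := by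
  simpa using resp_C 0 v t

theorem resp_sum_left {ι : Type*} (s : Finset ι) (g : ι → RatFunc ℝ)
    (hg : ∀ i ∈ s, g i ∈ properRing) {v : ℝ → ℝ} {t : ℝ} (hv : IntervalIntegrable v volume 0 t) :
    resp (∑ i ∈ s, g i) v t = ∑ i ∈ s, resp (g i) v t := by
  classical
  induction s using Finset.induction_on with
  | empty => simpa using resp_zero_left v t
  | insert a s ha ih =>
    have hs : ∀ i ∈ s, g i ∈ properRing := fun i hi => hg i (Finset.mem_insert_of_mem hi)
    rw [Finset.sum_insert ha, Finset.sum_insert ha,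
      resp_add_left (hg a (Finset.mem_insert_self a s)) (properRing.sum_mem hs) hv, ih hs]

theorem resp_mul {g₁ g₂ : RatFunc ℝ} (h₁ : g₁ ∈ properRing) (h₂ : g₂ ∈ properRing)
    {v : ℝ → ℝ} {t : ℝ} (ht : 0 ≤ t) (hv : IntervalIntegrable v volume 0 t) :
    resp (g₁ * g₂) v t = resp g₁ (resp g₂ v) t := by
  have hconv : ∫ τ in (0 : ℝ)..t, impulse g₁ (t - τ) *
      (∫ s in (0 : ℝ)..τ, impulse g₂ (τ - s) * v s) =
      ∫ s in (0 : ℝ)..t,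
        (∫ σ in (0 : ℝ)..(t - s), impulse g₁ (t - s - σ) * impulse g₂ σ) * v s := by
    have c1 := continuous_impulse g₁
    have c2 := continuous_impulse g₂
    have h := integral_integral_triangle
      (K := fun q => impulse g₁ (t - q.1) * impulse g₂ (q.1 - q.2)) (by fun_prop) ht hv
    simp only [mul_assoc, intervalIntegral.integral_const_mul] at h
    rw [h]
    refine intervalIntegral.integral_congr fun s _ => ?_
    congr 1
    have h2 := intervalIntegral.integral_comp_sub_right (a := s) (b := t)
      (fun σ => impulse g₁ (t - s - σ) * impulse g₂ σ) s
    rw [sub_self] at h2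
    rw [← h2]
    refine intervalIntegral.integral_congr fun τ _ => ?_
    simp only [sub_sub_sub_cancel_right]
  have hi2 := intervalIntegrable_convolution (continuous_impulse g₂) ht hv
  have e1 : ∫ τ in (0 : ℝ)..t, impulse g₁ (t - τ) * resp g₂ v τ =
      markov g₂ 0 * (∫ τ in (0 : ℝ)..t, impulse g₁ (t - τ) * v τ) +
      ∫ s in (0 : ℝ)..t,
        (∫ σ in (0 : ℝ)..(t - s), impulse g₁ (t - s - σ) * impulse g₂ σ) * v s := by
    rw [← hconv, ← intervalIntegral.integral_const_mul, ← intervalIntegral.integral_add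
      ((intervalIntegrable_impulse_mul g₁ hv).const_mul _) (intervalIntegrable_impulse_mul g₁ hi2)]
    refine intervalIntegral.integral_congr fun τ _ => ?_
    simp only [resp]
    ring
  have e2 : ∫ τ in (0 : ℝ)..t, impulse (g₁ * g₂) (t - τ) * v τ =
      markov g₁ 0 * (∫ τ in (0 : ℝ)..t, impulse g₂ (t - τ) * v τ) +
      markov g₂ 0 * (∫ τ in (0 : ℝ)..t, impulse g₁ (t - τ) * v τ) +
      ∫ s in (0 : ℝ)..t,
        (∫ σ in (0 : ℝ)..(t - s), impulse g₁ (t - s - σ) * impulse g₂ σ) * v s := by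
    have i1 := (intervalIntegrable_impulse_mul g₂ hv).const_mul (markov g₁ 0)
    have i2 := (intervalIntegrable_impulse_mul g₁ hv).const_mul (markov g₂ 0)
    have i3 := intervalIntegrable_impulse_mul (g₁ * g₂) hv
    have e : EqOn (fun τ => impulse (g₁ * g₂) (t - τ) * v τ) (fun τ =>
        markov g₁ 0 * (impulse g₂ (t - τ) * v τ) + markov g₂ 0 * (impulse g₁ (t - τ) * v τ) +
        (∫ σ in (0 : ℝ)..(t - τ), impulse g₁ (t - τ - σ) * impulse g₂ σ) * v τ) (uIcc 0 t) := by
      intro τ hτ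
      rw [uIcc_of_le ht] at hτ
      beta_reduce
      rw [impulse_mul h₁ h₂ (by linarith [hτ.2])]
      ring
    have i4 : IntervalIntegrable (fun τ =>
        (∫ σ in (0 : ℝ)..(t - τ), impulse g₁ (t - τ - σ) * impulse g₂ σ) * v τ) volume 0 t := by
      refine ((i3.sub i1).sub i2).congr ?_
      intro τ hτ
      have := e (uIoc_subset_uIcc hτ)
      beta_reduce at this ⊢
      rw [this]
      ring
    rw [intervalIntegral.integral_congr e, intervalIntegral.integral_add (i1.add i2) i4,
      intervalIntegral.integral_add i1 i2, intervalIntegral.integral_const_mul,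
      intervalIntegral.integral_const_mul]
  rw [resp, e2, markov_zero_mul h₁ h₂]
  conv_rhs => rw [resp, e1, resp]
  ring

theorem resp_congr_ae (g : RatFunc ℝ) {v w : ℝ → ℝ} {t : ℝ} (ht : 0 ≤ t)
    (h0 : markov g 0 = 0 ∨ v t = w t) (h : ∀ᵐ τ ∂volume.restrict (Ioc 0 t), v τ = w τ) :
    resp g v t = resp g w t := by
  simp only [resp]
  congr 1
  · rcases h0 with h0 | h0 <;> simp [h0]
  · rw [intervalIntegral.integral_of_le ht, intervalIntegral.integral_of_le ht]
    refine integral_congr_ae ?_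
    filter_upwards [h] with τ hτ
    rw [hτ]

theorem resp_congr (g : RatFunc ℝ) {v w : ℝ → ℝ} {t : ℝ} (ht : 0 ≤ t)
    (h : ∀ τ ∈ Icc 0 t, v τ = w τ) : resp g v t = resp g w t :=
  resp_congr_ae g ht (Or.inr (h t ⟨ht, le_rfl⟩))
    ((ae_restrict_iff' measurableSet_Ioc).2
      (Eventually.of_forall fun τ hτ => h τ (Ioc_subset_Icc_self hτ)))

/-- The `L₁`-norm of `e^{μ t} g(t)`, where `g(t)` is the impulse response. -/
def weightedNorm (μ : ℝ) (g : RatFunc ℝ) : ℝ :=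
  |markov g 0| + ∫ t in Ioi (0 : ℝ), Real.exp (μ * t) * |impulse g t|

theorem weightedNorm_nonneg (μ : ℝ) (g : RatFunc ℝ) : 0 ≤ weightedNorm μ g :=
  add_nonneg (abs_nonneg _) (integral_nonneg fun t => by positivity)

theorem integrableOn_exp_mul_of_bound {g : RatFunc ℝ} {C β μ : ℝ} (hμ : μ < β)
    (h : ∀ t, 0 ≤ t → ‖impulse g t‖ ≤ C * Real.exp (-β * t)) :
    IntegrableOn (fun t => Real.exp (μ * t) * |impulse g t|) (Ioi 0) := by
  have hd : IntegrableOn (fun t => C * Real.exp (-(β - μ) * t)) (Ioi 0) :=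
    (integrableOn_exp_mul_Ioi (by linarith) 0).const_mul C
  refine hd.mono' ?_ ?_
  · have := continuous_impulse g
    exact (Continuous.aestronglyMeasurable (by fun_prop))
  · refine (ae_restrict_iff' measurableSet_Ioi).2 (Eventually.of_forall fun t ht => ?_)
    rw [norm_mul, Real.norm_eq_abs, Real.norm_eq_abs, abs_abs, Real.abs_exp]
    calc Real.exp (μ * t) * |impulse g t| ≤ Real.exp (μ * t) * (C * Real.exp (-β * t)) :=
          mul_le_mul_of_nonneg_left (h t (le_of_lt ht)) (Real.exp_pos _).le
      _ = C * (Real.exp (μ * t) * Real.exp (-β * t)) := by ring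
      _ = _ := by rw [← Real.exp_add]; ring_nf

/-- `e^{μ t} g(t)` is integrable. -/
def WeightIntegrable (μ : ℝ) (g : RatFunc ℝ) : Prop :=
  IntegrableOn (fun t => Real.exp (μ * t) * |impulse g t|) (Ioi 0)

theorem eventually_weightIntegrable {g : RatFunc ℝ} (hp : g ∈ properRing) (hs : g ∈ stableRing) :
    ∀ᶠ μ in 𝓝[>] (0 : ℝ), WeightIntegrable μ g := by
  obtain ⟨C, β, -, hβ, h⟩ := expDecay_impulse hp hs
  filter_upwards [Ioo_mem_nhdsGT hβ] with μ hμ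
  exact integrableOn_exp_mul_of_bound hμ.2 h

theorem weightIntegrable_zero {g : RatFunc ℝ} (hp : g ∈ properRing) (hs : g ∈ stableRing) :
    WeightIntegrable 0 g := by
  obtain ⟨C, β, -, hβ, h⟩ := expDecay_impulse hp hs
  exact integrableOn_exp_mul_of_bound hβ h

theorem tendsto_weightedNorm {g : RatFunc ℝ} (hp : g ∈ properRing) (hs : g ∈ stableRing) :
    Tendsto (fun μ => weightedNorm μ g) (𝓝[>] 0) (𝓝 (weightedNorm 0 g)) := by
  obtain ⟨C, β, -, hβ, h⟩ := expDecay_impulse hp hs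
  have hb := integrableOn_exp_mul_of_bound (half_lt_self hβ) h
  have hc := continuous_impulse g
  refine tendsto_const_nhds.add (tendsto_integral_filter_of_dominated_convergence _ ?_ ?_ hb ?_)
  · exact Eventually.of_forall fun μ => (Continuous.aestronglyMeasurable (by fun_prop))
  · filter_upwards [Ioo_mem_nhdsGT (half_pos hβ)] with μ hμ
    refine (ae_restrict_iff' measurableSet_Ioi).2 (Eventually.of_forall fun t ht => ?_)
    rw [norm_mul, Real.norm_eq_abs, Real.norm_eq_abs, abs_abs, Real.abs_exp]
    have : (0 : ℝ) < t := ht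
    gcongr
    exact hμ.2.le
  · refine Eventually.of_forall fun t => ?_
    have : Continuous fun μ : ℝ => Real.exp (μ * t) * |impulse g t| := by fun_prop
    exact (this.tendsto 0).mono_left nhdsWithin_le_nhds

theorem abs_resp_le {g : RatFunc ℝ} {μ : ℝ} (hμ : WeightIntegrable μ g)
    (h0 : WeightIntegrable 0 g) {v : ℝ → ℝ} {A B t : ℝ} (hA : 0 ≤ A) (hB : 0 ≤ B) (ht : 0 ≤ t)
    (hvt : markov g 0 = 0 ∨ |v t| ≤ A * Real.exp (-μ * t) + B)
    (hv : ∀ᵐ τ ∂volume.restrict (Ioc 0 t), |v τ| ≤ A * Real.exp (-μ * τ) + B) :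
    |resp g v t| ≤ weightedNorm μ g * (A * Real.exp (-μ * t)) + weightedNorm 0 g * B := by
  have hweight : ∀ ν, WeightIntegrable ν g →
      IntervalIntegrable (fun τ => Real.exp (ν * (t - τ)) * |impulse g (t - τ)|) volume 0 t ∧
      ∫ τ in (0 : ℝ)..t, Real.exp (ν * (t - τ)) * |impulse g (t - τ)| ≤
        ∫ τ in Ioi (0 : ℝ), Real.exp (ν * τ) * |impulse g τ| := by
    intro ν hν
    have hc := continuous_impulse g
    refine ⟨Continuous.intervalIntegrable (by fun_prop) _ _, ?_⟩
    rw [intervalIntegral.integral_comp_sub_left (fun τ => Real.exp (ν * τ) * |impulse g τ|) t,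
      sub_self, sub_zero, intervalIntegral.integral_of_le ht]
    refine setIntegral_mono_set hν (Eventually.of_forall fun τ => ?_) ?_
    · exact mul_nonneg (Real.exp_pos _).le (abs_nonneg _)
    · exact (Ioc_subset_Ioi_self).eventuallyLE
  obtain ⟨i1, l1⟩ := hweight μ hμ
  obtain ⟨i2, l2⟩ := hweight 0 h0
  have e1 : |∫ τ in (0 : ℝ)..t, impulse g (t - τ) * v τ| ≤
      ∫ τ in (0 : ℝ)..t, ((A * Real.exp (-μ * t)) *
        (Real.exp (μ * (t - τ)) * |impulse g (t - τ)|) +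
        B * (Real.exp (0 * (t - τ)) * |impulse g (t - τ)|)) := by
    rw [← Real.norm_eq_abs]
    refine intervalIntegral.norm_integral_le_of_norm_le ht ?_
      ((i1.const_mul _).add (i2.const_mul _))
    rw [ae_restrict_iff' measurableSet_Ioc] at hv
    filter_upwards [hv] with τ hτ hm
    rw [norm_mul, Real.norm_eq_abs, Real.norm_eq_abs]
    have h1 : Real.exp (-μ * t) * Real.exp (μ * (t - τ)) = Real.exp (-μ * τ) := by
      rw [← Real.exp_add]; ring_nf
    calc |impulse g (t - τ)| * |v τ| ≤ |impulse g (t - τ)| * (A * Real.exp (-μ * τ) + B) :=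
          mul_le_mul_of_nonneg_left (hτ hm) (abs_nonneg _)
      _ = _ := by rw [← h1, zero_mul, Real.exp_zero]; ring
  rw [intervalIntegral.integral_add (i1.const_mul _) (i2.const_mul _),
    intervalIntegral.integral_const_mul, intervalIntegral.integral_const_mul] at e1
  have hE : 0 ≤ A * Real.exp (-μ * t) := mul_nonneg hA (Real.exp_pos _).le
  have e2 : |markov g 0 * v t| ≤ |markov g 0| * (A * Real.exp (-μ * t)) + |markov g 0| * B := by
    rw [abs_mul, ← mul_add]
    rcases hvt with h | h
    · simp [h]
    · exact mul_le_mul_of_nonneg_left h (abs_nonneg _)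
  have e3 := mul_le_mul_of_nonneg_left l1 hE
  have e4 := mul_le_mul_of_nonneg_left l2 hB
  rw [resp]
  refine (abs_add_le _ _).trans ?_
  rw [weightedNorm, weightedNorm]
  nlinarith

end L1Control

end

noncomputable section

namespace L1Control

/-! ### Proper and stable transfer matrices -/

variable {a b c : ℕ}

/-- All entries are proper. -/
def Proper (G : TM a b) : Prop := ∀ i j, G i j ∈ properRing

/-- All entries are strictly proper. -/
def Strict (G : TM a b) : Prop := ∀ i j, RatFunc.X * G i j ∈ properRing

theorem strictlyProper_iff {G : TM a b} : StrictlyProper G ↔ Strict G :=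
  forall₂_congr fun _ _ => degree_num_lt_iff

theorem Strict.proper {G : TM a b} (h : Strict G) : Proper G := fun i j =>
  mem_properRing_of_X_mul (h i j)

theorem proper_const (A : Matrix (Fin a) (Fin b) ℝ) : Proper (const A) := fun _ _ =>
  C_mem_properRing _

theorem proper_one : Proper (1 : TM a a) := fun i j => by
  rw [Matrix.one_apply]
  split_ifs
  · exact properRing.one_mem
  · exact properRing.zero_mem

theorem Proper.mul {G : TM a b} {G' : TM b c} (h : Proper G) (h' : Proper G') : Proper (G * G') :=
  fun i j => by
    rw [Matrix.mul_apply]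
    exact properRing.sum_mem fun k _ => properRing.mul_mem (h i k) (h' k j)

theorem Proper.add {G G' : TM a b} (h : Proper G) (h' : Proper G') : Proper (G + G') :=
  fun i j => properRing.add_mem (h i j) (h' i j)

theorem Proper.sub {G G' : TM a b} (h : Proper G) (h' : Proper G') : Proper (G - G') :=
  fun i j => properRing.sub_mem (h i j) (h' i j)

theorem Proper.smul {G : TM a b} {g : RatFunc ℝ} (hg : g ∈ properRing) (h : Proper G) :
    Proper (g • G) := fun i j => properRing.mul_mem hg (h i j)

theorem Strict.mul_proper {G : TM a b} {G' : TM b c} (h : Strict G) (h' : Proper G') :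
    Strict (G * G') := fun i j => by
  rw [Matrix.mul_apply, Finset.mul_sum]
  refine properRing.sum_mem fun k _ => ?_
  rw [← mul_assoc]
  exact properRing.mul_mem (h i k) (h' k j)

theorem Proper.mul_strict {G : TM a b} {G' : TM b c} (h : Proper G) (h' : Strict G') :
    Strict (G * G') := fun i j => by
  rw [Matrix.mul_apply, Finset.mul_sum]
  refine properRing.sum_mem fun k _ => ?_
  rw [mul_left_comm]
  exact properRing.mul_mem (h i k) (h' k j)

theorem Strict.smul {G : TM a b} {g : RatFunc ℝ} (hg : g ∈ properRing) (h : Strict G) :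
    Strict (g • G) := fun i j => by
  rw [Matrix.smul_apply, smul_eq_mul, mul_left_comm]
  exact properRing.mul_mem hg (h i j)

theorem Strict.X_smul {G : TM a b} (h : Strict G) : Proper ((RatFunc.X : RatFunc ℝ) • G) := h

theorem stable_const (A : Matrix (Fin a) (Fin b) ℝ) : Stable (const A) := fun _ _ =>
  C_mem_stableRing _

theorem stable_one : Stable (1 : TM a a) := fun i j => by
  change (1 : TM a a) i j ∈ stableRing
  rw [Matrix.one_apply]
  split_ifs
  · exact stableRing.one_mem
  · exact stableRing.zero_mem

theorem Stable.mul {G : TM a b} {G' : TM b c} (h : Stable G) (h' : Stable G') : Stable (G * G') :=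
  fun i j => by
    change (G * G') i j ∈ stableRing
    rw [Matrix.mul_apply]
    exact stableRing.sum_mem fun k _ => stableRing.mul_mem (h i k) (h' k j)

theorem Stable.sub {G G' : TM a b} (h : Stable G) (h' : Stable G') : Stable (G - G') :=
  fun i j => stableRing.sub_mem (h i j) (h' i j)

theorem Stable.smul {G : TM a b} {g : RatFunc ℝ} (hg : g ∈ stableRing) (h : Stable G) :
    Stable (g • G) := fun i j => stableRing.mul_mem hg (h i j)

theorem const_mul_const (A : Matrix (Fin a) (Fin b) ℝ) (B : Matrix (Fin b) (Fin c) ℝ) :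
    const A * const B = const (A * B) := (Matrix.map_mul).symm

theorem const_one : const (1 : Matrix (Fin a) (Fin a) ℝ) = 1 := by
  rw [const]
  exact Matrix.map_one _ (map_zero _) (map_one _)

/-! ### Responses of transfer matrices -/

/-- Integrability of all coordinates of a signal on `[0, t]`. -/
def IntOn (v : ℝ → Fin b → ℝ) (t : ℝ) : Prop :=
  ∀ j, IntervalIntegrable (fun τ => v τ j) volume 0 t

theorem IntOn.of_continuousOn {v : ℝ → Fin b → ℝ} {t : ℝ} (ht : 0 ≤ t)
    (hv : ContinuousOn v (Icc 0 t)) : IntOn v t := fun j =>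
  ContinuousOn.intervalIntegrable_of_Icc ht ((continuous_apply j).comp_continuousOn hv)

theorem IntOn.add {v w : ℝ → Fin b → ℝ} {t : ℝ} (hv : IntOn v t) (hw : IntOn w t) :
    IntOn (fun τ => v τ + w τ) t := fun j => (hv j).add (hw j)

theorem IntOn.sub {v w : ℝ → Fin b → ℝ} {t : ℝ} (hv : IntOn v t) (hw : IntOn w t) :
    IntOn (fun τ => v τ - w τ) t := fun j => (hv j).sub (hw j)

theorem IntOn.smul {v : ℝ → Fin b → ℝ} {t : ℝ} (r : ℝ) (hv : IntOn v t) :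
    IntOn (fun τ => r • v τ) t := fun j => (hv j).const_mul r

theorem IntOn.mulVec {v : ℝ → Fin b → ℝ} {t : ℝ} (A : Matrix (Fin a) (Fin b) ℝ) (hv : IntOn v t) :
    IntOn (fun τ => A *ᵥ v τ) t := fun i => by
  have := IntervalIntegrable.sum Finset.univ fun j _ => (hv j).const_mul (A i j)
  simpa [Matrix.mulVec, dotProduct, Finset.sum_fn] using this

theorem response_apply (G : TM a b) (v : ℝ → Fin b → ℝ) (t : ℝ) (i : Fin a) :
    response G v t i = ∑ j, resp (G i j) (fun τ => v τ j) t := rfl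

theorem IntOn.response {v : ℝ → Fin b → ℝ} {t : ℝ} (ht : 0 ≤ t) (G : TM a b) (hv : IntOn v t) :
    IntOn (response G v) t := fun i => by
  have := IntervalIntegrable.sum Finset.univ fun j _ => intervalIntegrable_resp (G i j) ht (hv j)
  simpa [funext fun τ => response_apply G v τ i, Finset.sum_fn] using this

theorem IntOn.mono {v : ℝ → Fin b → ℝ} {s t : ℝ} (hs : 0 ≤ s) (hst : s ≤ t) (hv : IntOn v t) :
    IntOn v s := fun j => (hv j).mono_set (by
  rw [uIcc_of_le hs, uIcc_of_le (hs.trans hst)]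
  exact Icc_subset_Icc_right hst)

theorem IntOn.congr {v w : ℝ → Fin b → ℝ} {t : ℝ} (ht : 0 ≤ t) (h : ∀ τ ∈ Icc 0 t, v τ = w τ)
    (hv : IntOn v t) : IntOn w t := fun j => (hv j).congr (by
  intro τ hτ
  rw [uIoc_of_le ht] at hτ
  exact congrFun (h τ (Ioc_subset_Icc_self hτ)) j)

theorem response_congr (G : TM a b) {v w : ℝ → Fin b → ℝ} {t : ℝ} (ht : 0 ≤ t)
    (h : ∀ τ ∈ Icc 0 t, v τ = w τ) : response G v t = response G w t := by
  funext i
  simp only [response_apply]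
  exact Finset.sum_congr rfl fun j _ => resp_congr _ ht fun τ hτ => congrFun (h τ hτ) j

theorem response_mul {G : TM a b} {G' : TM b c} (h : Proper G) (h' : Proper G')
    {v : ℝ → Fin c → ℝ} {t : ℝ} (ht : 0 ≤ t) (hv : IntOn v t) :
    response (G * G') v t = response G (response G' v) t := by
  funext i
  simp only [response_apply, Matrix.mul_apply]
  have e : ∀ j, resp (∑ k, G i k * G' k j) (fun τ => v τ j) t =
      ∑ k, resp (G i k) (resp (G' k j) fun τ => v τ j) t := fun j => by
    rw [resp_sum_left _ _ (fun k _ => properRing.mul_mem (h i k) (h' k j)) (hv j)]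
    exact Finset.sum_congr rfl fun k _ => resp_mul (h i k) (h' k j) ht (hv j)
  simp only [e]
  rw [Finset.sum_comm]
  refine Finset.sum_congr rfl fun k _ => ?_
  exact (resp_sum_right _ _ _ fun j _ => intervalIntegrable_resp (G' k j) ht (hv j)).symm

theorem response_add_left {G G' : TM a b} (h : Proper G) (h' : Proper G') {v : ℝ → Fin b → ℝ}
    {t : ℝ} (hv : IntOn v t) : response (G + G') v t = response G v t + response G' v t := by
  funext i
  simp only [response_apply, Pi.add_apply, ← Finset.sum_add_distrib]
  exact Finset.sum_congr rfl fun j _ => resp_add_left (h i j) (h' i j) (hv j)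

theorem response_sub_left {G G' : TM a b} (h : Proper G) (h' : Proper G') {v : ℝ → Fin b → ℝ}
    {t : ℝ} (hv : IntOn v t) : response (G - G') v t = response G v t - response G' v t := by
  have := response_add_left (h.sub h') h' hv
  rw [sub_add_cancel] at this
  rw [this, add_sub_cancel_right]

theorem response_add_right (G : TM a b) {v w : ℝ → Fin b → ℝ} {t : ℝ} (hv : IntOn v t)
    (hw : IntOn w t) :
    response G (fun τ => v τ + w τ) t = response G v t + response G w t := by
  funext i
  simp only [response_apply, Pi.add_apply, ← Finset.sum_add_distrib]
  exact Finset.sum_congr rfl fun j _ => resp_add_right _ (hv j) (hw j)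

theorem response_smul_right (G : TM a b) (r : ℝ) (v : ℝ → Fin b → ℝ) (t : ℝ) :
    response G (fun τ => r • v τ) t = r • response G v t := by
  funext i
  simp only [response_apply, Pi.smul_apply, smul_eq_mul, Finset.mul_sum, resp_const_mul_right]

theorem response_sub_right (G : TM a b) {v w : ℝ → Fin b → ℝ} {t : ℝ} (hv : IntOn v t)
    (hw : IntOn w t) :
    response G (fun τ => v τ - w τ) t = response G v t - response G w t := by
  have := response_add_right G (hv.sub hw) hw
  simp only [sub_add_cancel] at this
  rw [this, add_sub_cancel_right]

theorem response_const (A : Matrix (Fin a) (Fin b) ℝ) (v : ℝ → Fin b → ℝ) (t : ℝ) :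
    response (const A) v t = A *ᵥ v t := by
  funext i
  simp only [response_apply, const, Matrix.map_apply, resp_C, Matrix.mulVec, dotProduct]

theorem response_one (v : ℝ → Fin b → ℝ) (t : ℝ) : response 1 v t = v t := by
  rw [← const_one, response_const, Matrix.one_mulVec]

theorem response_mul_const {G : TM a b} (h : Proper G) (A : Matrix (Fin b) (Fin c) ℝ)
    {v : ℝ → Fin c → ℝ} {t : ℝ} (ht : 0 ≤ t) (hv : IntOn v t) :
    response (G * const A) v t = response G (fun τ => A *ᵥ v τ) t := by
  rw [response_mul h (proper_const A) ht hv]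
  exact response_congr G ht fun τ _ => response_const A v τ

theorem response_C_smul {G : TM a b} (h : Proper G) (r : ℝ) {v : ℝ → Fin b → ℝ} {t : ℝ}
    (ht : 0 ≤ t) (hv : IntOn v t) :
    response (RatFunc.C r • G) v t = r • response G v t := by
  funext i
  simp only [response_apply, Pi.smul_apply, smul_eq_mul, Finset.mul_sum, Matrix.smul_apply]
  refine Finset.sum_congr rfl fun j _ => ?_
  rw [resp_mul (C_mem_properRing r) (h i j) ht (hv j), resp_C]

/-! ### Norm bounds -/

/-- The `L₁`-norm with exponential weight `e^{μ t}`. -/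
def weightedL1 (μ : ℝ) (G : TM a b) : ℝ := ⨆ i, ∑ j, weightedNorm μ (G i j)

theorem l1Norm_eq (G : TM a b) : l1Norm G = weightedL1 0 G := by
  simp [l1Norm, weightedL1, weightedNorm]

theorem sum_weightedNorm_le (μ : ℝ) (G : TM a b) (i : Fin a) :
    ∑ j, weightedNorm μ (G i j) ≤ weightedL1 μ G :=
  le_ciSup (f := fun i => ∑ j, weightedNorm μ (G i j)) (Set.finite_range _).bddAbove i

theorem weightedL1_nonneg (μ : ℝ) (G : TM a b) : 0 ≤ weightedL1 μ G :=
  Real.iSup_nonneg fun _ => Finset.sum_nonneg fun _ _ => weightedNorm_nonneg _ _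

theorem l1Norm_nonneg (G : TM a b) : 0 ≤ l1Norm G := by
  rw [l1Norm_eq]
  exact weightedL1_nonneg 0 G

theorem norm_response_le {G : TM a b} {μ : ℝ} (hμ : ∀ i j, WeightIntegrable μ (G i j))
    (hp : Proper G) (hs : Stable G) {v : ℝ → Fin b → ℝ} {A B t : ℝ} (hA : 0 ≤ A) (hB : 0 ≤ B)
    (ht : 0 ≤ t) (hvt : Strict G ∨ ‖v t‖ ≤ A * Real.exp (-μ * t) + B)
    (hv : ∀ᵐ τ ∂volume.restrict (Ioc 0 t), ‖v τ‖ ≤ A * Real.exp (-μ * τ) + B) :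
    ‖response G v t‖ ≤ weightedL1 μ G * (A * Real.exp (-μ * t)) + l1Norm G * B := by
  have hE : 0 ≤ A * Real.exp (-μ * t) := mul_nonneg hA (Real.exp_pos _).le
  have hn : 0 ≤ weightedL1 μ G * (A * Real.exp (-μ * t)) + l1Norm G * B :=
    add_nonneg (mul_nonneg (weightedL1_nonneg _ _) hE) (mul_nonneg (l1Norm_nonneg _) hB)
  refine (pi_norm_le_iff_of_nonneg hn).2 fun i => ?_
  rw [response_apply, Real.norm_eq_abs]
  refine (Finset.abs_sum_le_sum_abs _ _).trans ?_
  have h1 : ∀ j, |resp (G i j) (fun τ => v τ j) t| ≤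
      weightedNorm μ (G i j) * (A * Real.exp (-μ * t)) + weightedNorm 0 (G i j) * B := fun j => by
    refine abs_resp_le (hμ i j) (weightIntegrable_zero (hp i j) (hs i j)) hA hB ht ?_ ?_
    · exact hvt.imp (fun h => markov_zero_of_strict (h i j)) fun h => (norm_le_pi_norm _ j).trans h
    · filter_upwards [hv] with τ hτ using (norm_le_pi_norm (v τ) j).trans hτ
  refine (Finset.sum_le_sum fun j _ => h1 j).trans ?_
  rw [Finset.sum_add_distrib, ← Finset.sum_mul, ← Finset.sum_mul, l1Norm_eq]
  exact add_le_add (mul_le_mul_of_nonneg_right (sum_weightedNorm_le μ G i) hE)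
    (mul_le_mul_of_nonneg_right (sum_weightedNorm_le 0 G i) hB)

theorem norm_response_le_of_ae {G : TM a b} (hp : Strict G) (hs : Stable G) {v : ℝ → Fin b → ℝ}
    {B t : ℝ} (hB : 0 ≤ B) (ht : 0 ≤ t) (hv : ∀ᵐ τ ∂volume.restrict (Ioc 0 t), ‖v τ‖ ≤ B) :
    ‖response G v t‖ ≤ l1Norm G * B := by
  have := norm_response_le (μ := 0) (A := 0)
    (fun i j => weightIntegrable_zero (hp.proper i j) (hs i j)) hp.proper hs le_rfl hB ht
    (Or.inl hp) (by simpa using hv)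
  simpa using this

theorem norm_response_le_const {G : TM a b} (hp : Proper G) (hs : Stable G) {v : ℝ → Fin b → ℝ}
    {B t : ℝ} (ht : 0 ≤ t) (hv : ∀ τ ∈ Icc 0 t, ‖v τ‖ ≤ B) :
    ‖response G v t‖ ≤ l1Norm G * B := by
  have := norm_response_le (μ := 0) (A := 0) (B := B) (v := v)
    (fun i j => weightIntegrable_zero (hp i j) (hs i j)) hp hs le_rfl
    ((norm_nonneg _).trans (hv t ⟨ht, le_rfl⟩)) ht
    (Or.inr (by simpa using hv t ⟨ht, le_rfl⟩))
    ((ae_restrict_iff' measurableSet_Ioc).2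
      (Eventually.of_forall fun τ hτ => by simpa using hv τ (Ioc_subset_Icc_self hτ)))
  simpa using this

theorem eventually_weightedL1_lt {G : TM a b} (hp : Proper G) (hs : Stable G) {r : ℝ}
    (hr0 : 0 < r) (hr : l1Norm G < r) : ∀ᶠ μ in 𝓝[>] (0 : ℝ), weightedL1 μ G < r := by
  have h : ∀ i, ∀ᶠ μ in 𝓝[>] (0 : ℝ), ∑ j, weightedNorm μ (G i j) < r := fun i => by
    have : Tendsto (fun μ => ∑ j, weightedNorm μ (G i j)) (𝓝[>] 0)
        (𝓝 (∑ j, weightedNorm 0 (G i j))) :=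
      tendsto_finsetSum _ fun j _ => tendsto_weightedNorm (hp i j) (hs i j)
    refine this.eventually_lt_const ((sum_weightedNorm_le 0 G i).trans_lt ?_)
    rwa [← l1Norm_eq]
  filter_upwards [eventually_all.2 h] with μ hμ
  rcases isEmpty_or_nonempty (Fin a) with he | he
  · rw [weightedL1, Real.iSup_of_isEmpty]
    exact hr0
  · obtain ⟨i, hi⟩ := exists_eq_ciSup_of_finite (f := fun i => ∑ j, weightedNorm μ (G i j))
    rw [weightedL1, ← hi]
    exact hμ i

theorem eventually_weightIntegrable_matrix {G : TM a b} (hp : Proper G) (hs : Stable G) :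
    ∀ᶠ μ in 𝓝[>] (0 : ℝ), ∀ i j, WeightIntegrable μ (G i j) :=
  eventually_all.2 fun i => eventually_all.2 fun j => eventually_weightIntegrable (hp i j) (hs i j)

theorem norm_mulVec_le {ι κ : Type} [Fintype ι] [Fintype κ] (A : Matrix ι κ ℝ) (v : κ → ℝ) :
    ‖A *ᵥ v‖ ≤ infNorm A * ‖v‖ := Matrix.linfty_opNorm_mulVec A v

theorem infNorm_nonneg {ι κ : Type} [Fintype ι] [Fintype κ] (A : Matrix ι κ ℝ) : 0 ≤ infNorm A := by
  let : NormedAddCommGroup (Matrix ι κ ℝ) := Matrix.linftyOpNormedAddCommGroup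
  exact norm_nonneg A

end L1Control

end

noncomputable section

namespace L1Control

variable {a b c k : ℕ}

/-! ### The resolvent -/

theorem X_sub_const_eq_map (A : Matrix (Fin k) (Fin k) ℝ) :
    (RatFunc.X : RatFunc ℝ) • (1 : TM k k) - const A =
      A.charmatrix.map (algebraMap (Polynomial ℝ) (RatFunc ℝ)) := by
  ext i j
  by_cases h : i = j
  · subst h
    simp [const, Matrix.charmatrix_apply_eq, RatFunc.algebraMap_X, RatFunc.algebraMap_C]
  · simp [const, h, RatFunc.algebraMap_C]

theorem det_X_sub_const (A : Matrix (Fin k) (Fin k) ℝ) :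
    ((RatFunc.X : RatFunc ℝ) • (1 : TM k k) - const A).det =
      algebraMap (Polynomial ℝ) (RatFunc ℝ) A.charpoly := by
  rw [X_sub_const_eq_map, Matrix.charpoly, RingHom.map_det, RingHom.mapMatrix_apply]

theorem isUnit_det_X_sub_const (A : Matrix (Fin k) (Fin k) ℝ) :
    IsUnit ((RatFunc.X : RatFunc ℝ) • (1 : TM k k) - const A).det := by
  rw [det_X_sub_const, isUnit_iff_ne_zero]
  exact RatFunc.algebraMap_ne_zero A.charpoly_monic.ne_zero

theorem resolvent_mul_self (A : Matrix (Fin k) (Fin k) ℝ) :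
    resolvent A * ((RatFunc.X : RatFunc ℝ) • (1 : TM k k) - const A) = 1 :=
  Matrix.nonsing_inv_mul _ (isUnit_det_X_sub_const A)

theorem mul_resolvent_self (A : Matrix (Fin k) (Fin k) ℝ) :
    ((RatFunc.X : RatFunc ℝ) • (1 : TM k k) - const A) * resolvent A = 1 :=
  Matrix.mul_nonsing_inv _ (isUnit_det_X_sub_const A)

theorem X_smul_resolvent (A : Matrix (Fin k) (Fin k) ℝ) :
    (RatFunc.X : RatFunc ℝ) • resolvent A = 1 + const A * resolvent A := by
  have h := mul_resolvent_self A
  rw [Matrix.sub_mul, Matrix.smul_mul, Matrix.one_mul] at h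
  rw [← h, sub_add_cancel]

theorem X_smul_resolvent' (A : Matrix (Fin k) (Fin k) ℝ) :
    (RatFunc.X : RatFunc ℝ) • resolvent A = 1 + resolvent A * const A := by
  have h := resolvent_mul_self A
  rw [Matrix.mul_sub, Matrix.mul_smul, Matrix.mul_one] at h
  rw [← h, sub_add_cancel]

theorem exists_X_inv_pow_mul_mem (g : RatFunc ℝ) :
    ∃ d : ℕ, ∀ e, d ≤ e → (RatFunc.X⁻¹ : RatFunc ℝ) ^ e * g ∈ properRing := by
  refine ⟨g.intDegree.toNat, fun e he => ?_⟩
  change RatFunc.intDegree _ ≤ 0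
  by_cases h : g = 0
  · simp [h]
  have hpow : ∀ e : ℕ, ((RatFunc.X⁻¹ : RatFunc ℝ) ^ e).intDegree = -e := by
    intro e
    induction e with
    | zero => simp
    | succ e ih =>
      rw [pow_succ, RatFunc.intDegree_mul (pow_ne_zero _ (inv_ne_zero RatFunc.X_ne_zero))
        (inv_ne_zero RatFunc.X_ne_zero), ih, RatFunc.intDegree_inv, RatFunc.intDegree_X]
      push_cast
      ring
  rw [RatFunc.intDegree_mul (pow_ne_zero _ (inv_ne_zero RatFunc.X_ne_zero)) h, hpow]
  have := Int.self_le_toNat g.intDegree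
  omega

theorem strict_resolvent (A : Matrix (Fin k) (Fin k) ℝ) : Strict (resolvent A) := by
  choose d hd using fun i j => exists_X_inv_pow_mul_mem (resolvent A i j)
  have hstep : ∀ e : ℕ, (∀ i j, (RatFunc.X⁻¹ : RatFunc ℝ) ^ e * resolvent A i j ∈ properRing) →
      ∀ i j, RatFunc.X * ((RatFunc.X⁻¹ : RatFunc ℝ) ^ e * resolvent A i j) ∈ properRing := by
    intro e he i j
    have h := congrFun (congrFun (X_smul_resolvent A) i) j
    rw [Matrix.smul_apply, smul_eq_mul, Matrix.add_apply, Matrix.mul_apply] at h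
    rw [mul_left_comm, h, mul_add, Finset.mul_sum]
    refine properRing.add_mem (properRing.mul_mem (properRing.pow_mem X_inv_mem_properRing e)
      (proper_one i j)) (properRing.sum_mem fun l _ => ?_)
    rw [mul_left_comm]
    exact properRing.mul_mem (proper_const A i l) (he l j)
  have hmain : ∀ e : ℕ, (∀ i j, (RatFunc.X⁻¹ : RatFunc ℝ) ^ e * resolvent A i j ∈ properRing) →
      Strict (resolvent A) := by
    intro e
    induction e with
    | zero =>
      intro h i j
      simpa using hstep 0 h i j
    | succ e ih =>
      intro h
      refine ih fun i j => ?_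
      have := hstep (e + 1) h i j
      rwa [pow_succ', mul_assoc, ← mul_assoc, mul_inv_cancel₀ RatFunc.X_ne_zero, one_mul] at this
  refine hmain (∑ i, ∑ j, d i j) fun i j => hd i j _ ?_
  exact (Finset.single_le_sum (f := fun j => d i j) (fun _ _ => Nat.zero_le _)
    (Finset.mem_univ j)).trans (Finset.single_le_sum (f := fun i => ∑ j, d i j)
      (fun _ _ => Nat.zero_le _) (Finset.mem_univ i))

theorem stable_resolvent {A : Matrix (Fin k) (Fin k) ℝ} (hA : Hurwitz A) :
    Stable (resolvent A) := by
  intro i j z hz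
  apply hA
  have h1 : resolvent A i j = algebraMap (Polynomial ℝ) (RatFunc ℝ) (A.charmatrix.adjugate i j) /
      algebraMap (Polynomial ℝ) (RatFunc ℝ) A.charpoly := by
    rw [resolvent, Matrix.inv_def, det_X_sub_const, Ring.inverse_eq_inv', X_sub_const_eq_map,
      Matrix.smul_apply, smul_eq_mul, div_eq_inv_mul]
    congr 1
    exact congrFun (congrFun (RingHom.map_adjugate (algebraMap (Polynomial ℝ) (RatFunc ℝ))
      A.charmatrix).symm i) j
  obtain ⟨q, hq⟩ := RatFunc.denom_div_dvd (A.charmatrix.adjugate i j) A.charpoly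
  have h2 : Polynomial.aeval z A.charpoly = 0 := by
    rw [hq, map_mul, ← h1, hz, zero_mul]
  rw [spectrum.mem_iff, Matrix.isUnit_iff_isUnit_det, isUnit_iff_ne_zero, not_not]
  have h3 : (A.map ((↑) : ℝ → ℂ)).charpoly = A.charpoly.map Complex.ofRealHom :=
    Matrix.charpoly_map A Complex.ofRealHom
  rw [Matrix.algebraMap_eq_diagonal]
  have h4 := Matrix.eval_charpoly (A.map ((↑) : ℝ → ℂ)) z
  rw [h3, Polynomial.eval_map] at h4
  have h5 : Polynomial.eval₂ Complex.ofRealHom z A.charpoly = 0 := h2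
  rw [h5] at h4
  exact h4.symm

theorem markov_resolvent (A : Matrix (Fin k) (Fin k) ℝ) (l : ℕ) (i j : Fin k) :
    markov (resolvent A i j) (l + 1) = (A ^ l) i j := by
  induction l generalizing i j with
  | zero =>
    rw [markov_succ_of_strict (strict_resolvent A i j)]
    have h := congrFun (congrFun (X_smul_resolvent A) i) j
    rw [Matrix.smul_apply, smul_eq_mul, Matrix.add_apply] at h
    rw [h, markov_add (proper_one i j)
      (((proper_const A).mul (strict_resolvent A).proper) i j),
      markov_zero_of_strict (((proper_const A).mul_strict (strict_resolvent A)) i j), add_zero,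
      ← const_one, const, Matrix.map_apply, ← coeff_markovSeries, markovSeries_C, pow_zero]
    simp
  | succ l ih =>
    rw [markov_succ_of_strict (strict_resolvent A i j)]
    have h := congrFun (congrFun (X_smul_resolvent A) i) j
    rw [Matrix.smul_apply, smul_eq_mul, Matrix.add_apply] at h
    rw [h, markov_add (proper_one i j)
      (((proper_const A).mul (strict_resolvent A).proper) i j), Matrix.mul_apply]
    have h1 : markov ((1 : TM k k) i j) (l + 1) = 0 := by
      rw [← const_one, const, Matrix.map_apply, ← coeff_markovSeries, markovSeries_C]
      simp
    have h2 : ∀ s : Finset (Fin k), markov (∑ r ∈ s, const A i r * resolvent A r j) (l + 1) =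
        ∑ r ∈ s, A i r * (A ^ l) r j := by
      intro s
      classical
      induction s using Finset.induction_on with
      | empty =>
        rw [Finset.sum_empty, Finset.sum_empty, ← map_zero RatFunc.C, ← coeff_markovSeries,
          markovSeries_C]
        simp
      | insert r s hr ihs =>
        rw [Finset.sum_insert hr, Finset.sum_insert hr, markov_add
          (properRing.mul_mem (proper_const A i r) ((strict_resolvent A).proper r j))
          (properRing.sum_mem fun q _ => properRing.mul_mem (proper_const A i q)
            ((strict_resolvent A).proper q j)), ihs]
        congr 1
        rw [const, Matrix.map_apply, markov_C_mul _ ((strict_resolvent A).proper r j), ih]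
    rw [h1, h2, zero_add, pow_succ', Matrix.mul_apply]

theorem impulse_resolvent (A : Matrix (Fin k) (Fin k) ℝ) (i j : Fin k) (t : ℝ) :
    impulse (resolvent A i j) t = NormedSpace.exp (t • A) i j := by
  let : NormedRing (Matrix (Fin k) (Fin k) ℝ) := Matrix.linftyOpNormedRing
  let : NormedAlgebra ℝ (Matrix (Fin k) (Fin k) ℝ) := Matrix.linftyOpNormedAlgebra
  have h := NormedSpace.exp_series_hasSum_exp' (𝕂 := ℝ) (t • A)
  have h1 := (Pi.hasSum.1 (Pi.hasSum.1 h i)) j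
  rw [impulse]
  refine (tsum_congr fun l => ?_).trans h1.tsum_eq
  rw [markov_resolvent, smul_pow]
  simp only [Matrix.smul_apply, smul_eq_mul]
  ring

theorem hasDerivAt_exp_mulVec (A : Matrix (Fin k) (Fin k) ℝ) (x : Fin k → ℝ) (t : ℝ) :
    HasDerivAt (fun s : ℝ => NormedSpace.exp (s • A) *ᵥ x)
      (A *ᵥ (NormedSpace.exp (t • A) *ᵥ x)) t := by
  let : NormedRing (Matrix (Fin k) (Fin k) ℝ) := Matrix.linftyOpNormedRing
  let : NormedAlgebra ℝ (Matrix (Fin k) (Fin k) ℝ) := Matrix.linftyOpNormedAlgebra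
  have h := hasDerivAt_exp_smul_const' (𝕂 := ℝ) A t
  let Φ : Matrix (Fin k) (Fin k) ℝ →ₗ[ℝ] (Fin k → ℝ) :=
    { toFun := fun B => B *ᵥ x
      map_add' := fun B C => Matrix.add_mulVec B C x
      map_smul' := fun r B => Matrix.smul_mulVec r B x }
  have h2 := (LinearMap.toContinuousLinearMap Φ).hasFDerivAt.comp_hasDerivAt t h
  rw [Matrix.mulVec_mulVec]
  exact h2

/-! ### Linear differential equations -/

theorem hasDerivWithinAt_Ioi_of_Icc {E : Type*} [NormedAddCommGroup E] [NormedSpace ℝ E]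
    {f : ℝ → E} {f' : E} {p q s : ℝ} (hs : s ∈ Ico p q)
    (h : HasDerivWithinAt f f' (Icc p q) s) : HasDerivWithinAt f f' (Ioi s) s := by
  refine h.mono_of_mem_nhdsWithin ?_
  filter_upwards [Ioo_mem_nhdsGT hs.2] with z hz
  exact ⟨hs.1.trans hz.1.le, hz.2.le⟩

theorem eq_response_X_inv {z w : ℝ → Fin k → ℝ} {t : ℝ} (ht : 0 ≤ t) (h0 : z 0 = 0)
    (hz : ∀ s ∈ Icc 0 t, HasDerivWithinAt z (w s) (Icc 0 t) s) (hw : IntOn w t) :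
    z t = response ((RatFunc.X : RatFunc ℝ)⁻¹ • (1 : TM k k)) w t := by
  funext i
  have h1 : ∀ j, resp (((RatFunc.X : RatFunc ℝ)⁻¹ • (1 : TM k k)) i j) (fun τ => w τ j) t =
      if i = j then z t j else 0 := by
    intro j
    by_cases hij : i = j
    · subst hij
      rw [if_pos rfl, Matrix.smul_apply, Matrix.one_apply_eq, smul_eq_mul, mul_one, resp]
      have e : markov (RatFunc.X : RatFunc ℝ)⁻¹ 0 = 0 := by
        rw [← coeff_markovSeries, markovSeries_X_inv]; simp
      simp only [impulse_X_inv, one_mul, e, zero_mul, zero_add]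
      have hi : ∀ s ∈ Icc 0 t, HasDerivWithinAt (fun τ => z τ i) (w s i) (Icc 0 t) s :=
        fun s hs => hasDerivWithinAt_pi.1 (hz s hs) i
      rw [intervalIntegral.integral_eq_sub_of_hasDeriv_right_of_le ht
        (fun s hs => (hi s hs).continuousWithinAt)
        (fun s hs => hasDerivWithinAt_Ioi_of_Icc ⟨hs.1.le, hs.2⟩ (hi s ⟨hs.1.le, hs.2.le⟩)) (hw i),
        h0]
      simp
    · rw [if_neg hij, Matrix.smul_apply, Matrix.one_apply_ne hij, smul_zero, resp_zero_left]
  rw [response_apply, Finset.sum_congr rfl fun j _ => h1 j]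
  simp

theorem eq_response_resolvent_of_zero {A : Matrix (Fin k) (Fin k) ℝ} {z w : ℝ → Fin k → ℝ} {t : ℝ}
    (ht : 0 ≤ t) (h0 : z 0 = 0)
    (hz : ∀ s ∈ Icc 0 t, HasDerivWithinAt z (A *ᵥ z s + w s) (Icc 0 t) s) (hw : IntOn w t) :
    z t = response (resolvent A) w t := by
  have hzc : IntOn z t := IntOn.of_continuousOn ht fun s hs => (hz s hs).continuousWithinAt
  have hR := strict_resolvent A
  have hXR : Proper ((RatFunc.X : RatFunc ℝ) • resolvent A) := hR
  have hXi : Proper ((RatFunc.X : RatFunc ℝ)⁻¹ • (1 : TM k k)) :=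
    proper_one.smul X_inv_mem_properRing
  have hAzw : IntOn (fun s => A *ᵥ z s + w s) t := (hzc.mulVec A).add hw
  have e1 : ∀ s ∈ Icc 0 t, z s =
      response ((RatFunc.X : RatFunc ℝ)⁻¹ • (1 : TM k k)) (fun s => A *ᵥ z s + w s) s :=
    fun s hs => eq_response_X_inv hs.1 h0 (fun r hr => (hz r ⟨hr.1, hr.2.trans hs.2⟩).mono
      (Icc_subset_Icc_right hs.2)) (hAzw.mono hs.1 hs.2)
  have e2 : response ((RatFunc.X : RatFunc ℝ) • resolvent A) z t =
      response (resolvent A) (fun s => A *ᵥ z s + w s) t := by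
    rw [response_congr _ ht e1, ← response_mul hXR hXi ht hAzw]
    congr 1
    rw [Matrix.smul_mul, Matrix.mul_smul, Matrix.mul_one, smul_smul,
      mul_inv_cancel₀ RatFunc.X_ne_zero, one_smul]
  rw [X_smul_resolvent', response_add_left proper_one (hR.proper.mul (proper_const A)) hzc,
    response_one, response_mul_const hR.proper A ht hzc,
    response_add_right _ (hzc.mulVec A) hw, add_comm] at e2
  exact add_left_cancel e2

/-- Variation of constants. -/
theorem eq_exp_add_response {A : Matrix (Fin k) (Fin k) ℝ} {z w : ℝ → Fin k → ℝ} {t : ℝ}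
    (ht : 0 ≤ t) (hz : ∀ s ∈ Icc 0 t, HasDerivWithinAt z (A *ᵥ z s + w s) (Icc 0 t) s)
    (hw : IntOn w t) :
    z t = NormedSpace.exp (t • A) *ᵥ z 0 + response (resolvent A) w t := by
  have h := eq_response_resolvent_of_zero (A := A) (w := w)
    (z := fun s => z s - NormedSpace.exp (s • A) *ᵥ z 0) ht (by simp) (fun s hs => by
      refine ((hz s hs).sub (hasDerivAt_exp_mulVec A (z 0) s).hasDerivWithinAt).congr_deriv ?_
      rw [Matrix.mulVec_sub]
      abel) hw
  rw [← h]
  abel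

/-! ### Full column rank and behaviour at infinity -/

theorem pinv_mul_self {N : Matrix (Fin a) (Fin b) ℝ} (h : N.rank = b) : pinv N * N = 1 := by
  have h1 : (Nᵀ * N).rank = b := by rw [Matrix.rank_transpose_mul_self, h]
  have h2 : IsUnit (Nᵀ * N) := by
    rw [← Matrix.mulVec_surjective_iff_isUnit]
    have : LinearMap.range (Nᵀ * N).mulVecLin = ⊤ := by
      apply Submodule.eq_top_of_finrank_eq
      rw [Module.finrank_fin_fun]
      exact h1
    exact LinearMap.range_eq_top.1 this
  rw [pinv, Matrix.mul_assoc, Matrix.nonsing_inv_mul _ ((Matrix.isUnit_iff_isUnit_det _).1 h2)]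

theorem tendsto_evalAt_const_add {A : Matrix (Fin a) (Fin b) ℝ} {G : TM a b} (hG : Strict G) :
    Tendsto (fun s : ℝ => evalAt (const A + G) s) atTop (𝓝 A) := by
  refine tendsto_pi_nhds.2 fun i => tendsto_pi_nhds.2 fun j => ?_
  have h1 : ∀ᶠ s : ℝ in atTop, (G i j).denom.eval s ≠ 0 := by
    have hf := (Polynomial.rootSet_finite (G i j).denom ℝ).bddAbove
    obtain ⟨M, hM⟩ := hf
    filter_upwards [eventually_gt_atTop M] with s hs h0
    have : s ∈ (G i j).denom.rootSet ℝ := by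
      rw [Polynomial.mem_rootSet]
      exact ⟨(G i j).denom_ne_zero, by simpa using h0⟩
    exact absurd (hM this) (not_le.2 hs)
  have h2 : Tendsto (fun s : ℝ => A i j + (G i j).num.eval s / (G i j).denom.eval s) atTop
      (𝓝 (A i j + 0)) :=
    tendsto_const_nhds.add (Polynomial.div_tendsto_atTop_zero_of_degree_lt _ _
      (degree_num_lt_iff.2 (hG i j)))
  rw [add_zero] at h2
  refine h2.congr' ?_
  filter_upwards [h1] with s hs
  rw [evalAt, Matrix.map_apply, Matrix.add_apply, RatFunc.eval_add]
  · simp [const, RatFunc.eval]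
  · simp [const, RatFunc.denom_C]
  · simpa [Polynomial.eval₂_id] using hs

/-! ### Inverting a transfer matrix without finite zeros -/

theorem exists_inverse_of_no_zeros {nz m : ℕ} (A : Matrix (Fin nz) (Fin nz) ℝ)
    (B : Matrix (Fin nz) (Fin m) ℝ) (C : Matrix (Fin m) (Fin nz) ℝ) (D : Matrix (Fin m) (Fin m) ℝ)
    (h : ∀ s : ℂ, (Matrix.fromBlocks (-(s • (1 : Matrix (Fin nz) (Fin nz) ℂ)) +
      A.map ((↑) : ℝ → ℂ)) (B.map ((↑) : ℝ → ℂ)) (C.map ((↑) : ℝ → ℂ))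
      (D.map ((↑) : ℝ → ℂ))).det ≠ 0) :
    ss A B C D * (ss A B C D)⁻¹ = 1 ∧ Stable (ss A B C D)⁻¹ := by
  set R : Matrix (Fin nz ⊕ Fin m) (Fin nz ⊕ Fin m) (Polynomial ℝ) := Matrix.fromBlocks
    (-((Polynomial.X : Polynomial ℝ) • (1 : Matrix (Fin nz) (Fin nz) (Polynomial ℝ))) +
      A.map Polynomial.C) (B.map Polynomial.C) (C.map Polynomial.C) (D.map Polynomial.C) with hR
  have hroot : ∀ s : ℂ, Polynomial.aeval s R.det ≠ 0 := by
    intro s hs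
    apply h s
    rw [AlgHom.map_det] at hs
    rw [← hs, hR]
    congr 1
    rw [AlgHom.mapMatrix_apply, Matrix.fromBlocks_map]
    congr 1 <;> ext i j <;> simp [Matrix.one_apply]
    split_ifs <;> simp
  have hdeg : R.det.degree = 0 := by
    by_contra hne
    obtain ⟨z, hz⟩ := IsAlgClosed.exists_aeval_eq_zero ℂ R.det hne
    exact hroot z hz
  obtain ⟨d, hd⟩ : ∃ d : ℝ, R.det = Polynomial.C d := ⟨_, Polynomial.eq_C_of_degree_eq_zero hdeg⟩
  have hd0 : d ≠ 0 := by
    intro h0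
    rw [h0, map_zero] at hd
    exact hroot 0 (by rw [hd, map_zero])
  set R' : Matrix (Fin nz ⊕ Fin m) (Fin nz ⊕ Fin m) (RatFunc ℝ) :=
    R.map (algebraMap (Polynomial ℝ) (RatFunc ℝ)) with hR'
  have hblocks : R' = Matrix.fromBlocks
      (-((RatFunc.X : RatFunc ℝ) • (1 : TM nz nz) - const A)) (const B) (const C) (const D) := by
    rw [hR', hR, Matrix.fromBlocks_map]
    congr 1 <;> ext i j <;> simp [const, RatFunc.algebraMap_C, Matrix.one_apply]
    split_ifs <;> simp [RatFunc.algebraMap_X]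
    ring
  have hdet : R'.det = RatFunc.C d := by
    rw [hR', ← RingHom.mapMatrix_apply, ← RingHom.map_det, hd, RatFunc.algebraMap_C]
  have hunit : IsUnit R'.det := by
    rw [hdet, isUnit_iff_ne_zero]
    simpa using hd0
  have hinv : ∀ i j, R'⁻¹ i j ∈ stableRing := by
    intro i j
    rw [Matrix.inv_def, hdet, Ring.inverse_eq_inv', Matrix.smul_apply, smul_eq_mul, ← map_inv₀]
    refine stableRing.mul_mem (C_mem_stableRing _) ?_
    have : R'.adjugate i j = algebraMap (Polynomial ℝ) (RatFunc ℝ) (R.adjugate i j) :=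
      congrFun (congrFun (RingHom.map_adjugate (algebraMap (Polynomial ℝ) (RatFunc ℝ))
        R).symm i) j
    rw [this]
    exact polynomial_mem_stableRing _
  have hmul := Matrix.mul_nonsing_inv _ hunit
  set N12 : TM nz m := R'⁻¹.toBlocks₁₂ with hN12
  set N22 : TM m m := R'⁻¹.toBlocks₂₂ with hN22
  rw [← Matrix.fromBlocks_toBlocks R'⁻¹, hblocks, Matrix.fromBlocks_multiply,
    ← Matrix.fromBlocks_one, Matrix.fromBlocks_inj] at hmul
  obtain ⟨-, h12, -, h22⟩ := hmul
  have h12' : N12 = resolvent A * const B * N22 := by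
    have : ((RatFunc.X : RatFunc ℝ) • (1 : TM nz nz) - const A) * N12 = const B * N22 := by
      rw [← hblocks, Matrix.neg_mul] at h12
      exact (neg_add_eq_zero.1 h12)
    rw [Matrix.mul_assoc, ← this, ← Matrix.mul_assoc, resolvent_mul_self, Matrix.one_mul]
  have hZ : ss A B C D * N22 = 1 := by
    rw [← hblocks] at h22
    rw [← h22, ss, Matrix.add_mul]
    congr 1
    change _ = const C * N12
    rw [h12', Matrix.mul_assoc, Matrix.mul_assoc, Matrix.mul_assoc]
  have hZinv : (ss A B C D)⁻¹ = N22 := Matrix.inv_eq_right_inv hZ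
  rw [hZinv]
  exact ⟨hZ, fun i j => hinv (Sum.inr i) (Sum.inr j)⟩

end L1Control

end

noncomputable section

namespace L1Control

variable {k l : ℕ}

/-! ### Quadratic forms -/

theorem dot_self_nonneg (v : Fin k → ℝ) : 0 ≤ v ⬝ᵥ v :=
  Finset.sum_nonneg fun _ _ => mul_self_nonneg _

theorem norm_sq_le_dot (v : Fin k → ℝ) : ‖v‖ ^ 2 ≤ v ⬝ᵥ v := by
  have h : ‖v‖ ≤ √(v ⬝ᵥ v) := by
    refine (pi_norm_le_iff_of_nonneg (Real.sqrt_nonneg _)).2 fun i => ?_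
    rw [Real.norm_eq_abs]
    refine Real.abs_le_sqrt ?_
    rw [sq]
    exact Finset.single_le_sum (f := fun i => v i * v i) (fun _ _ => mul_self_nonneg _)
      (Finset.mem_univ i)
  calc ‖v‖ ^ 2 ≤ √(v ⬝ᵥ v) ^ 2 := pow_le_pow_left₀ (norm_nonneg _) h 2
    _ = _ := Real.sq_sqrt (dot_self_nonneg v)

theorem dot_le_card_mul_norm_sq (v : Fin k → ℝ) : v ⬝ᵥ v ≤ k * ‖v‖ ^ 2 := by
  have h : ∀ i, v i * v i ≤ ‖v‖ ^ 2 := fun i => by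
    have := norm_le_pi_norm v i
    rw [Real.norm_eq_abs] at this
    rw [← abs_mul_abs_self, ← sq]
    exact pow_le_pow_left₀ (abs_nonneg _) this 2
  refine (Finset.sum_le_sum fun i _ => h i).trans ?_
  simp

theorem dot_le_mul_of_sq_le {v w : Fin k → ℝ} {A B : ℝ} (hA : 0 ≤ A) (hB : 0 ≤ B)
    (hv : v ⬝ᵥ v ≤ A ^ 2) (hw : w ⬝ᵥ w ≤ B ^ 2) : v ⬝ᵥ w ≤ A * B := by
  have h := Finset.sum_mul_sq_le_sq_mul_sq Finset.univ v w
  have h1 : ∑ i, v i ^ 2 = v ⬝ᵥ v := Finset.sum_congr rfl fun i _ => sq _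
  have h2 : ∑ i, w i ^ 2 = w ⬝ᵥ w := Finset.sum_congr rfl fun i _ => sq _
  rw [h1, h2] at h
  refine le_of_sq_le_sq ?_ (mul_nonneg hA hB)
  calc (v ⬝ᵥ w) ^ 2 ≤ (v ⬝ᵥ v) * (w ⬝ᵥ w) := h
    _ ≤ A ^ 2 * B ^ 2 := mul_le_mul hv hw (dot_self_nonneg w) (sq_nonneg A)
    _ = _ := by ring

theorem spectrum_eq_range {P : Matrix (Fin k) (Fin k) ℝ} (hP : P.IsHermitian) :
    spectrum ℝ P = Set.range hP.eigenvalues := hP.spectrum_real_eq_range_eigenvalues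

theorem spectrum_finite {P : Matrix (Fin k) (Fin k) ℝ} (hP : P.IsHermitian) :
    (spectrum ℝ P).Finite := by
  rw [spectrum_eq_range hP]
  exact Set.finite_range _

theorem spectrum_nonempty_of_pos (hk : 0 < k) {P : Matrix (Fin k) (Fin k) ℝ}
    (hP : P.IsHermitian) : (spectrum ℝ P).Nonempty := by
  rw [spectrum_eq_range hP]
  exact ⟨_, ⟨0, hk⟩, rfl⟩

theorem lamMin_mul_dot_le {P : Matrix (Fin k) (Fin k) ℝ} (hP : P.IsHermitian) (v : Fin k → ℝ) :
    lamMin P * (v ⬝ᵥ v) ≤ v ⬝ᵥ (P *ᵥ v) := by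
  have hs := spectrum.sub_singleton_eq P (lamMin P)
  have h : (P - algebraMap ℝ (Matrix (Fin k) (Fin k) ℝ) (lamMin P)).PosSemidef := by
    rw [Matrix.posSemidef_iff_isHermitian_and_spectrum_nonneg]
    refine ⟨hP.sub (by rw [Algebra.algebraMap_eq_smul_one]; simp [Matrix.IsHermitian]), ?_⟩
    rw [← hs]
    rintro _ ⟨x, hx, y, hy, rfl⟩
    rw [mem_singleton_iff] at hy
    subst hy
    exact sub_nonneg.2 (csInf_le (spectrum_finite hP).bddBelow hx)
  have := h.dotProduct_mulVec_nonneg v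
  rw [Algebra.algebraMap_eq_smul_one, Matrix.sub_mulVec, dotProduct_sub, Matrix.smul_mulVec,
    Matrix.one_mulVec, dotProduct_smul, smul_eq_mul, star_trivial] at this
  linarith

theorem dot_le_lamMax_mul {P : Matrix (Fin k) (Fin k) ℝ} (hP : P.IsHermitian) (v : Fin k → ℝ) :
    v ⬝ᵥ (P *ᵥ v) ≤ lamMax P * (v ⬝ᵥ v) := by
  have hs := spectrum.singleton_sub_eq P (lamMax P)
  have h : (algebraMap ℝ (Matrix (Fin k) (Fin k) ℝ) (lamMax P) - P).PosSemidef := by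
    rw [Matrix.posSemidef_iff_isHermitian_and_spectrum_nonneg]
    refine ⟨Matrix.IsHermitian.sub (by rw [Algebra.algebraMap_eq_smul_one];
                                       simp [Matrix.IsHermitian]) hP, ?_⟩
    rw [← hs]
    rintro _ ⟨y, hy, x, hx, rfl⟩
    rw [mem_singleton_iff] at hy
    subst hy
    exact sub_nonneg.2 (le_csSup (spectrum_finite hP).bddAbove hx)
  have := h.dotProduct_mulVec_nonneg v
  rw [Algebra.algebraMap_eq_smul_one, Matrix.sub_mulVec, dotProduct_sub, Matrix.smul_mulVec,
    Matrix.one_mulVec, dotProduct_smul, smul_eq_mul, star_trivial] at this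
  linarith

theorem lamMin_pos (hk : 0 < k) {P : Matrix (Fin k) (Fin k) ℝ} (hP : P.PosDef) : 0 < lamMin P := by
  have h := (spectrum_nonempty_of_pos hk hP.isHermitian).csInf_mem (spectrum_finite hP.isHermitian)
  rw [spectrum_eq_range hP.isHermitian] at h
  obtain ⟨i, hi⟩ := h
  rw [lamMin, spectrum_eq_range hP.isHermitian, ← hi]
  exact hP.eigenvalues_pos i

theorem lamMax_pos (hk : 0 < k) {P : Matrix (Fin k) (Fin k) ℝ} (hP : P.PosDef) : 0 < lamMax P := by
  have h := (spectrum_nonempty_of_pos hk hP.isHermitian).csSup_mem (spectrum_finite hP.isHermitian)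
  rw [spectrum_eq_range hP.isHermitian] at h
  obtain ⟨i, hi⟩ := h
  rw [lamMax, spectrum_eq_range hP.isHermitian, ← hi]
  exact hP.eigenvalues_pos i

theorem isHermitian_sub_smul_one {P : Matrix (Fin k) (Fin k) ℝ} (hP : P.IsHermitian) (r : ℝ) :
    (P - r • (1 : Matrix (Fin k) (Fin k) ℝ)).IsHermitian := hP.sub (by simp [Matrix.IsHermitian])

theorem lamMin_sub_smul_one_pos (hk : 0 < k) {P : Matrix (Fin k) (Fin k) ℝ} (hP : P.IsHermitian)
    {r : ℝ} (hr : r < lamMin P) : 0 < lamMin (P - r • (1 : Matrix (Fin k) (Fin k) ℝ)) := by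
  have hH := isHermitian_sub_smul_one hP r
  have hs := spectrum.sub_singleton_eq P r
  rw [Algebra.algebraMap_eq_smul_one] at hs
  refine (sub_pos.2 hr).trans_le (le_csInf (spectrum_nonempty_of_pos hk hH) ?_)
  rw [← hs]
  rintro _ ⟨x, hx, y, hy, rfl⟩
  rw [mem_singleton_iff] at hy
  subst hy
  exact sub_le_sub_right (csInf_le (spectrum_finite hP).bddBelow hx) _

theorem dot_mulVec_symm {P : Matrix (Fin k) (Fin k) ℝ} (hP : P.IsHermitian) (v w : Fin k → ℝ) :
    v ⬝ᵥ (P *ᵥ w) = w ⬝ᵥ (P *ᵥ v) := by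
  have h : Pᵀ = P := by rw [← Matrix.conjTranspose_eq_transpose_of_trivial]; exact hP
  rw [Matrix.dotProduct_mulVec, ← Matrix.mulVec_transpose, h, dotProduct_comm]

theorem dot_transpose_mulVec_le (N : Matrix (Fin k) (Fin l) ℝ) (v : Fin k → ℝ) :
    (Nᵀ *ᵥ v) ⬝ᵥ (Nᵀ *ᵥ v) ≤ twoNorm N ^ 2 * (v ⬝ᵥ v) := by
  let : NormedAddCommGroup (Matrix (Fin k) (Fin l) ℝ) := Matrix.instL2OpNormedAddCommGroup
  let : NormedAddCommGroup (Matrix (Fin l) (Fin k) ℝ) := Matrix.instL2OpNormedAddCommGroup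
  have h := Matrix.l2_opNorm_mulVec Nᴴ (WithLp.toLp 2 v)
  rw [Matrix.l2_opNorm_conjTranspose] at h
  have h1 : ∀ {d : ℕ} (w : Fin d → ℝ), ‖(WithLp.toLp 2 w : EuclideanSpace ℝ (Fin d))‖ ^ 2 = w ⬝ᵥ w :=
    fun w => by
      rw [EuclideanSpace.norm_sq_eq]
      exact Finset.sum_congr rfl fun i _ => by rw [Real.norm_eq_abs, sq_abs, sq]
  have h2 := pow_le_pow_left₀ (norm_nonneg _) h 2
  rw [mul_pow, h1, h1, Matrix.conjTranspose_eq_transpose_of_trivial] at h2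
  exact h2

/-! ### Derivatives of quadratic forms -/

theorem HasDerivWithinAt.mulVec {z : ℝ → Fin k → ℝ} {z' : Fin k → ℝ} {s : Set ℝ} {t : ℝ}
    (A : Matrix (Fin l) (Fin k) ℝ) (h : HasDerivWithinAt z z' s t) :
    HasDerivWithinAt (fun τ => A *ᵥ z τ) (A *ᵥ z') s t :=
  (LinearMap.toContinuousLinearMap A.mulVecLin).hasFDerivAt.comp_hasDerivWithinAt t h

theorem HasDerivWithinAt.dot {z w : ℝ → Fin k → ℝ} {z' w' : Fin k → ℝ} {s : Set ℝ} {t : ℝ}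
    (hz : HasDerivWithinAt z z' s t) (hw : HasDerivWithinAt w w' s t) :
    HasDerivWithinAt (fun τ => z τ ⬝ᵥ w τ) (z' ⬝ᵥ w t + z t ⬝ᵥ w') s t := by
  have h := HasDerivWithinAt.fun_sum (u := Finset.univ) fun i (_ : i ∈ Finset.univ) =>
    (hasDerivWithinAt_pi.1 hz i).mul (hasDerivWithinAt_pi.1 hw i)
  refine h.congr_deriv ?_
  rw [Finset.sum_add_distrib]
  rfl

theorem HasDerivWithinAt.quadratic {z : ℝ → Fin k → ℝ} {z' : Fin k → ℝ} {s : Set ℝ} {t : ℝ}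
    {P : Matrix (Fin k) (Fin k) ℝ} (hP : P.IsHermitian) (h : HasDerivWithinAt z z' s t) :
    HasDerivWithinAt (fun τ => z τ ⬝ᵥ (P *ᵥ z τ)) (2 * (z t ⬝ᵥ (P *ᵥ z'))) s t := by
  refine (HasDerivWithinAt.dot h (HasDerivWithinAt.mulVec P h)).congr_deriv ?_
  rw [dot_mulVec_symm hP z' (z t)]
  ring

theorem HasDerivWithinAt.dot_self {z : ℝ → Fin k → ℝ} {z' : Fin k → ℝ} {s : Set ℝ} {t : ℝ}
    (h : HasDerivWithinAt z z' s t) :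
    HasDerivWithinAt (fun τ => z τ ⬝ᵥ z τ) (2 * (z t ⬝ᵥ z')) s t := by
  refine (HasDerivWithinAt.dot h h).congr_deriv ?_
  rw [dotProduct_comm z']
  ring

/-! ### The projection operator -/

theorem sub_dot_proj_sub_nonpos {c z zs y : Fin k → ℝ} {ϱ ε : ℝ} (hϱ : 0 < ϱ) (hε : 0 < ε)
    (hzs : (zs - c) ⬝ᵥ (zs - c) ≤ ϱ ^ 2) : (z - zs) ⬝ᵥ (proj c ϱ ε z y - y) ≤ 0 := by
  rw [proj]
  split_ifs with h
  · obtain ⟨h1, h2⟩ := h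
    set w := z - c with hw
    set q := w ⬝ᵥ w with hq
    have hq1 : ϱ ^ 2 < q := by
      have := (div_pos_iff_of_pos_right (by positivity : 0 < ε * ϱ ^ 2)).1 h1
      linarith
    have hqs : q = (√q) ^ 2 := (Real.sq_sqrt (dot_self_nonneg w)).symm
    have hle : ϱ ≤ √q := Real.le_sqrt_of_sq_le hq1.le
    have h3 : (zs - c) ⬝ᵥ w ≤ ϱ * √q :=
      dot_le_mul_of_sq_le hϱ.le (Real.sqrt_nonneg _) hzs (le_of_eq hqs)
    have h4 : (z - zs) ⬝ᵥ w = q - (zs - c) ⬝ᵥ w := by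
      rw [hq, ← sub_dotProduct]
      congr 1
      rw [hw]
      abel
    rw [sub_sub_cancel_left, ← neg_smul, dotProduct_smul, smul_eq_mul, h4]
    have h5 : 0 ≤ q - (zs - c) ⬝ᵥ w := by nlinarith [Real.sqrt_nonneg q]
    have h6 : 0 ≤ (q - ϱ ^ 2) / (ε * ϱ ^ 2) * (w ⬝ᵥ y) / q :=
      div_nonneg (mul_nonneg h1.le h2.le) (dot_self_nonneg w)
    rw [neg_mul]
    exact neg_nonpos.2 (mul_nonneg h6 h5)
  · simp

theorem dot_proj_nonpos {c z y : Fin k → ℝ} {ϱ ε : ℝ} (hϱ : 0 < ϱ) (hε : 0 < ε)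
    (hz : (1 + ε) * ϱ ^ 2 ≤ (z - c) ⬝ᵥ (z - c)) : (z - c) ⬝ᵥ proj c ϱ ε z y ≤ 0 := by
  have hpos : 0 < ε * ϱ ^ 2 := by positivity
  have h1 : 1 ≤ ((z - c) ⬝ᵥ (z - c) - ϱ ^ 2) / (ε * ϱ ^ 2) := by
    rw [le_div_iff₀ hpos]
    linarith
  have hq : (z - c) ⬝ᵥ (z - c) ≠ 0 := by
    have : 0 < (1 + ε) * ϱ ^ 2 := by positivity
    linarith
  rw [proj]
  split_ifs with h
  · rw [dotProduct_sub, dotProduct_smul, smul_eq_mul, div_mul_cancel₀ _ hq]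
    nlinarith [h.2]
  · by_contra hc
    exact h ⟨zero_lt_one.trans_le h1, not_le.1 hc⟩

theorem proj_invariance {c : Fin k → ℝ} {ϱ ε Γ T : ℝ} (hϱ : 0 < ϱ) (hε : 0 < ε) (hΓ : 0 < Γ)
    {z y : ℝ → Fin k → ℝ} (h0 : (z 0 - c) ⬝ᵥ (z 0 - c) ≤ ϱ ^ 2)
    (hz : ∀ t ∈ Icc 0 T, HasDerivWithinAt z (Γ • proj c ϱ ε (z t) (y t)) (Icc 0 T) t) :
    ∀ t ∈ Icc 0 T, (z t - c) ⬝ᵥ (z t - c) ≤ (1 + ε) * ϱ ^ 2 := by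
  have hd : ∀ t ∈ Icc 0 T, HasDerivWithinAt (fun t => (z t - c) ⬝ᵥ (z t - c))
      (2 * ((z t - c) ⬝ᵥ (Γ • proj c ϱ ε (z t) (y t)))) (Icc 0 T) t := fun t ht =>
    HasDerivWithinAt.dot_self ((hz t ht).sub_const c)
  have hc : ContinuousOn (fun t => (z t - c) ⬝ᵥ (z t - c)) (Icc 0 T) := fun t ht =>
    (hd t ht).continuousWithinAt
  have key : ∀ η : ℝ, 0 < η → ∀ t ∈ Icc 0 T,
      (z t - c) ⬝ᵥ (z t - c) ≤ (1 + ε) * ϱ ^ 2 + η * t := by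
    intro η hη t ht
    refine image_le_of_deriv_right_lt_deriv_boundary
      (f := fun t => (z t - c) ⬝ᵥ (z t - c))
      (B := fun t => (1 + ε) * ϱ ^ 2 + η * t) (B' := fun _ => η) hc
      (fun x hx => (hasDerivWithinAt_Ioi_of_Icc hx (hd x ⟨hx.1, hx.2.le⟩)).Ici_of_Ioi) ?_ ?_ ?_ ht
    · nlinarith [sq_nonneg ϱ, mul_nonneg hε.le (sq_nonneg ϱ)]
    · intro x
      simpa using ((hasDerivAt_id x).const_mul η).const_add ((1 + ε) * ϱ ^ 2)
    · intro x hx hxe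
      have hge : (1 + ε) * ϱ ^ 2 ≤ (z x - c) ⬝ᵥ (z x - c) := by
        have : (z x - c) ⬝ᵥ (z x - c) = (1 + ε) * ϱ ^ 2 + η * x := hxe
        rw [this]
        nlinarith [mul_nonneg hη.le hx.1]
      have := dot_proj_nonpos (y := y x) hϱ hε hge
      rw [dotProduct_smul, smul_eq_mul]
      nlinarith
  intro t ht
  refine le_of_forall_pos_le_add fun η hη => ?_
  have h1 : 0 < 1 + T := by linarith [ht.1.trans ht.2]
  refine (key (η / (1 + T)) (by positivity) t ht).trans ?_
  gcongr
  rw [div_mul_eq_mul_div, div_le_iff₀ h1]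
  nlinarith [ht.2, ht.1]

theorem sub_dot_sub_le_of_layer {c z zs : Fin k → ℝ} {ϱ ε E : ℝ} (hϱ : 0 < ϱ) (hε : 0 < ε)
    (hE : ε ≤ E) (hz : (z - c) ⬝ᵥ (z - c) ≤ (1 + ε) * ϱ ^ 2)
    (hzs : (zs - c) ⬝ᵥ (zs - c) ≤ ϱ ^ 2) : (z - zs) ⬝ᵥ (z - zs) ≤ (4 + 2 * E) * ϱ ^ 2 := by
  have h1 : (c - z) ⬝ᵥ (zs - c) ≤ ((1 + ε / 2) * ϱ) * ϱ := by
    refine dot_le_mul_of_sq_le (by positivity) hϱ.le ?_ hzs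
    rw [← neg_sub z c, neg_dotProduct_neg]
    refine hz.trans ?_
    nlinarith [mul_nonneg (sq_nonneg ε) (sq_nonneg ϱ)]
  have h2 : (z - zs) ⬝ᵥ (z - zs) = (z - c) ⬝ᵥ (z - c) + (zs - c) ⬝ᵥ (zs - c) +
      2 * ((c - z) ⬝ᵥ (zs - c)) := by
    have e : z - zs = (z - c) - (zs - c) := by abel
    rw [e, ← neg_sub z c]
    simp only [sub_dotProduct, dotProduct_sub, neg_dotProduct]
    rw [dotProduct_comm zs z, dotProduct_comm c z, dotProduct_comm zs c]
    ring
  rw [h2]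
  nlinarith [mul_nonneg (sub_nonneg.2 hE) (sq_nonneg ϱ)]

/-! ### A comparison principle with one-sided upper derivatives -/

theorem le_exp_decay_of_upper_derivative {V : ℝ → ℝ} {lam c T : ℝ} (hlam : 0 < lam)
    (hV : ContinuousOn V (Icc 0 T))
    (h : ∀ s ∈ Ico 0 T, ∃ (U : ℝ → ℝ) (U' : ℝ), HasDerivWithinAt U U' (Ioi s) s ∧ U s = V s ∧
      (∀ᶠ z in 𝓝[>] s, V z ≤ U z) ∧ U' ≤ -lam * V s + c) :
    ∀ t ∈ Icc 0 T, V t ≤ Real.exp (-lam * t) * V 0 + (1 - Real.exp (-lam * t)) * (c / lam) := by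
  intro t ht
  have h1 := le_gronwallBound_of_liminf_deriv_right_le (f := V) (f' := fun s => -lam * V s + c)
    (δ := V 0) (K := -lam) (ε := c) hV ?_ le_rfl (fun _ _ => le_rfl) t ht
  · rw [gronwallBound_of_K_ne_0 (by linarith)] at h1
    refine h1.trans (le_of_eq ?_)
    rw [sub_zero]
    field_simp
    ring
  · intro s hs r hr
    obtain ⟨U, U', hU, hUs, hle, hb⟩ := h s hs
    have h2 : Tendsto (slope U s) (𝓝[>] s) (𝓝 U') := by
      have := hasDerivWithinAt_iff_tendsto_slope.1 hU
      rwa [sdiff_singleton_eq_self self_notMem_Ioi] at this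
    have h3 : ∀ᶠ z in 𝓝[>] s, slope U s z < r := h2.eventually_lt_const (hb.trans_lt hr)
    refine Eventually.frequently ?_
    filter_upwards [h3, hle, self_mem_nhdsWithin] with z hz1 hz2 hz3
    rw [slope_def_field, div_eq_inv_mul] at hz1
    have hpos : 0 ≤ (z - s)⁻¹ := inv_nonneg.2 (sub_nonneg.2 (le_of_lt hz3))
    refine lt_of_le_of_lt (mul_le_mul_of_nonneg_left ?_ hpos) hz1
    rw [hUs]
    linarith

end L1Control

end

noncomputable section

namespace L1Control

/-! ### Consequences of the design constraints -/

theorem infNorm_eq_zero {ι κ : Type} [Fintype ι] [Fintype κ] {A : Matrix ι κ ℝ}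
    (h : infNorm A = 0) : A = 0 := by
  let : NormedAddCommGroup (Matrix ι κ ℝ) := Matrix.linftyOpNormedAddCommGroup
  exact norm_eq_zero.1 h

theorem continuous_infNorm {ι κ : Type} [Fintype ι] [Fintype κ] {F : ℝ → Matrix ι κ ℝ}
    (hF : Continuous F) : Continuous fun r => infNorm (F r) := by
  let : NormedAddCommGroup (Matrix ι κ ℝ) := Matrix.linftyOpNormedAddCommGroup
  exact hF.norm

theorem isUnit_det_of_hurwitz {k : ℕ} {A : Matrix (Fin k) (Fin k) ℝ} (hA : Hurwitz A) :
    IsUnit A.det := by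
  rw [isUnit_iff_ne_zero]
  intro h
  have h0 : (0 : ℂ) ∈ spectrum ℂ (A.map ((↑) : ℝ → ℂ)) := by
    rw [spectrum.mem_iff, map_zero, zero_sub, IsUnit.neg_iff, Matrix.isUnit_iff_isUnit_det,
      isUnit_iff_ne_zero, not_not]
    have := (RingHom.map_det Complex.ofRealHom A).symm
    rw [h, map_zero] at this
    exact this
  simpa using hA 0 h0

namespace Design.Admissible

variable {n m p nz mr : ℕ} {S : Design n m p nz mr}

theorem Z_mul_inv (hS : S.Admissible) : S.Z * S.Z⁻¹ = 1 :=
  (exists_inverse_of_no_zeros S.Az S.Bz S.Cz S.Dz hS.no_zeros).1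

theorem stable_Z_inv (hS : S.Admissible) : Stable S.Z⁻¹ :=
  (exists_inverse_of_no_zeros S.Az S.Bz S.Cz S.Dz hS.no_zeros).2

theorem Cm_mul_Tz (hS : S.Admissible) : S.Cm * S.Tz = 0 := by
  have h := hS.CmAmTz
  rw [Matrix.mul_assoc, hS.AmTz, Matrix.mul_add, ← Matrix.mul_assoc, ← Matrix.mul_assoc,
    add_eq_right] at h
  have h1 := congrArg (· * S.Az⁻¹) h
  simpa [Matrix.mul_assoc, Matrix.mul_nonsing_inv _ (isUnit_det_of_hurwitz hS.hurwitz_Az)] using h1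

theorem H0_eq (hS : S.Admissible) : S.H0 = const S.Tz * (resolvent S.Az * const S.Bz) +
    resolvent S.Am * const S.Bbar * S.Z := by
  have h1 : ((RatFunc.X : RatFunc ℝ) • (1 : TM n n) - const S.Am) * const S.Tz =
      const S.Tz * ((RatFunc.X : RatFunc ℝ) • (1 : TM nz nz) - const S.Az) -
        const S.Bbar * const S.Cz := by
    rw [Matrix.sub_mul, Matrix.mul_sub, const_mul_const, const_mul_const, const_mul_const, hS.AmTz]
    have : const (S.Tz * S.Az + S.Bbar * S.Cz) = const (S.Tz * S.Az) + const (S.Bbar * S.Cz) :=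
      Matrix.map_add _ (map_add _) _ _
    rw [this, Matrix.smul_mul, Matrix.mul_smul, Matrix.one_mul, Matrix.mul_one]
    abel
  have h2 : const S.Tz * resolvent S.Az = resolvent S.Am * const S.Tz -
      resolvent S.Am * const S.Bbar * const S.Cz * resolvent S.Az := by
    have h3 := congrArg (fun G => resolvent S.Am * G * resolvent S.Az) h1
    beta_reduce at h3
    rw [← Matrix.mul_assoc, resolvent_mul_self, Matrix.one_mul, Matrix.mul_sub, Matrix.sub_mul,
      Matrix.mul_assoc (resolvent S.Am) (const S.Tz * _), Matrix.mul_assoc (const S.Tz),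
      mul_resolvent_self, Matrix.mul_one, ← Matrix.mul_assoc] at h3
    exact h3
  have h4 : const S.Bm = const S.Tz * const S.Bz + const S.Bbar * const S.Dz := by
    rw [const_mul_const, const_mul_const, hS.Bm_eq]
    exact Matrix.map_add _ (map_add _) _ _
  rw [Design.H0, h4, ← Matrix.mul_assoc (const S.Tz), h2, Design.Z, ss, Matrix.mul_add,
    Matrix.mul_add, Matrix.sub_mul]
  simp only [Matrix.mul_assoc]
  abel

theorem M_mul_Z_inv (hS : S.Admissible) :
    S.M * S.Z⁻¹ = const S.Cm * resolvent S.Am * const S.Bbar := by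
  have h0 : const (0 : Matrix (Fin p) (Fin m) ℝ) = 0 := Matrix.map_zero _ (map_zero _)
  have h1 : S.M = const S.Cm * S.H0 := by
    rw [Design.M, ss, h0, add_zero, Design.H0, Matrix.mul_assoc]
  have h2 : const S.Cm * const S.Tz = 0 := by
    rw [const_mul_const, hS.Cm_mul_Tz]
    exact Matrix.map_zero _ (map_zero _)
  rw [h1, hS.H0_eq, Matrix.mul_add, ← Matrix.mul_assoc, h2, Matrix.zero_mul, zero_add,
    Matrix.mul_assoc, Matrix.mul_assoc (resolvent S.Am * const S.Bbar), hS.Z_mul_inv,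
    Matrix.mul_one, Matrix.mul_assoc]

theorem rank_CB (hS : S.Admissible) : (S.Cm * S.Bbar).rank = m := by
  obtain ⟨N, hN, hr⟩ := hS.interactor
  have h1 : ((RatFunc.X : RatFunc ℝ) • S.M) * S.Z⁻¹ = const (S.Cm * S.Bbar) +
      const S.Cm * (const S.Am * resolvent S.Am) * const S.Bbar := by
    rw [Matrix.smul_mul, hS.M_mul_Z_inv, ← Matrix.smul_mul, ← Matrix.mul_smul, X_smul_resolvent,
      Matrix.mul_add, Matrix.mul_one, Matrix.add_mul, const_mul_const]
  have h2 : Strict (const S.Cm * (const S.Am * resolvent S.Am) * const S.Bbar) :=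
    ((proper_const _).mul_strict ((proper_const _).mul_strict (strict_resolvent _))).mul_proper
      (proper_const _)
  rw [h1] at hN
  rw [← tendsto_nhds_unique hN (tendsto_evalAt_const_add h2)]
  exact hr

theorem CBdag_mul (hS : S.Admissible) : S.CBdag * (S.Cm * S.Bbar) = 1 := pinv_mul_self hS.rank_CB

theorem n_pos (hS : S.Admissible) : 0 < n := by
  have h1 := Matrix.rank_mul_le_left S.Cm S.Bbar
  rw [hS.rank_CB] at h1
  exact hS.m_pos.trans_le (h1.trans (by simpa using Matrix.rank_le_width S.Cm))

theorem p_pos (hS : S.Admissible) : 0 < p := by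
  have h1 : (S.Cm * S.Bbar).rank ≤ p := by simpa using Matrix.rank_le_height (S.Cm * S.Bbar)
  rw [hS.rank_CB] at h1
  exact hS.m_pos.trans_le h1

theorem ρx_pos (hS : S.Admissible) : 0 < S.ρx := add_pos hS.ρr_pos hS.γbar_pos

theorem Cz_or_Dz_ne_zero (hS : S.Admissible) : S.Cz * pinv S.Tz ≠ 0 ∨ S.Dz ≠ 0 := by
  by_contra hc
  push Not at hc
  obtain ⟨h1, h2⟩ := hc
  have h3 : S.Cz = 0 := by
    have := congrArg (· * S.Tz) h1
    simpa [Matrix.mul_assoc, pinv_mul_self hS.Tz_rank] using this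
  have h4 : S.Z = 0 := by
    rw [Design.Z, ss, h2, h3]
    have e1 : const (0 : Matrix (Fin m) (Fin nz) ℝ) = 0 := Matrix.map_zero _ (map_zero _)
    have e2 : const (0 : Matrix (Fin m) (Fin m) ℝ) = 0 := Matrix.map_zero _ (map_zero _)
    rw [e1, e2]
    simp
  have h5 := hS.Z_mul_inv
  rw [h4, Matrix.zero_mul] at h5
  have h6 := congrFun (congrFun h5 ⟨0, hS.m_pos⟩) ⟨0, hS.m_pos⟩
  simp at h6

theorem bddAbove_dbar (S : Design n m p nz mr) :
    BddAbove ((fun ω : ℝ => infNorm (S.Cz * pinv S.Tz * S.Tg ω) +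
      infNorm S.Dz * infNorm (S.Tg ω) * S.d S.ρx) '' S.Cω) := by
  have hT : Continuous fun ω => S.Tg ω := by
    refine continuous_matrix fun i j => ?_
    rcases j with j | j
    · simp only [Design.Tg, Matrix.fromCols_apply_inl]
      fun_prop
    · simp only [Design.Tg, Matrix.fromCols_apply_inr, Matrix.smul_apply, smul_eq_mul]
      fun_prop
  have h1 := continuous_infNorm hT
  have h2 : Continuous fun ω => infNorm (S.Cz * pinv S.Tz * S.Tg ω) :=
    continuous_infNorm (continuous_const.matrix_mul hT)
  refine (isCompact_Icc.image ?_).bddAbove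
  fun_prop

theorem le_dbar (S : Design n m p nz mr) {ω : ℝ} (hω : ω ∈ S.Cω) :
    infNorm (S.Cz * pinv S.Tz * S.Tg ω) + infNorm S.Dz * infNorm (S.Tg ω) * S.d S.ρx ≤ S.dbar :=
  le_csSup (bddAbove_dbar S) ⟨ω, hω, rfl⟩

theorem Tg_mulVec (S : Design n m p nz mr) (ω : ℝ) (v : Fin n → ℝ) (w : Fin nz → ℝ) :
    S.Tg ω *ᵥ Sum.elim v w = v + ω • (S.Tz *ᵥ w) := by
  rw [Design.Tg, Matrix.fromCols_mulVec]
  simp [Matrix.smul_mulVec]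

theorem infNorm_pos {ι κ : Type} [Fintype ι] [Fintype κ] {A : Matrix ι κ ℝ} (h : A ≠ 0) :
    0 < infNorm A := lt_of_le_of_ne (infNorm_nonneg A) fun h0 => h (infNorm_eq_zero h0.symm)

theorem dbar_pos (hS : S.Admissible) : 0 < S.dbar := by
  refine lt_of_lt_of_le ?_ (le_dbar S hS.one_mem)
  have hd := hS.d_pos _ hS.ρx_pos
  have hinj : ∀ {q : ℕ} (A : Matrix (Fin q) (Fin n) ℝ), A * S.Tg 1 = 0 → A = 0 := by
    intro q A hA
    ext i j
    have := congrFun (congrFun hA i) (Sum.inl j)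
    rw [Design.Tg, Matrix.mul_fromCols, Matrix.fromCols_apply_inl, Matrix.mul_one] at this
    simpa using this
  have hTg : S.Tg 1 ≠ 0 := by
    intro h
    have h1 := hinj (q := n) 1 (by rw [h, Matrix.mul_zero])
    have := congrFun (congrFun h1 ⟨0, hS.n_pos⟩) ⟨0, hS.n_pos⟩
    simp at this
  rcases hS.Cz_or_Dz_ne_zero with h | h
  · have h1 := infNorm_pos (fun h0 => h (hinj _ h0))
    have h2 := infNorm_nonneg S.Dz
    have h3 := infNorm_nonneg (S.Tg 1)
    have : 0 ≤ infNorm S.Dz * infNorm (S.Tg 1) * S.d S.ρx := by positivity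
    linarith
  · have h1 := infNorm_pos h
    have h2 := infNorm_pos hTg
    have h3 := infNorm_nonneg (S.Cz * pinv S.Tz * S.Tg 1)
    have : 0 < infNorm S.Dz * infNorm (S.Tg 1) * S.d S.ρx := by positivity
    linarith

theorem bbar_pos (hS : S.Admissible) : 0 < S.bbar := by
  have hd := hS.d_pos _ hS.ρx_pos
  have hρ := hS.ρx_pos
  have hb := hS.b0_pos
  have hT := l1Norm_nonneg S.T
  have h1 := infNorm_nonneg (S.Cz * pinv S.Tz)
  have h2 := infNorm_nonneg S.Dz
  rw [Design.bbar]
  have e1 : 0 ≤ infNorm (S.Cz * pinv S.Tz) * S.ρx := by positivity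
  have e2 : 0 ≤ infNorm S.Dz * l1Norm S.T * S.d S.ρx ^ 2 * S.ρx := by positivity
  have e3 : 0 ≤ infNorm S.Dz * (l1Norm S.T * S.d S.ρx + 1) * S.b0 := by positivity
  rcases hS.Cz_or_Dz_ne_zero with h | h
  · have := infNorm_pos h
    have : 0 < infNorm (S.Cz * pinv S.Tz) * S.ρx := by positivity
    linarith
  · have := infNorm_pos h
    have : 0 < infNorm S.Dz * (l1Norm S.T * S.d S.ρx + 1) * S.b0 := by positivity
    linarith

theorem ωu_pos (hS : S.Admissible) : 0 < S.ωu := hS.ωl_pos.trans hS.ωl_lt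

theorem lam1_pos (hS : S.Admissible) : 0 < S.lam1 :=
  lt_min (div_pos (lamMin_sub_smul_one_pos hS.n_pos hS.Q_posDef.isHermitian hS.εq_lt)
    (lamMax_pos hS.n_pos hS.Pv_posDef)) hS.αy_pos

theorem θ1_pos (hS : S.Admissible) {lθ lσ : ℝ} (hθ : 0 ≤ lθ) (hσ : 0 ≤ lσ) : 0 < S.θ1 lθ lσ := by
  have := hS.ωu_pos
  have := hS.dbar_pos
  have := hS.bbar_pos
  have := hS.lam1_pos
  rw [Design.θ1, Design.θ0]
  positivity

end Design.Admissible

end L1Control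

end

noncomputable section

namespace L1Control

/-! ### Lyapunov analysis of the prediction error -/

theorem sub_mul_projScalar_sub_nonpos {c ϱ ε z zs y : ℝ} (hϱ : 0 < ϱ) (hε : 0 < ε)
    (hzs : (zs - c) ^ 2 ≤ ϱ ^ 2) : (z - zs) * (projScalar c ϱ ε z y - y) ≤ 0 := by
  have h := sub_dot_proj_sub_nonpos (k := 1) (c := fun _ => c) (z := fun _ => z)
    (zs := fun _ => zs) (y := fun _ => y) hϱ hε (by simpa [dotProduct, ← sq] using hzs)
  simpa [dotProduct, projScalar] using h

theorem projScalar_invariance {c ϱ ε Γ T : ℝ} (hϱ : 0 < ϱ) (hε : 0 < ε) (hΓ : 0 < Γ)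
    {z y : ℝ → ℝ} (h0 : (z 0 - c) ^ 2 ≤ ϱ ^ 2)
    (hz : ∀ t ∈ Icc 0 T, HasDerivWithinAt z (Γ * projScalar c ϱ ε (z t) (y t)) (Icc 0 T) t) :
    ∀ t ∈ Icc 0 T, (z t - c) ^ 2 ≤ (1 + ε) * ϱ ^ 2 := by
  intro t ht
  have h := proj_invariance (k := 1) (c := fun _ => c) (z := fun t _ => z t)
    (y := fun t _ => y t) hϱ hε hΓ (by simpa [dotProduct, ← sq] using h0)
    (fun t ht => hasDerivWithinAt_pi.2 fun i => by
      rw [Subsingleton.elim i 0]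
      exact hz t ht) t ht
  simpa [dotProduct, ← sq] using h

theorem sub_sq_le_of_layer {c z zs ϱ ε E : ℝ} (hϱ : 0 < ϱ) (hε : 0 < ε) (hE : ε ≤ E)
    (hz : (z - c) ^ 2 ≤ (1 + ε) * ϱ ^ 2) (hzs : (zs - c) ^ 2 ≤ ϱ ^ 2) :
    (z - zs) ^ 2 ≤ (4 + 2 * E) * ϱ ^ 2 := by
  have h := sub_dot_sub_le_of_layer (k := 1) (c := fun _ => c) (z := fun _ => z)
    (zs := fun _ => zs) hϱ hε hE (by simpa [dotProduct, ← sq] using hz)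
    (by simpa [dotProduct, ← sq] using hzs)
  simpa [dotProduct, ← sq] using h

variable {n m p nz mr : ℕ} {S : Design n m p nz mr}

/-- The part of the Lyapunov function that depends on the prediction errors. -/
def Design.predictionEnergy (S : Design n m p nz mr) (yt : Fin p → ℝ) (ξ : Fin n → ℝ) : ℝ :=
  yt ⬝ᵥ (S.Py *ᵥ yt) + ξ ⬝ᵥ (S.Pv *ᵥ ξ)

theorem Design.Admissible.dot_ey_le (hS : S.Admissible) (yt : Fin p → ℝ) :
    (S.Bbarᵀ *ᵥ (S.Cmᵀ *ᵥ (S.Py *ᵥ yt))) ⬝ᵥ (S.Bbarᵀ *ᵥ (S.Cmᵀ *ᵥ (S.Py *ᵥ yt))) ≤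
      twoNorm (S.sqrtPy * (S.Cm * S.Bbar)) ^ 2 * (yt ⬝ᵥ (S.Py *ᵥ yt)) := by
  have h := dot_transpose_mulVec_le (S.sqrtPy * (S.Cm * S.Bbar)) (S.sqrtPy *ᵥ yt)
  have e1 : (S.sqrtPy * (S.Cm * S.Bbar))ᵀ *ᵥ (S.sqrtPy *ᵥ yt) =
      S.Bbarᵀ *ᵥ (S.Cmᵀ *ᵥ (S.Py *ᵥ yt)) := by
    rw [hS.sqrtPy_sq]
    simp only [Matrix.transpose_mul, Matrix.mulVec_mulVec, Matrix.mul_assoc]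
  have e2 : (S.sqrtPy *ᵥ yt) ⬝ᵥ (S.sqrtPy *ᵥ yt) = yt ⬝ᵥ (S.Py *ᵥ yt) := by
    rw [hS.sqrtPy_sq, ← Matrix.mulVec_mulVec, Matrix.dotProduct_mulVec yt, Matrix.vecMul_transpose]
  rwa [e1, e2] at h

theorem Design.Admissible.energy_rate_le (hS : S.Admissible) {ω ωh pω N Δ : ℝ}
    {yt : Fin p → ℝ} {ξ : Fin n → ℝ} {e uz θ θh σ σh pθ pσ : Fin m → ℝ}
    (he : e = S.Bbarᵀ *ᵥ (S.Cmᵀ *ᵥ (S.Py *ᵥ yt)))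
    (hΔ : |Δ| ≤ ‖ξ‖) (hθ : ‖θ‖ ≤ S.dbar)
    (h1 : (ωh - ω) * (pω - -(uz ⬝ᵥ e)) ≤ 0) (h2 : (θh - θ) ⬝ᵥ (pθ - -(N • e)) ≤ 0)
    (h3 : (σh - σ) ⬝ᵥ (pσ - -e) ≤ 0) :
    2 * (yt ⬝ᵥ (S.Py *ᵥ (-(S.α • yt) + (S.Cm * S.Am) *ᵥ ξ + (S.Cm * S.Bbar) *ᵥ
        ((ωh - ω) • uz + N • (θh - θ) + (σh - σ) + Δ • θ)))) +
      2 * (ξ ⬝ᵥ (S.Pv *ᵥ (S.Av *ᵥ ξ - (S.Pv⁻¹ * S.Amᵀ * S.Cmᵀ * S.Py) *ᵥ yt))) +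
      2 * ((ωh - ω) * pω) + 2 * ((θh - θ) ⬝ᵥ pθ) + 2 * ((σh - σ) ⬝ᵥ pσ) ≤
    -S.lam1 * S.predictionEnergy yt ξ := by
  have hPyT : S.Pyᵀ = S.Py := by
    rw [← Matrix.conjTranspose_eq_transpose_of_trivial]; exact hS.Py_posDef.isHermitian
  have hPvT : S.Pvᵀ = S.Pv := by
    rw [← Matrix.conjTranspose_eq_transpose_of_trivial]; exact hS.Pv_posDef.isHermitian
  have hPv : S.Pv * S.Pv⁻¹ = 1 := Matrix.mul_nonsing_inv _
    ((Matrix.isUnit_iff_isUnit_det _).1 hS.Pv_posDef.isUnit)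
  have key : ∀ {q : ℕ} (A : Matrix (Fin p) (Fin q) ℝ) (w : Fin q → ℝ),
      yt ⬝ᵥ (S.Py *ᵥ (A *ᵥ w)) = (Aᵀ *ᵥ (S.Py *ᵥ yt)) ⬝ᵥ w := by
    intro q A w
    rw [Matrix.mulVec_transpose, ← Matrix.dotProduct_mulVec, Matrix.dotProduct_mulVec,
      ← Matrix.mulVec_transpose, hPyT]
  -- the two cross terms cancel
  have c1 : yt ⬝ᵥ (S.Py *ᵥ ((S.Cm * S.Am) *ᵥ ξ)) =
      ξ ⬝ᵥ (S.Pv *ᵥ ((S.Pv⁻¹ * S.Amᵀ * S.Cmᵀ * S.Py) *ᵥ yt)) := by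
    rw [key, Matrix.mulVec_mulVec yt S.Pv (S.Pv⁻¹ * S.Amᵀ * S.Cmᵀ * S.Py)]
    simp only [← Matrix.mul_assoc]
    rw [hPv, Matrix.one_mul, dotProduct_comm, Matrix.transpose_mul, Matrix.mulVec_mulVec]
  have c2 : ∀ w : Fin m → ℝ, yt ⬝ᵥ (S.Py *ᵥ ((S.Cm * S.Bbar) *ᵥ w)) = e ⬝ᵥ w := by
    intro w
    rw [key, he, Matrix.transpose_mul]
    simp only [Matrix.mulVec_mulVec, Matrix.mul_assoc]
  have c3 : 2 * (ξ ⬝ᵥ (S.Pv *ᵥ (S.Av *ᵥ ξ))) = -(ξ ⬝ᵥ (S.Q *ᵥ ξ)) := by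
    have h := congrArg (fun B => ξ ⬝ᵥ (B *ᵥ ξ)) hS.lyapunov
    beta_reduce at h
    rw [Matrix.neg_mulVec, dotProduct_neg, Matrix.add_mulVec, dotProduct_add] at h
    have e1 : ξ ⬝ᵥ ((S.Avᵀ * S.Pv) *ᵥ ξ) = ξ ⬝ᵥ ((S.Pv * S.Av) *ᵥ ξ) := by
      rw [Matrix.dotProduct_mulVec, ← Matrix.mulVec_transpose, Matrix.transpose_mul,
        Matrix.transpose_transpose, hPvT, dotProduct_comm]
    rw [Matrix.mulVec_mulVec]
    linarith
  have hT2 : Δ * (e ⬝ᵥ θ) * 2 ≤ S.εq * (ξ ⬝ᵥ ξ) + S.αφ * (yt ⬝ᵥ (S.Py *ᵥ yt)) := by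
    have hξ := norm_sq_le_dot ξ
    have hθ2 : θ ⬝ᵥ θ ≤ m * S.dbar ^ 2 := (dot_le_card_mul_norm_sq θ).trans
      (mul_le_mul_of_nonneg_left (pow_le_pow_left₀ (norm_nonneg _) hθ 2) (Nat.cast_nonneg m))
    have he2 : e ⬝ᵥ e ≤ twoNorm (S.sqrtPy * (S.Cm * S.Bbar)) ^ 2 * (yt ⬝ᵥ (S.Py *ᵥ yt)) := by
      rw [he]; exact hS.dot_ey_le yt
    have hcs : (e ⬝ᵥ θ) ^ 2 ≤ (e ⬝ᵥ e) * (θ ⬝ᵥ θ) := by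
      have h := Finset.sum_mul_sq_le_sq_mul_sq Finset.univ e θ
      have q1 : ∑ i, e i ^ 2 = e ⬝ᵥ e := Finset.sum_congr rfl fun i _ => sq _
      have q2 : ∑ i, θ i ^ 2 = θ ⬝ᵥ θ := Finset.sum_congr rfl fun i _ => sq _
      rwa [q1, q2] at h
    have hΔ2 : Δ ^ 2 ≤ ξ ⬝ᵥ ξ := by
      rw [← sq_abs]
      exact (pow_le_pow_left₀ (abs_nonneg _) hΔ 2).trans hξ
    have hεq := hS.εq_pos
    have hy : 2 * (Δ * (e ⬝ᵥ θ)) ≤ S.εq * Δ ^ 2 + (e ⬝ᵥ θ) ^ 2 / S.εq := by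
      have := sq_nonneg (S.εq * Δ - e ⬝ᵥ θ)
      rw [← sub_nonneg]
      have e3 : S.εq * Δ ^ 2 + (e ⬝ᵥ θ) ^ 2 / S.εq - 2 * (Δ * (e ⬝ᵥ θ)) =
          (S.εq * Δ - e ⬝ᵥ θ) ^ 2 / S.εq := by field_simp; ring
      rw [e3]
      positivity
    have h4 : (e ⬝ᵥ θ) ^ 2 / S.εq ≤ S.αφ * (yt ⬝ᵥ (S.Py *ᵥ yt)) := by
      rw [div_le_iff₀ hεq, Design.αφ]
      calc (e ⬝ᵥ θ) ^ 2 ≤ (e ⬝ᵥ e) * (θ ⬝ᵥ θ) := hcs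
        _ ≤ (twoNorm (S.sqrtPy * (S.Cm * S.Bbar)) ^ 2 * (yt ⬝ᵥ (S.Py *ᵥ yt))) *
            (m * S.dbar ^ 2) := mul_le_mul he2 hθ2 (dot_self_nonneg _)
              ((dot_self_nonneg _).trans he2)
        _ = _ := by field_simp
    have h5 : S.εq * Δ ^ 2 ≤ S.εq * (ξ ⬝ᵥ ξ) := mul_le_mul_of_nonneg_left hΔ2 hεq.le
    linarith
  have hY : 0 ≤ yt ⬝ᵥ (S.Py *ᵥ yt) := by
    simpa using hS.Py_posDef.posSemidef.dotProduct_mulVec_nonneg yt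
  have hX : 0 ≤ ξ ⬝ᵥ (S.Pv *ᵥ ξ) := by
    simpa using hS.Pv_posDef.posSemidef.dotProduct_mulVec_nonneg ξ
  have hlm := lamMax_pos hS.n_pos hS.Pv_posDef
  have hln := lamMin_sub_smul_one_pos hS.n_pos hS.Q_posDef.isHermitian hS.εq_lt
  have hQ : lamMin (S.Q - S.εq • 1) / lamMax S.Pv * (ξ ⬝ᵥ (S.Pv *ᵥ ξ)) ≤
      ξ ⬝ᵥ (S.Q *ᵥ ξ) - S.εq * (ξ ⬝ᵥ ξ) := by
    have q1 := lamMin_mul_dot_le (isHermitian_sub_smul_one hS.Q_posDef.isHermitian S.εq) ξ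
    rw [Matrix.sub_mulVec, dotProduct_sub, Matrix.smul_mulVec, Matrix.one_mulVec, dotProduct_smul,
      smul_eq_mul] at q1
    refine le_trans ?_ q1
    rw [div_mul_eq_mul_div, div_le_iff₀ hlm]
    have q2 := dot_le_lamMax_mul hS.Pv_posDef.isHermitian ξ
    calc lamMin (S.Q - S.εq • 1) * (ξ ⬝ᵥ (S.Pv *ᵥ ξ))
        ≤ lamMin (S.Q - S.εq • 1) * (lamMax S.Pv * (ξ ⬝ᵥ ξ)) :=
          mul_le_mul_of_nonneg_left q2 hln.le
      _ = _ := by ring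
  have hl1 : S.lam1 * (ξ ⬝ᵥ (S.Pv *ᵥ ξ)) ≤
      lamMin (S.Q - S.εq • 1) / lamMax S.Pv * (ξ ⬝ᵥ (S.Pv *ᵥ ξ)) :=
    mul_le_mul_of_nonneg_right (min_le_left _ _) hX
  have hl2 : S.lam1 * (yt ⬝ᵥ (S.Py *ᵥ yt)) ≤ S.αy * (yt ⬝ᵥ (S.Py *ᵥ yt)) :=
    mul_le_mul_of_nonneg_right (min_le_right _ _) hY
  have hαy : S.αy = 2 * S.α - S.αφ := rfl
  rw [hαy] at hl2
  simp only [Matrix.mulVec_add, Matrix.mulVec_sub, dotProduct_add, dotProduct_sub, c1, c2,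
    Matrix.mulVec_neg, dotProduct_neg, Matrix.mulVec_smul, dotProduct_smul, smul_eq_mul,
    Design.predictionEnergy, sub_neg_eq_add] at h1 h2 h3 ⊢
  rw [dotProduct_comm uz e] at h1
  have d1 : (θh - θ) ⬝ᵥ e = e ⬝ᵥ θh - e ⬝ᵥ θ := by rw [dotProduct_comm, dotProduct_sub]
  have d2 : (σh - σ) ⬝ᵥ e = e ⬝ᵥ σh - e ⬝ᵥ σ := by rw [dotProduct_comm, dotProduct_sub]
  rw [d1] at h2
  rw [d2] at h3
  linarith

end L1Control

end

noncomputable section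

namespace L1Control

variable {n m p nz mr : ℕ} {S : Design n m p nz mr}

theorem sub_dot_self_le_of_step {k : ℕ} {v θ₁ θ₂ : Fin k → ℝ} {r l δ : ℝ} (hr : 0 ≤ r)
    (hl : 0 ≤ l) (hδ : 0 ≤ δ) (hv : (v - θ₁) ⬝ᵥ (v - θ₁) ≤ r ^ 2) (hθ : ‖θ₁ - θ₂‖ ≤ l * δ) :
    (v - θ₂) ⬝ᵥ (v - θ₂) ≤
      (v - θ₁) ⬝ᵥ (v - θ₁) + (2 * (r * (√k * l)) * δ + (√k * l * δ) ^ 2) := by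
  have h1 : (θ₁ - θ₂) ⬝ᵥ (θ₁ - θ₂) ≤ (√k * l * δ) ^ 2 := by
    refine (dot_le_card_mul_norm_sq _).trans ?_
    rw [mul_assoc, mul_pow, Real.sq_sqrt (Nat.cast_nonneg k)]
    exact mul_le_mul_of_nonneg_left (pow_le_pow_left₀ (norm_nonneg _) hθ 2) (Nat.cast_nonneg k)
  have h2 := dot_le_mul_of_sq_le hr (by positivity) hv h1
  have e : v - θ₂ = (v - θ₁) + (θ₁ - θ₂) := by abel
  rw [e, add_dotProduct, dotProduct_add, dotProduct_add, dotProduct_comm (θ₁ - θ₂) (v - θ₁)]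
  nlinarith

theorem continuousOn_of_lipschitz {k : ℕ} {θ : ℝ → Fin k → ℝ} {l τ : ℝ} (hl : 0 ≤ l)
    (h : ∀ s ∈ Icc 0 τ, ∀ t ∈ Icc 0 τ, ‖θ s - θ t‖ ≤ l * |s - t|) : ContinuousOn θ (Icc 0 τ) := by
  have : LipschitzOnWith ⟨l, hl⟩ θ (Icc 0 τ) := by
    refine LipschitzOnWith.of_dist_le_mul fun s hs t ht => ?_
    rw [dist_eq_norm, Real.dist_eq]
    exact h s hs t ht
  exact this.continuousOn

theorem Design.Admissible.layer_bookkeeping (hS : S.Admissible) {lθ lσ : ℝ} (hlθ : 0 ≤ lθ)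
    (hlσ : 0 ≤ lσ) {E : ℝ} (hE : E = 3 * S.ωu ^ 2 / S.θ1 lθ lσ) :
    (4 + 2 * E) * (((S.ωu - S.ωl) / 2) ^ 2 + m * S.dbar ^ 2 + m * S.bbar ^ 2) +
      (m * (4 + E) * (S.dbar * lθ + S.bbar * lσ)) / S.lam1 ≤ S.θ1 lθ lσ := by
  have hθ1 := hS.θ1_pos hlθ hlσ
  have hd := hS.dbar_pos
  have hb := hS.bbar_pos
  have hl := hS.lam1_pos
  have hu := hS.ωu_pos
  have hwl := hS.ωl_pos
  have hlt := hS.ωl_lt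
  have hEθ : E * S.θ1 lθ lσ = 3 * S.ωu ^ 2 := by rw [hE]; field_simp
  have hE0 : 0 ≤ E := by rw [hE]; positivity
  set R : ℝ := m * ((S.dbar * lθ + S.bbar * lσ) / S.lam1) with hR
  have hR0 : 0 ≤ R := by positivity
  set D2 : ℝ := m * S.dbar ^ 2 + m * S.bbar ^ 2 with hD2
  have hD0 : 0 ≤ D2 := by positivity
  have e1 : S.θ1 lθ lσ = 4 * S.ωu ^ 2 + 4 * D2 + 4 * R := by
    rw [Design.θ1, Design.θ0, hR, hD2]; ring
  have e2 : (m * (4 + E) * (S.dbar * lθ + S.bbar * lσ)) / S.lam1 = (4 + E) * R := by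
    rw [hR]; ring
  have hq : ((S.ωu - S.ωl) / 2) ^ 2 ≤ S.ωu ^ 2 / 4 := by nlinarith
  rw [e2, add_assoc _ (m * S.dbar ^ 2), ← hD2]
  rw [e1] at hEθ ⊢
  have h3 : (4 + 2 * E) * ((S.ωu - S.ωl) / 2) ^ 2 ≤ (4 + 2 * E) * (S.ωu ^ 2 / 4) :=
    mul_le_mul_of_nonneg_left hq (by linarith)
  have h4 : 0 ≤ E * S.ωu ^ 2 := by positivity
  have h5 : 0 ≤ E * R := by positivity
  nlinarith

set_option maxHeartbeats 1600000 in
/-- Decay of the prediction errors, up to a term of order `1 / Γ`. -/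
theorem Design.Admissible.predictionEnergy_le (hS : S.Admissible) {ω : ℝ} (hω : ω ∈ S.Cω)
    {lθ lσ : ℝ} (hlθ : 0 ≤ lθ) (hlσ : 0 ≤ lσ) {K : Gains} (hK : K.Admissible S lθ lσ) {τ : ℝ}
    {yt : ℝ → Fin p → ℝ} {ξ : ℝ → Fin n → ℝ} {ωh N Δ : ℝ → ℝ}
    {e uz θ θh σ σh : ℝ → Fin m → ℝ}
    (he : ∀ t ∈ Icc 0 τ, e t = S.Bbarᵀ *ᵥ (S.Cmᵀ *ᵥ (S.Py *ᵥ yt t)))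
    (hyt : ∀ t ∈ Icc 0 τ, HasDerivWithinAt yt (-(S.α • yt t) + (S.Cm * S.Am) *ᵥ ξ t +
      (S.Cm * S.Bbar) *ᵥ ((ωh t - ω) • uz t + N t • (θh t - θ t) + (σh t - σ t) + Δ t • θ t))
      (Icc 0 τ) t)
    (hξ : ∀ t ∈ Icc 0 τ, HasDerivWithinAt ξ
      (S.Av *ᵥ ξ t - (S.Pv⁻¹ * S.Amᵀ * S.Cmᵀ * S.Py) *ᵥ yt t) (Icc 0 τ) t)
    (hΔ : ∀ t ∈ Icc 0 τ, |Δ t| ≤ ‖ξ t‖)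
    (hθ : ∀ t ∈ Icc 0 τ, ‖θ t‖ ≤ S.dbar) (hσ : ∀ t ∈ Icc 0 τ, ‖σ t‖ ≤ S.bbar)
    (hLθ : ∀ s ∈ Icc 0 τ, ∀ t ∈ Icc 0 τ, ‖θ s - θ t‖ ≤ lθ * |s - t|)
    (hLσ : ∀ s ∈ Icc 0 τ, ∀ t ∈ Icc 0 τ, ‖σ s - σ t‖ ≤ lσ * |s - t|)
    (hω0 : ωh 0 = 1) (hθ0 : θh 0 = 0) (hσ0 : σh 0 = 0)
    (hωh : ∀ t ∈ Icc 0 τ, HasDerivWithinAt ωh (K.Γω * projScalar ((S.ωl + S.ωu) / 2)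
      ((S.ωu - S.ωl) / 2) K.εω (ωh t) (-(uz t ⬝ᵥ e t))) (Icc 0 τ) t)
    (hθh : ∀ t ∈ Icc 0 τ, HasDerivWithinAt θh
      (K.Γθ • proj 0 (√m * S.dbar) K.εθ (θh t) (-(N t • e t))) (Icc 0 τ) t)
    (hσh : ∀ t ∈ Icc 0 τ, HasDerivWithinAt σh
      (K.Γσ • proj 0 (√m * S.bbar) K.εσ (σh t) (-(e t))) (Icc 0 τ) t) :
    ∀ t ∈ Icc 0 τ, S.predictionEnergy (yt t) (ξ t) ≤
      Real.exp (-S.lam1 * t) * S.predictionEnergy (yt 0) (ξ 0) + S.θ1 lθ lσ / K.Γ := by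
  have hd := hS.dbar_pos
  have hb := hS.bbar_pos
  have hl := hS.lam1_pos
  have hu := hS.ωu_pos
  have hlt := hS.ωl_lt
  have hm : (0 : ℝ) < m := by exact_mod_cast hS.m_pos
  have hsm : 0 < √(m : ℝ) := Real.sqrt_pos.2 hm
  have hθ1 := hS.θ1_pos hlθ hlσ
  have hΓω := hK.Γω_pos
  have hΓθ := hK.Γθ_pos
  have hΓσ := hK.Γσ_pos
  have hΓ : 0 < K.Γ := lt_min hΓω (lt_min hΓθ hΓσ)
  have hΓω' : K.Γω⁻¹ ≤ K.Γ⁻¹ := inv_anti₀ hΓ (min_le_left _ _)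
  have hΓθ' : K.Γθ⁻¹ ≤ K.Γ⁻¹ := inv_anti₀ hΓ ((min_le_right _ _).trans (min_le_left _ _))
  have hΓσ' : K.Γσ⁻¹ ≤ K.Γ⁻¹ := inv_anti₀ hΓ ((min_le_right _ _).trans (min_le_right _ _))
  obtain ⟨hεω, hEω⟩ := hK.εω_mem
  obtain ⟨hεθ, hEθ⟩ := hK.εθ_mem
  obtain ⟨hεσ, hEσ⟩ := hK.εσ_mem
  obtain ⟨E, hE⟩ : ∃ E, E = 3 * S.ωu ^ 2 / S.θ1 lθ lσ := ⟨_, rfl⟩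
  rw [← hE] at hEω hEθ hEσ
  have hE0 : 0 ≤ E := hεω.le.trans hEω
  have hbk := hS.layer_bookkeeping hlθ hlσ hE
  set ϱ := (S.ωu - S.ωl) / 2 with hϱ
  have hϱ0 : 0 < ϱ := by rw [hϱ]; linarith
  have hball : ∀ w ∈ S.Cω, (w - (S.ωl + S.ωu) / 2) ^ 2 ≤ ϱ ^ 2 := by
    intro w hw
    rw [hϱ]
    have := hw.1
    have := hw.2
    nlinarith
  have hϱθ : 0 < √m * S.dbar := by positivity
  have hϱσ : 0 < √m * S.bbar := by positivity
  have hsqθ : (√m * S.dbar) ^ 2 = m * S.dbar ^ 2 := by rw [mul_pow, Real.sq_sqrt hm.le]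
  have hsqσ : (√m * S.bbar) ^ 2 = m * S.bbar ^ 2 := by rw [mul_pow, Real.sq_sqrt hm.le]
  have hθb : ∀ t ∈ Icc 0 τ, (θ t - 0) ⬝ᵥ (θ t - 0) ≤ (√m * S.dbar) ^ 2 := fun t ht => by
    rw [sub_zero, hsqθ]
    exact (dot_le_card_mul_norm_sq _).trans (mul_le_mul_of_nonneg_left
      (pow_le_pow_left₀ (norm_nonneg _) (hθ t ht) 2) hm.le)
  have hσb : ∀ t ∈ Icc 0 τ, (σ t - 0) ⬝ᵥ (σ t - 0) ≤ (√m * S.bbar) ^ 2 := fun t ht => by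
    rw [sub_zero, hsqσ]
    exact (dot_le_card_mul_norm_sq _).trans (mul_le_mul_of_nonneg_left
      (pow_le_pow_left₀ (norm_nonneg _) (hσ t ht) 2) hm.le)
  have iω := projScalar_invariance hϱ0 hεω hΓω (y := fun t => -(uz t ⬝ᵥ e t))
    (by rw [hω0]; exact hball 1 hS.one_mem) hωh
  have iθ := proj_invariance hϱθ hεθ hΓθ (y := fun t => -(N t • e t))
    (by rw [hθ0]; simpa using sq_nonneg _) hθh
  have iσ := proj_invariance hϱσ hεσ hΓσ (y := fun t => -(e t))
    (by rw [hσ0]; simpa using sq_nonneg _) hσh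
  have bω : ∀ t ∈ Icc 0 τ, (ωh t - ω) ^ 2 ≤ (4 + 2 * E) * ϱ ^ 2 := fun t ht =>
    sub_sq_le_of_layer hϱ0 hεω hEω (iω t ht) (hball ω hω)
  have bθ : ∀ s ∈ Icc 0 τ, ∀ t ∈ Icc 0 τ, (θh t - θ s) ⬝ᵥ (θh t - θ s) ≤
      (4 + 2 * E) * (m * S.dbar ^ 2) := fun s hs t ht => by
    rw [← hsqθ]
    exact sub_dot_sub_le_of_layer hϱθ hεθ hEθ (iθ t ht) (hθb s hs)
  have bσ : ∀ s ∈ Icc 0 τ, ∀ t ∈ Icc 0 τ, (σh t - σ s) ⬝ᵥ (σh t - σ s) ≤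
      (4 + 2 * E) * (m * S.bbar ^ 2) := fun s hs t ht => by
    rw [← hsqσ]
    exact sub_dot_sub_le_of_layer hϱσ hεσ hEσ (iσ t ht) (hσb s hs)
  set rθ := (2 + E / 2) * (√m * S.dbar) with hrθ
  set rσ := (2 + E / 2) * (√m * S.bbar) with hrσ
  have hrθ2 : (4 + 2 * E) * (m * S.dbar ^ 2) ≤ rθ ^ 2 := by
    rw [hrθ, mul_pow, hsqθ]
    exact mul_le_mul_of_nonneg_right (by nlinarith) (by positivity)
  have hrσ2 : (4 + 2 * E) * (m * S.bbar ^ 2) ≤ rσ ^ 2 := by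
    rw [hrσ, mul_pow, hsqσ]
    exact mul_le_mul_of_nonneg_right (by nlinarith) (by positivity)
  set par : ℝ → ℝ := fun t => K.Γω⁻¹ * (ωh t - ω) ^ 2 +
    K.Γθ⁻¹ * ((θh t - θ t) ⬝ᵥ (θh t - θ t)) + K.Γσ⁻¹ * ((σh t - σ t) ⬝ᵥ (σh t - σ t)) with hpar
  set A : ℝ := (4 + 2 * E) * (ϱ ^ 2 + m * S.dbar ^ 2 + m * S.bbar ^ 2) with hA
  have hparA : ∀ t ∈ Icc 0 τ, par t ≤ K.Γ⁻¹ * A := by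
    intro t ht
    have hΓi : 0 ≤ K.Γ⁻¹ := (inv_pos.2 hΓ).le
    have e1 : K.Γω⁻¹ * (ωh t - ω) ^ 2 ≤ K.Γ⁻¹ * ((4 + 2 * E) * ϱ ^ 2) :=
      mul_le_mul hΓω' (bω t ht) (sq_nonneg _) hΓi
    have e2 := mul_le_mul hΓθ' (bθ t ht t ht) (dot_self_nonneg _) hΓi
    have e3 := mul_le_mul hΓσ' (bσ t ht t ht) (dot_self_nonneg _) hΓi
    rw [hpar, hA]
    beta_reduce
    calc _ ≤ _ := add_le_add (add_le_add e1 e2) e3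
      _ = _ := by ring
  have hpar0 : ∀ t, 0 ≤ par t := fun t => by
    have := dot_self_nonneg (θh t - θ t)
    have := dot_self_nonneg (σh t - σ t)
    rw [hpar]
    positivity
  set V : ℝ → ℝ := fun t => S.predictionEnergy (yt t) (ξ t) + par t with hV
  set c : ℝ := K.Γ⁻¹ * (S.lam1 * A + (2 * (rθ * (√m * lθ)) + 2 * (rσ * (√m * lσ)))) with hc
  have hcθ : c / S.lam1 ≤ S.θ1 lθ lσ / K.Γ := by
    have e1 : c / S.lam1 = K.Γ⁻¹ * (A + (m * (4 + E) * (S.dbar * lθ + S.bbar * lσ)) / S.lam1) := by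
      rw [hc, hrθ, hrσ]
      have : √(m : ℝ) * √(m : ℝ) = m := Real.mul_self_sqrt hm.le
      field_simp
      linear_combination ((4 + E) * (S.dbar * lθ + S.bbar * lσ)) * this
    rw [e1, div_eq_inv_mul (S.θ1 lθ lσ)]
    exact mul_le_mul_of_nonneg_left hbk (inv_pos.2 hΓ).le
  have hVc : ContinuousOn V (Icc 0 τ) := by
    have cθ := continuousOn_of_lipschitz hlθ hLθ
    have cσ := continuousOn_of_lipschitz hlσ hLσ
    have cy : ContinuousOn yt (Icc 0 τ) := fun t ht => (hyt t ht).continuousWithinAt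
    have cx : ContinuousOn ξ (Icc 0 τ) := fun t ht => (hξ t ht).continuousWithinAt
    have cωh : ContinuousOn ωh (Icc 0 τ) := fun t ht => (hωh t ht).continuousWithinAt
    have cθh : ContinuousOn θh (Icc 0 τ) := fun t ht => (hθh t ht).continuousWithinAt
    have cσh : ContinuousOn σh (Icc 0 τ) := fun t ht => (hσh t ht).continuousWithinAt
    have dotc : ∀ {q : ℕ} {f g : ℝ → Fin q → ℝ}, ContinuousOn f (Icc 0 τ) →
        ContinuousOn g (Icc 0 τ) → ContinuousOn (fun t => f t ⬝ᵥ g t) (Icc 0 τ) := by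
      intro q f g hf hg
      exact continuousOn_finsetSum _ fun i _ => ((continuous_apply i).comp_continuousOn hf).mul
        ((continuous_apply i).comp_continuousOn hg)
    have mulc : ∀ {q : ℕ} (B : Matrix (Fin q) (Fin q) ℝ) {f : ℝ → Fin q → ℝ},
        ContinuousOn f (Icc 0 τ) → ContinuousOn (fun t => B *ᵥ f t) (Icc 0 τ) := by
      intro q B f hf
      exact (LinearMap.toContinuousLinearMap B.mulVecLin).continuous.comp_continuousOn hf
    rw [hV, hpar]
    unfold Design.predictionEnergy
    exact ((dotc cy (mulc _ cy)).add (dotc cx (mulc _ cx))).add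
      (((continuousOn_const.mul ((cωh.sub continuousOn_const).pow 2)).add
        (continuousOn_const.mul (dotc (cθh.sub cθ) (cθh.sub cθ)))).add
        (continuousOn_const.mul (dotc (cσh.sub cσ) (cσh.sub cσ))))
  have main := le_exp_decay_of_upper_derivative (V := V) (c := c) (T := τ) hl hVc ?_
  · intro t ht
    have h1 := main t ht
    have h0 : (0 : ℝ) ∈ Icc 0 τ := ⟨le_rfl, ht.1.trans ht.2⟩
    have hV0 : V 0 ≤ S.predictionEnergy (yt 0) (ξ 0) + S.θ1 lθ lσ / K.Γ := by
      rw [hV]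
      beta_reduce
      gcongr
      refine (hparA 0 h0).trans ?_
      rw [div_eq_inv_mul]
      refine mul_le_mul_of_nonneg_left ?_ (inv_pos.2 hΓ).le
      refine le_trans ?_ hbk
      have : 0 ≤ (m * (4 + E) * (S.dbar * lθ + S.bbar * lσ)) / S.lam1 := by positivity
      linarith
    have hexp : Real.exp (-S.lam1 * t) ≤ 1 := Real.exp_le_one_iff.2 (by nlinarith [ht.1])
    have hexp0 := Real.exp_pos (-S.lam1 * t)
    have hVt : S.predictionEnergy (yt t) (ξ t) ≤ V t := le_add_of_nonneg_right (hpar0 t)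
    have e1 := mul_le_mul_of_nonneg_left hV0 hexp0.le
    have e2 := mul_le_mul_of_nonneg_left hcθ (sub_nonneg.2 hexp)
    linarith
  · intro s hs
    have hs' : s ∈ Icc 0 τ := ⟨hs.1, hs.2.le⟩
    have dy := hasDerivWithinAt_Ioi_of_Icc hs (hyt s hs')
    have dx := hasDerivWithinAt_Ioi_of_Icc hs (hξ s hs')
    have dω := hasDerivWithinAt_Ioi_of_Icc hs (hωh s hs')
    have dθ := hasDerivWithinAt_Ioi_of_Icc hs (hθh s hs')
    have dσ := hasDerivWithinAt_Ioi_of_Icc hs (hσh s hs')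
    have d1 := HasDerivWithinAt.quadratic hS.Py_posDef.isHermitian dy
    have d2 := HasDerivWithinAt.quadratic hS.Pv_posDef.isHermitian dx
    have d3 := ((dω.sub_const ω).pow 2).const_mul K.Γω⁻¹
    have d4 := HasDerivWithinAt.dot_self (dθ.sub_const (θ s))
    have d5 := HasDerivWithinAt.dot_self (dσ.sub_const (σ s))
    have dstep : ∀ r l : ℝ, HasDerivWithinAt
        (fun z : ℝ => 2 * (r * (√m * l)) * (z - s) + (√m * l * (z - s)) ^ 2)
        (2 * (r * (√m * l))) (Ioi s) s := by
      intro r l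
      have q1 : HasDerivAt (fun z : ℝ => z - s) 1 s := (hasDerivAt_id s).sub_const s
      have q2 := (q1.const_mul (2 * (r * (√m * l)))).add ((q1.const_mul (√m * l)).pow 2)
      exact (q2.congr_deriv (by simp)).hasDerivWithinAt
    have d6 := (d4.add (dstep rθ lθ)).const_mul K.Γθ⁻¹
    have d7 := (d5.add (dstep rσ lσ)).const_mul K.Γσ⁻¹
    refine ⟨_, _, ((d1.add d2).add ((d3.add d6).add d7)), ?_, ?_, ?_⟩
    · simp [hV, hpar, Design.predictionEnergy]
    · filter_upwards [Ioo_mem_nhdsGT hs.2] with z hz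
      have hz' : z ∈ Icc 0 τ := ⟨hs.1.trans hz.1.le, hz.2.le⟩
      have hzs : 0 ≤ z - s := sub_nonneg.2 hz.1.le
      have f1 := sub_dot_self_le_of_step (v := θh z) (θ₁ := θ s) (θ₂ := θ z)
        (r := rθ) (l := lθ) (δ := z - s) (by positivity) hlθ hzs ((bθ s hs' z hz').trans hrθ2)
        (by have := hLθ s hs' z hz'; rwa [abs_sub_comm, abs_of_nonneg hzs] at this)
      have f2 := sub_dot_self_le_of_step (v := σh z) (θ₁ := σ s) (θ₂ := σ z)
        (r := rσ) (l := lσ) (δ := z - s) (by positivity) hlσ hzs ((bσ s hs' z hz').trans hrσ2)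
        (by have := hLσ s hs' z hz'; rwa [abs_sub_comm, abs_of_nonneg hzs] at this)
      have g1 := mul_le_mul_of_nonneg_left f1 (inv_pos.2 hΓθ).le
      have g2 := mul_le_mul_of_nonneg_left f2 (inv_pos.2 hΓσ).le
      simp only [hV, hpar, Design.predictionEnergy, Pi.add_apply, Pi.pow_apply]
      linarith
    · have hrate := hS.energy_rate_le (ω := ω) (ωh := ωh s) (N := N s) (uz := uz s) (θh := θh s)
        (σ := σ s) (σh := σh s) (he s hs') (hΔ s hs') (hθ s hs')
        (sub_mul_projScalar_sub_nonpos hϱ0 hεω (hball ω hω))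
        (sub_dot_proj_sub_nonpos hϱθ hεθ (hθb s hs'))
        (sub_dot_proj_sub_nonpos hϱσ hεσ (hσb s hs'))
      have hpA := hparA s hs'
      have g1 : K.Γθ⁻¹ * (2 * (rθ * (√m * lθ))) ≤ K.Γ⁻¹ * (2 * (rθ * (√m * lθ))) :=
        mul_le_mul_of_nonneg_right hΓθ' (by positivity)
      have g2 : K.Γσ⁻¹ * (2 * (rσ * (√m * lσ))) ≤ K.Γ⁻¹ * (2 * (rσ * (√m * lσ))) :=
        mul_le_mul_of_nonneg_right hΓσ' (by positivity)
      have g3 := mul_le_mul_of_nonneg_left hpA hl.le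
      have i1 : K.Γω⁻¹ * K.Γω = 1 := inv_mul_cancel₀ hΓω.ne'
      have i2 : K.Γθ⁻¹ * K.Γθ = 1 := inv_mul_cancel₀ hΓθ.ne'
      have i3 : K.Γσ⁻¹ * K.Γσ = 1 := inv_mul_cancel₀ hΓσ.ne'
      have hVs : V s = S.predictionEnergy (yt s) (ξ s) + par s := rfl
      rw [hVs, hc]
      set pω := projScalar ((S.ωl + S.ωu) / 2) ϱ K.εω (ωh s) (-(uz s ⬝ᵥ e s))
      set pθ := proj 0 (√m * S.dbar) K.εθ (θh s) (-(N s • e s))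
      set pσ := proj 0 (√m * S.bbar) K.εσ (σh s) (-(e s))
      simp only [dotProduct_smul, smul_eq_mul]
      have j1 : K.Γω⁻¹ * (↑2 * (ωh s - ω) ^ (2 - 1) * (K.Γω * pω)) = 2 * ((ωh s - ω) * pω) := by
        rw [show 2 - 1 = 1 from rfl, pow_one]
        linear_combination (2 * ((ωh s - ω) * pω)) * i1
      have j2 : K.Γθ⁻¹ * (2 * (K.Γθ * ((θh s - θ s) ⬝ᵥ pθ)) + 2 * (rθ * (√m * lθ))) =
          2 * ((θh s - θ s) ⬝ᵥ pθ) + K.Γθ⁻¹ * (2 * (rθ * (√m * lθ))) := by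
        linear_combination (2 * ((θh s - θ s) ⬝ᵥ pθ)) * i2
      have j3 : K.Γσ⁻¹ * (2 * (K.Γσ * ((σh s - σ s) ⬝ᵥ pσ)) + 2 * (rσ * (√m * lσ))) =
          2 * ((σh s - σ s) ⬝ᵥ pσ) + K.Γσ⁻¹ * (2 * (rσ * (√m * lσ))) := by
        linear_combination (2 * ((σh s - σ s) ⬝ᵥ pσ)) * i3
      rw [j2, j3]
      linarith

end L1Control

end

noncomputable section

namespace L1Control

variable {n m p nz mr : ℕ} {S : Design n m p nz mr} {f : (Fin n → ℝ) → ℝ → Fin m → ℝ}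

/-! ### Regularity of the uncertainty -/

theorem Design.Uncertainty.norm_sub_le (hf : S.Uncertainty f) {δ : ℝ} (hδ : 0 < δ)
    {x z : Fin n → ℝ} (hx : ‖x‖ ≤ δ) (hz : ‖z‖ ≤ δ) {t : ℝ} (ht : 0 ≤ t) :
    ‖f x t - f z t‖ ≤ S.d δ * ‖x - z‖ := by
  have hc : Continuous fun w => f w t :=
    continuous_iff_continuousAt.2 fun w => (hf.diff_x w t ht).continuousAt
  have key : ∀ r ∈ Ico (0 : ℝ) 1, ‖f (r • x) t - f (r • z) t‖ ≤ S.d δ * ‖r • x - r • z‖ := by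
    intro r hr
    have hin : ∀ w : Fin n → ℝ, ‖w‖ ≤ δ → r • w ∈ Metric.ball (0 : Fin n → ℝ) δ := by
      intro w hw
      rw [mem_ball_zero_iff, norm_smul, Real.norm_of_nonneg hr.1]
      nlinarith [norm_nonneg w, hr.1, hr.2]
    exact (convex_ball (0 : Fin n → ℝ) δ).norm_image_sub_le_of_norm_fderiv_le (𝕜 := ℝ)
      (fun w _ => hf.diff_x w t ht)
      (fun w hw => hf.bound_x δ hδ w t (by simpa using hw) ht) (hin z hz) (hin x hx)
  have lim : ∀ w : Fin n → ℝ, Tendsto (fun r : ℝ => r • w) (𝓝[<] 1) (𝓝 w) := by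
    intro w
    have : Continuous fun r : ℝ => r • w := by fun_prop
    simpa using (this.tendsto 1).mono_left nhdsWithin_le_nhds
  refine le_of_tendsto_of_tendsto
    (((hc.tendsto x).comp (lim x)).sub ((hc.tendsto z).comp (lim z))).norm
    (((lim x).sub (lim z)).norm.const_mul (S.d δ)) ?_
  filter_upwards [Ico_mem_nhdsLT (zero_lt_one (α := ℝ))] with r hr using key r hr

theorem Design.Uncertainty.norm_sub_le_time (hf : S.Uncertainty f) {δ : ℝ} (hδ : 0 < δ)
    {x : Fin n → ℝ} (hx : ‖x‖ < δ) {s t : ℝ} (hs : 0 ≤ s) (ht : 0 ≤ t) :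
    ‖f x s - f x t‖ ≤ S.b δ * |s - t| :=
  (convex_Ici (0 : ℝ)).norm_image_sub_le_of_norm_derivWithin_le (𝕜 := ℝ)
    (fun w hw => hf.diff_t x w hw) (fun w hw => hf.bound_t δ hδ x w hx hw) ht hs

theorem Design.Uncertainty.norm_le (hf : S.Uncertainty f) {δ : ℝ} (hδ : 0 < δ)
    {x : Fin n → ℝ} (hx : ‖x‖ ≤ δ) {t : ℝ} (ht : 0 ≤ t) : ‖f x t‖ ≤ S.d δ * ‖x‖ + S.b0 := by
  have h1 := hf.norm_sub_le hδ hx (z := 0) (by simpa using hδ.le) ht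
  have h2 := hf.zero t ht
  rw [sub_zero] at h1
  have h3 := norm_sub_norm_le (f x t) (f 0 t)
  linarith

theorem Design.Uncertainty.continuousOn (hf : S.Uncertainty f) {I : Set ℝ} (hI : I ⊆ Ici 0)
    {x : ℝ → Fin n → ℝ} (hx : ContinuousOn x I) : ContinuousOn (fun t => f (x t) t) I := by
  intro s hs
  have hδ : 0 < ‖x s‖ + 1 := by positivity
  have hlt : ‖x s‖ < ‖x s‖ + 1 := lt_add_one _
  have h1 : Tendsto (fun t => S.d (‖x s‖ + 1) * ‖x t - x s‖ + S.b (‖x s‖ + 1) * |t - s|)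
      (𝓝[I] s) (𝓝 0) := by
    have a := (((hx s hs).sub_const (x s)).norm.const_mul (S.d (‖x s‖ + 1)))
    have b : Tendsto (fun t => S.b (‖x s‖ + 1) * |t - s|) (𝓝[I] s) (𝓝 0) := by
      have : Continuous fun t : ℝ => S.b (‖x s‖ + 1) * |t - s| := by fun_prop
      simpa using (this.tendsto s).mono_left nhdsWithin_le_nhds
    simpa using a.add b
  refine tendsto_iff_norm_sub_tendsto_zero.2 (squeeze_zero' (Eventually.of_forall fun t =>
    norm_nonneg _) ?_ h1)
  have ev : ∀ᶠ t in 𝓝[I] s, ‖x t‖ < ‖x s‖ + 1 := (hx s hs).norm.eventually_lt_const hlt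
  filter_upwards [ev, self_mem_nhdsWithin] with t ht htI
  have e : f (x t) t - f (x s) s = (f (x t) t - f (x s) t) + (f (x s) t - f (x s) s) := by abel
  rw [e]
  exact (norm_add_le _ _).trans (add_le_add (hf.norm_sub_le hδ ht.le hlt.le (hI htI))
    (hf.norm_sub_le_time hδ hlt (hI htI) (hI hs)))

/-! ### Parametrization of the lumped uncertainty -/

theorem norm_sub_le_of_hasDerivWithinAt {k : ℕ} {z w : ℝ → Fin k → ℝ} {τ B : ℝ}
    (hz : ∀ t ∈ Icc 0 τ, HasDerivWithinAt z (w t) (Icc 0 τ) t) (hw : ∀ t ∈ Icc 0 τ, ‖w t‖ ≤ B)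
    {s t : ℝ} (hs : s ∈ Icc 0 τ) (ht : t ∈ Icc 0 τ) : ‖z s - z t‖ ≤ B * |s - t| :=
  (convex_Icc 0 τ).norm_image_sub_le_of_norm_hasDerivWithin_le (𝕜 := ℝ) hz hw ht hs

/-- States driven from rest through a Hurwitz matrix stay bounded. -/
theorem norm_le_of_hurwitz {k q : ℕ} {A : Matrix (Fin k) (Fin k) ℝ} (hA : Hurwitz A)
    (B : Matrix (Fin k) (Fin q) ℝ) {z : ℝ → Fin k → ℝ} {w : ℝ → Fin q → ℝ} {τ W : ℝ} (hz0 : z 0 = 0)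
    (hz : ∀ t ∈ Icc 0 τ, HasDerivWithinAt z (A *ᵥ z t + B *ᵥ w t) (Icc 0 τ) t)
    (hwc : ContinuousOn w (Icc 0 τ)) (hw : ∀ t ∈ Icc 0 τ, ‖w t‖ ≤ W) {t : ℝ} (ht : t ∈ Icc 0 τ) :
    z t = response (resolvent A) (fun s => B *ᵥ w s) t ∧
      ‖z t‖ ≤ l1Norm (resolvent A) * (infNorm B * W) := by
  have hsub : Icc 0 t ⊆ Icc 0 τ := Icc_subset_Icc_right ht.2
  have h1 : z t = response (resolvent A) (fun s => B *ᵥ w s) t :=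
    eq_response_resolvent_of_zero ht.1 hz0 (fun s hs => (hz s (hsub hs)).mono hsub)
      ((IntOn.of_continuousOn ht.1 (hwc.mono hsub)).mulVec B)
  refine ⟨h1, h1 ▸ norm_response_le_const (strict_resolvent A).proper (stable_resolvent hA) ht.1
    fun s hs => (norm_mulVec_le _ _).trans ?_⟩
  exact mul_le_mul_of_nonneg_left (hw s (hsub hs)) (infNorm_nonneg _)

theorem norm_sum_elim_sub_le {a b : ℕ} (v v' : Fin a → ℝ) (w w' : Fin b → ℝ) :
    |‖(Sum.elim v w : Fin a ⊕ Fin b → ℝ)‖ - ‖(Sum.elim v' w' : Fin a ⊕ Fin b → ℝ)‖| ≤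
      ‖v - v'‖ + ‖w - w'‖ := by
  refine (abs_norm_sub_norm_le _ _).trans ((pi_norm_le_iff_of_nonneg (by positivity)).2 ?_)
  rintro (i | i)
  · exact (norm_le_pi_norm (v - v') i).trans (le_add_of_nonneg_right (norm_nonneg _))
  · exact (norm_le_pi_norm (w - w') i).trans (le_add_of_nonneg_left (norm_nonneg _))

/-- A signal bounded by an affine function of `N` splits proportionally into bounded factors. -/
theorem exists_affine_split {k : ℕ} {τ d b lN lg : ℝ} {g : ℝ → Fin k → ℝ} {N : ℝ → ℝ} (hd : 0 < d)
    (hb : 0 < b) (hN : ∀ t ∈ Icc 0 τ, 0 ≤ N t)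
    (hg : ∀ t ∈ Icc 0 τ, ‖g t‖ ≤ d * N t + b)
    (hLg : ∀ s ∈ Icc 0 τ, ∀ t ∈ Icc 0 τ, ‖g s - g t‖ ≤ lg * |s - t|)
    (hLN : ∀ s ∈ Icc 0 τ, ∀ t ∈ Icc 0 τ, |N s - N t| ≤ lN * |s - t|) :
    ∃ θ σ : ℝ → Fin k → ℝ,
      (∀ t ∈ Icc 0 τ, g t = N t • θ t + σ t ∧ ‖θ t‖ ≤ d ∧ ‖σ t‖ ≤ b) ∧
      ∀ s ∈ Icc 0 τ, ∀ t ∈ Icc 0 τ, ‖θ s - θ t‖ ≤ d * ((lg + d * lN) / b) * |s - t| ∧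
        ‖σ s - σ t‖ ≤ b * ((lg + d * lN) / b) * |s - t| := by
  set φ : ℝ → Fin k → ℝ := fun t => (d * N t + b)⁻¹ • g t with hφ
  have hpos : ∀ t ∈ Icc 0 τ, b ≤ d * N t + b := fun t ht => by
    have := mul_nonneg hd.le (hN t ht); linarith
  have hφ1 : ∀ t ∈ Icc 0 τ, ‖φ t‖ ≤ 1 := fun t ht => by
    have h1 := hb.trans_le (hpos t ht)
    rw [hφ]
    beta_reduce
    rw [norm_smul, norm_inv, Real.norm_of_nonneg h1.le, inv_mul_le_iff₀ h1, mul_one]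
    exact hg t ht
  have hφg : ∀ t ∈ Icc 0 τ, g t = (d * N t + b) • φ t := fun t ht => by
    rw [hφ]
    beta_reduce
    rw [smul_smul, mul_inv_cancel₀ (hb.trans_le (hpos t ht)).ne', one_smul]
  have hφL : ∀ s ∈ Icc 0 τ, ∀ t ∈ Icc 0 τ, ‖φ s - φ t‖ ≤ (lg + d * lN) / b * |s - t| := by
    intro s hs t ht
    have h1 := hb.trans_le (hpos s hs)
    have e : (d * N s + b) • (φ s - φ t) = (g s - g t) - (d * (N s - N t)) • φ t := by
      rw [smul_sub, ← hφg s hs]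
      conv_rhs => rw [hφg t ht]
      rw [sub_sub, ← add_smul]
      congr 2
      ring
    have h2 : (d * N s + b) * ‖φ s - φ t‖ ≤ (lg + d * lN) * |s - t| := by
      rw [← Real.norm_of_nonneg h1.le, ← norm_smul, e]
      refine (norm_sub_le _ _).trans ?_
      rw [norm_smul, norm_mul, Real.norm_of_nonneg hd.le, Real.norm_eq_abs, add_mul]
      refine add_le_add (hLg s hs t ht) ?_
      have h3 := hLN s hs t ht
      calc d * |N s - N t| * ‖φ t‖ ≤ d * |N s - N t| * 1 :=
            mul_le_mul_of_nonneg_left (hφ1 t ht) (by positivity)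
        _ ≤ d * lN * |s - t| := by nlinarith
    have h4 : b * ‖φ s - φ t‖ ≤ (lg + d * lN) * |s - t| :=
      (mul_le_mul_of_nonneg_right (hpos s hs) (norm_nonneg _)).trans h2
    rw [div_mul_eq_mul_div, le_div_iff₀ hb]
    linarith
  refine ⟨fun t => d • φ t, fun t => b • φ t, fun t ht => ⟨?_, ?_, ?_⟩, fun s hs t ht => ⟨?_, ?_⟩⟩
  · beta_reduce
    rw [smul_smul, ← add_smul, mul_comm (N t)]
    exact hφg t ht
  · rw [norm_smul, Real.norm_of_nonneg hd.le]
    nlinarith [hφ1 t ht]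
  · rw [norm_smul, Real.norm_of_nonneg hb.le]
    nlinarith [hφ1 t ht]
  · rw [← smul_sub, norm_smul, Real.norm_of_nonneg hd.le, mul_assoc]
    exact mul_le_mul_of_nonneg_left (hφL s hs t ht) hd.le
  · rw [← smul_sub, norm_smul, Real.norm_of_nonneg hb.le, mul_assoc]
    exact mul_le_mul_of_nonneg_left (hφL s hs t ht) hb.le

theorem Design.stable_T (hS : S.Admissible) : Strict S.T ∧ Stable S.T :=
  ⟨(Proper.mul_strict (proper_const _) (strict_resolvent _)).mul_proper (proper_const _),
    ((stable_const _).mul (stable_resolvent hS.hurwitz_Az)).mul (stable_const _)⟩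

/-- The lumped uncertainty grows at most affinely with the extended state. -/
theorem Design.Admissible.norm_lumped_le (hS : S.Admissible) {ω : ℝ} (hω : ω ∈ S.Cω)
    {x xv : Fin n → ℝ} {xu xf : Fin nz → ℝ} {w : Fin m → ℝ}
    (hx : x = S.Tg ω *ᵥ Sum.elim xv xu + S.Tz *ᵥ xf) (hxρ : ‖x‖ ≤ S.ρx)
    (hw : ‖w‖ ≤ S.d S.ρx * ‖x‖ + S.b0)
    (hxf : ‖S.Tz *ᵥ xf‖ ≤ l1Norm S.T * (S.d S.ρx * S.ρx + S.b0)) :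
    ‖S.Cz *ᵥ xf + S.Dz *ᵥ w‖ ≤
      S.dbar * ‖(Sum.elim xv xu : Fin n ⊕ Fin nz → ℝ)‖ + S.bbar := by
  set g : Fin n ⊕ Fin nz → ℝ := Sum.elim xv xu
  have hd := hS.d_pos _ hS.ρx_pos
  have e : S.Cz *ᵥ xf = (S.Cz * pinv S.Tz) *ᵥ x - (S.Cz * pinv S.Tz * S.Tg ω) *ᵥ g := by
    rw [hx, Matrix.mulVec_add, Matrix.mulVec_mulVec, Matrix.mulVec_mulVec, Matrix.mul_assoc S.Cz _ S.Tz,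
      pinv_mul_self hS.Tz_rank, Matrix.mul_one]
    abel
  have h1 : ‖S.Cz *ᵥ xf‖ ≤ infNorm (S.Cz * pinv S.Tz) * S.ρx +
      infNorm (S.Cz * pinv S.Tz * S.Tg ω) * ‖g‖ := by
    rw [e]
    exact (norm_sub_le _ _).trans (add_le_add ((norm_mulVec_le _ _).trans
      (mul_le_mul_of_nonneg_left hxρ (infNorm_nonneg _))) (norm_mulVec_le _ _))
  have h2 : ‖x‖ ≤ infNorm (S.Tg ω) * ‖g‖ + l1Norm S.T * (S.d S.ρx * S.ρx + S.b0) := by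
    rw [hx]
    exact (norm_add_le _ _).trans (add_le_add (norm_mulVec_le _ _) hxf)
  have h3 : ‖S.Dz *ᵥ w‖ ≤ infNorm S.Dz * (S.d S.ρx *
      (infNorm (S.Tg ω) * ‖g‖ + l1Norm S.T * (S.d S.ρx * S.ρx + S.b0)) + S.b0) :=
    (norm_mulVec_le _ _).trans (mul_le_mul_of_nonneg_left
      (hw.trans (add_le_add_left (mul_le_mul_of_nonneg_left h2 hd.le) _)) (infNorm_nonneg _))
  have h4 := mul_le_mul_of_nonneg_right (le_dbar S hω) (norm_nonneg g)
  refine (norm_add_le _ _).trans ((add_le_add h1 h3).trans ?_)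
  rw [Design.bbar]
  linarith

theorem norm_Tz_mulVec_le (hS : S.Admissible) {xf : ℝ → Fin nz → ℝ} {w : ℝ → Fin m → ℝ} {τ W : ℝ}
    (h0 : xf 0 = 0)
    (hxf : ∀ t ∈ Icc 0 τ, HasDerivWithinAt xf (S.Az *ᵥ xf t + S.Bz *ᵥ w t) (Icc 0 τ) t)
    (hwc : ContinuousOn w (Icc 0 τ)) (hw : ∀ t ∈ Icc 0 τ, ‖w t‖ ≤ W) {t : ℝ} (ht : t ∈ Icc 0 τ) :
    ‖S.Tz *ᵥ xf t‖ ≤ l1Norm S.T * W := by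
  have hI : IntOn w t := IntOn.of_continuousOn ht.1 (hwc.mono (Icc_subset_Icc_right ht.2))
  have hR := strict_resolvent S.Az
  have e : S.Tz *ᵥ xf t = response S.T w t := by
    rw [(norm_le_of_hurwitz hS.hurwitz_Az S.Bz h0 hxf hwc hw ht).1, Design.T,
      response_mul_const ((proper_const S.Tz).mul hR.proper) S.Bz ht.1 hI,
      response_mul (proper_const _) hR.proper ht.1 (hI.mulVec S.Bz), response_const]
  rw [e]
  exact norm_response_le_const (Design.stable_T hS).1.proper (Design.stable_T hS).2 ht.1
    fun s hs => hw s ⟨hs.1, hs.2.trans ht.2⟩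

/-- Rate bounds exist, uniformly in the uncertainty. -/
theorem Design.Admissible.exists_rateBounds (hS : S.Admissible) {ω : ℝ} (hω : ω ∈ S.Cω) :
    ∃ lθ lσ : ℝ, 0 ≤ lθ ∧ 0 ≤ lσ ∧ ∀ f, S.Uncertainty f → S.RateBounds ω f lθ lσ := by
  have hρ := hS.ρx_pos
  have hd := hS.d_pos _ hρ
  have hb := hS.b_pos (S.ρx + 1) (by linarith)
  have hb0 := hS.b0_pos
  have hω0 : 0 < ω := hS.ωl_pos.trans_le hω.1
  obtain ⟨R, hRe⟩ : ∃ R, R = l1Norm (resolvent S.Az) := ⟨_, rfl⟩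
  have hR : 0 ≤ R := hRe ▸ l1Norm_nonneg _
  obtain ⟨F, hF⟩ : ∃ c : ℝ, c = S.d S.ρx * S.ρx + S.b0 := ⟨_, rfl⟩
  obtain ⟨U, hU⟩ : ∃ U, U = |S.ρu ω| := ⟨_, rfl⟩
  obtain ⟨Xu, hXu⟩ : ∃ c : ℝ, c = R * (infNorm S.Bz * U) := ⟨_, rfl⟩
  obtain ⟨Xf, hXf⟩ : ∃ c : ℝ, c = R * (infNorm S.Bz * F) := ⟨_, rfl⟩
  obtain ⟨Xv, hXv⟩ : ∃ c : ℝ, c = S.ρx + ω * (infNorm S.Tz * Xu) + infNorm S.Tz * Xf := ⟨_, rfl⟩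
  obtain ⟨lu, hlu⟩ : ∃ c : ℝ, c = infNorm S.Az * Xu + infNorm S.Bz * U := ⟨_, rfl⟩
  obtain ⟨lf, hlf⟩ : ∃ c : ℝ, c = infNorm S.Az * Xf + infNorm S.Bz * F := ⟨_, rfl⟩
  obtain ⟨Fb, hFb⟩ : ∃ c : ℝ, c = infNorm S.Cz * Xf + infNorm S.Dz * F := ⟨_, rfl⟩
  obtain ⟨lv, hlv⟩ : ∃ c : ℝ, c = infNorm S.Am * Xv +
    infNorm S.Bbar * (ω * (infNorm S.Cz * Xu + infNorm S.Dz * U) + Fb) := ⟨_, rfl⟩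
  obtain ⟨lx, hlx⟩ : ∃ c : ℝ, c = lv + ω * (infNorm S.Tz * lu) + infNorm S.Tz * lf := ⟨_, rfl⟩
  obtain ⟨lw, hlw⟩ : ∃ c : ℝ, c = S.d S.ρx * lx + S.b (S.ρx + 1) := ⟨_, rfl⟩
  obtain ⟨lg, hlg⟩ : ∃ c : ℝ, c = infNorm S.Cz * lf + infNorm S.Dz * lw := ⟨_, rfl⟩
  have n1 := infNorm_nonneg S.Az
  have n2 := infNorm_nonneg S.Bz
  have n3 := infNorm_nonneg S.Cz
  have n4 := infNorm_nonneg S.Dz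
  have n5 := infNorm_nonneg S.Am
  have n6 := infNorm_nonneg S.Bbar
  have n7 := infNorm_nonneg S.Tz
  have hF0 : 0 ≤ F := by rw [hF]; positivity
  have hU0 : 0 ≤ U := hU ▸ abs_nonneg _
  have hXu0 : 0 ≤ Xu := by rw [hXu]; positivity
  have hXf0 : 0 ≤ Xf := by rw [hXf]; positivity
  have hXv0 : 0 ≤ Xv := by rw [hXv]; positivity
  have hlu0 : 0 ≤ lu := by rw [hlu]; positivity
  have hlf0 : 0 ≤ lf := by rw [hlf]; positivity
  have hFb0 : 0 ≤ Fb := by rw [hFb]; positivity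
  have hlv0 : 0 ≤ lv := by rw [hlv]; positivity
  have hlx0 : 0 ≤ lx := by rw [hlx]; positivity
  have hlw0 : 0 ≤ lw := by rw [hlw]; positivity
  have hlg0 : 0 ≤ lg := by rw [hlg]; positivity
  have hdb := hS.dbar_pos
  have hbb := hS.bbar_pos
  refine ⟨S.dbar * ((lg + S.dbar * (lv + lu)) / S.bbar),
    S.bbar * ((lg + S.dbar * (lv + lu)) / S.bbar), by positivity, by positivity, ?_⟩
  intro f hf τ hτ u xv x xu xf fbar huc hxu0 hxf0 h
  have hxe := fun t ht => (h t ht).1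
  have hfb := fun t ht => (h t ht).2.1
  have hxu := fun t ht => (h t ht).2.2.1
  have hxf := fun t ht => (h t ht).2.2.2.1
  have hxv := fun t ht => (h t ht).2.2.2.2.1
  have hxρ := fun t ht => (h t ht).2.2.2.2.2.1
  have huρ : ∀ t ∈ Icc 0 τ, ‖u t‖ ≤ U := fun t ht =>
    ((h t ht).2.2.2.2.2.2).trans (hU ▸ le_abs_self _)
  have hxe' : ∀ t ∈ Icc 0 τ, x t = xv t + ω • (S.Tz *ᵥ xu t) + S.Tz *ᵥ xf t := fun t ht => by
    rw [hxe t ht, Tg_mulVec]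
  have cT : ∀ z : ℝ → Fin nz → ℝ, ContinuousOn z (Icc 0 τ) →
      ContinuousOn (fun t => S.Tz *ᵥ z t) (Icc 0 τ) := fun z hz =>
    (LinearMap.toContinuousLinearMap S.Tz.mulVecLin).continuous.comp_continuousOn hz
  have cx : ContinuousOn x (Icc 0 τ) := by
    refine ContinuousOn.congr ?_ hxe'
    exact (ContinuousOn.add (fun t ht => (hxv t ht).continuousWithinAt)
      ((cT _ fun t ht => (hxu t ht).continuousWithinAt).const_smul ω)).add
      (cT _ fun t ht => (hxf t ht).continuousWithinAt)
  have cw := hf.continuousOn (fun t ht => ht.1) cx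
  have bw' : ∀ t ∈ Icc 0 τ, ‖f (x t) t‖ ≤ S.d S.ρx * ‖x t‖ + S.b0 := fun t ht =>
    hf.norm_le hρ (hxρ t ht) ht.1
  have bw : ∀ t ∈ Icc 0 τ, ‖f (x t) t‖ ≤ F := fun t ht => by
    rw [hF]
    exact (bw' t ht).trans (add_le_add_left (mul_le_mul_of_nonneg_left (hxρ t ht) hd.le) _)
  have bu : ∀ t ∈ Icc 0 τ, ‖xu t‖ ≤ Xu := fun t ht => by
    rw [hXu, hRe]
    exact (norm_le_of_hurwitz hS.hurwitz_Az S.Bz hxu0 hxu huc huρ ht).2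
  have bf : ∀ t ∈ Icc 0 τ, ‖xf t‖ ≤ Xf := fun t ht => by
    rw [hXf, hRe]
    exact (norm_le_of_hurwitz hS.hurwitz_Az S.Bz hxf0 hxf cw bw ht).2
  have bTf : ∀ t ∈ Icc 0 τ, ‖S.Tz *ᵥ xf t‖ ≤ l1Norm S.T * F := by
    intro t ht
    exact norm_Tz_mulVec_le hS hxf0 hxf cw bw ht
  have mv : ∀ {a b : ℕ} (A : Matrix (Fin a) (Fin b) ℝ) {v : Fin b → ℝ} {B : ℝ}, ‖v‖ ≤ B →
      ‖A *ᵥ v‖ ≤ infNorm A * B := fun A v B hv =>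
    (norm_mulVec_le A v).trans (mul_le_mul_of_nonneg_left hv (infNorm_nonneg A))
  have sm : ∀ {a : ℕ} {v : Fin a → ℝ} {B : ℝ}, ‖v‖ ≤ B → ‖ω • v‖ ≤ ω * B := fun {a v B} hv => by
    rw [norm_smul, Real.norm_of_nonneg hω0.le]
    exact mul_le_mul_of_nonneg_left hv hω0.le
  have bv : ∀ t ∈ Icc 0 τ, ‖xv t‖ ≤ Xv := by
    intro t ht
    have e : xv t = x t - ω • (S.Tz *ᵥ xu t) - S.Tz *ᵥ xf t := by rw [hxe' t ht]; abel
    rw [e, hXv]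
    exact norm_sub_le_of_le (norm_sub_le_of_le (hxρ t ht) (sm (mv _ (bu t ht)))) (mv _ (bf t ht))
  have bfb : ∀ t ∈ Icc 0 τ, ‖fbar t‖ ≤ Fb := fun t ht => by
    rw [hfb t ht, hFb]
    exact norm_add_le_of_le (mv _ (bf t ht)) (mv _ (bw t ht))
  have Lu : ∀ s ∈ Icc 0 τ, ∀ t ∈ Icc 0 τ, ‖xu s - xu t‖ ≤ lu * |s - t| := fun s hs t ht => by
    rw [hlu]
    exact norm_sub_le_of_hasDerivWithinAt hxu
      (fun t ht => norm_add_le_of_le (mv _ (bu t ht)) (mv _ (huρ t ht))) hs ht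
  have Lf : ∀ s ∈ Icc 0 τ, ∀ t ∈ Icc 0 τ, ‖xf s - xf t‖ ≤ lf * |s - t| := fun s hs t ht => by
    rw [hlf]
    exact norm_sub_le_of_hasDerivWithinAt hxf
      (fun t ht => norm_add_le_of_le (mv _ (bf t ht)) (mv _ (bw t ht))) hs ht
  have Lv : ∀ s ∈ Icc 0 τ, ∀ t ∈ Icc 0 τ, ‖xv s - xv t‖ ≤ lv * |s - t| := fun s hs t ht => by
    rw [hlv]
    exact norm_sub_le_of_hasDerivWithinAt hxv
      (fun t ht => norm_add_le_of_le (mv _ (bv t ht)) (mv _ (norm_add_le_of_le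
      (sm (norm_add_le_of_le (mv _ (bu t ht)) (mv _ (huρ t ht)))) (bfb t ht)))) hs ht
  have Lx : ∀ s ∈ Icc 0 τ, ∀ t ∈ Icc 0 τ, ‖x s - x t‖ ≤ lx * |s - t| := by
    intro s hs t ht
    have e : x s - x t = (xv s - xv t) + ω • (S.Tz *ᵥ (xu s - xu t)) +
        S.Tz *ᵥ (xf s - xf t) := by
      rw [hxe' s hs, hxe' t ht, Matrix.mulVec_sub, Matrix.mulVec_sub, smul_sub]
      abel
    rw [e]
    refine (norm_add_le_of_le (norm_add_le_of_le (Lv s hs t ht) (sm (mv _ (Lu s hs t ht))))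
      (mv _ (Lf s hs t ht))).trans (le_of_eq ?_)
    rw [hlx]
    ring
  have Lw : ∀ s ∈ Icc 0 τ, ∀ t ∈ Icc 0 τ, ‖f (x s) s - f (x t) t‖ ≤ lw * |s - t| := by
    intro s hs t ht
    have e : f (x s) s - f (x t) t = (f (x s) s - f (x t) s) + (f (x t) s - f (x t) t) := by abel
    rw [e, hlw, add_mul]
    refine norm_add_le_of_le ((hf.norm_sub_le hρ (hxρ s hs) (hxρ t ht) hs.1).trans ?_)
      (hf.norm_sub_le_time (by linarith) ((hxρ t ht).trans_lt (lt_add_one _)) hs.1 ht.1)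
    rw [mul_assoc]
    exact mul_le_mul_of_nonneg_left (Lx s hs t ht) hd.le
  have Lg : ∀ s ∈ Icc 0 τ, ∀ t ∈ Icc 0 τ, ‖fbar s - fbar t‖ ≤ lg * |s - t| := by
    intro s hs t ht
    have e : fbar s - fbar t = S.Cz *ᵥ (xf s - xf t) + S.Dz *ᵥ (f (x s) s - f (x t) t) := by
      rw [hfb s hs, hfb t ht, Matrix.mulVec_sub, Matrix.mulVec_sub]
      abel
    rw [e]
    refine (norm_add_le_of_le (mv _ (Lf s hs t ht)) (mv _ (Lw s hs t ht))).trans (le_of_eq ?_)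
    rw [hlg]
    ring
  refine exists_affine_split hdb hbb (fun t _ => norm_nonneg _) (fun t ht => ?_) Lg
    fun s hs t ht => (norm_sum_elim_sub_le _ _ _ _).trans ?_
  · rw [hfb t ht]
    exact hS.norm_lumped_le hω (hxe t ht) (hxρ t ht) (bw' t ht) (hF ▸ bTf t ht)
  · rw [add_mul]
    exact add_le_add (Lv s hs t ht) (Lu s hs t ht)

end L1Control

end

noncomputable section

namespace L1Control

variable {n m p nz mr : ℕ} {S : Design n m p nz mr}

/-! ### Properness and stability of the transfer matrices of the design -/

theorem exists_pow_smul_proper {a b : ℕ} (G : TM a b) :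
    ∃ k : ℕ, Proper (((RatFunc.X : RatFunc ℝ)⁻¹ ^ k) • G) := by
  refine ⟨∑ i, ∑ j, (G i j).intDegree.toNat, fun i j => ?_⟩
  have hle : (G i j).intDegree ≤ ((∑ i, ∑ j, (G i j).intDegree.toNat : ℕ) : ℤ) := by
    refine (Int.self_le_toNat _).trans (Int.ofNat_le.2 ?_)
    exact (Finset.single_le_sum (f := fun j => (G i j).intDegree.toNat)
      (fun _ _ => Nat.zero_le _) (Finset.mem_univ j)).trans
      (Finset.single_le_sum (f := fun i => ∑ j, (G i j).intDegree.toNat)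
        (fun _ _ => Nat.zero_le _) (Finset.mem_univ i))
  generalize (∑ i, ∑ j, (G i j).intDegree.toNat : ℕ) = N at hle
  have hX : ∀ N : ℕ, (((RatFunc.X : RatFunc ℝ)⁻¹) ^ N).intDegree = -(N : ℤ) := by
    intro N
    induction N with
    | zero => simp
    | succ N ih =>
      rw [pow_succ, RatFunc.intDegree_mul (pow_ne_zero _ (inv_ne_zero RatFunc.X_ne_zero))
        (inv_ne_zero RatFunc.X_ne_zero), ih, RatFunc.intDegree_inv, RatFunc.intDegree_X]
      push_cast
      ring
  change (((RatFunc.X : RatFunc ℝ)⁻¹) ^ N * G i j).intDegree ≤ 0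
  by_cases h : G i j = 0
  · simp [h]
  rw [RatFunc.intDegree_mul (pow_ne_zero _ (inv_ne_zero RatFunc.X_ne_zero)) h, hX]
  linarith

/-- A well-posed feedback loop: the inverse of `1 - C` is proper when `C` is strictly proper. -/
theorem Strict.proper_of_one_sub_mul_eq_one {a : ℕ} {C W : TM a a} (hC : Strict C)
    (h : (1 - C) * W = 1) : Proper W := by
  have hW : W = 1 + C * W := by
    rw [← h, Matrix.sub_mul, Matrix.one_mul]
    abel
  obtain ⟨k, hk⟩ := exists_pow_smul_proper W
  induction k with
  | zero => simpa using hk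
  | succ k ih =>
    refine ih ?_
    have e : ((RatFunc.X : RatFunc ℝ)⁻¹ ^ k) • W = ((RatFunc.X : RatFunc ℝ)⁻¹ ^ k) • (1 : TM a a) +
        ((RatFunc.X : RatFunc ℝ) • C) * (((RatFunc.X : RatFunc ℝ)⁻¹ ^ (k + 1)) • W) := by
      rw [Matrix.smul_mul, Matrix.mul_smul, smul_smul]
      have : (RatFunc.X : RatFunc ℝ) * RatFunc.X⁻¹ ^ (k + 1) = RatFunc.X⁻¹ ^ k := by
        rw [pow_succ', ← mul_assoc, mul_inv_cancel₀ RatFunc.X_ne_zero, one_mul]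
      rw [this, ← smul_add, ← hW]
    rw [e]
    exact (proper_one.smul (properRing.pow_mem X_inv_mem_properRing k)).add (hC.X_smul.mul hk)

namespace Design.Admissible

theorem proper_Z (S : Design n m p nz mr) : Proper S.Z :=
  (((proper_const _).mul (strict_resolvent _).proper).mul (proper_const _)).add (proper_const _)

theorem Z_inv_mul (hS : S.Admissible) : S.Z⁻¹ * S.Z = 1 := mul_eq_one_comm.1 hS.Z_mul_inv

variable {ω : ℝ}

theorem ω_pos (hS : S.Admissible) (hω : ω ∈ S.Cω) : 0 < ω := hS.ωl_pos.trans_le hω.1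

theorem isUnit_loop (hS : S.Admissible) (hω : ω ∈ S.Cω) :
    IsUnit (1 + RatFunc.C ω • S.D).det := by
  by_contra hu
  have h0 : S.C ω = 0 := by
    rw [Design.C, Design.C0, Matrix.nonsing_inv_apply_not_isUnit _ hu, Matrix.mul_zero, smul_zero]
  have h1 := hS.dc_gain ω hω
  rw [h0] at h1
  have h2 := congrFun (congrFun h1 ⟨0, hS.m_pos⟩) ⟨0, hS.m_pos⟩
  simp [evalAt] at h2

theorem strict_C0_mul_Z_inv (hS : S.Admissible) (hω : ω ∈ S.Cω) : Strict (S.C0 ω * S.Z⁻¹) := by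
  have h := (strictlyProper_iff.1 (hS.strictly_proper ω hω)).smul (C_mem_properRing ω⁻¹)
  rwa [Design.C, Matrix.smul_mul, smul_smul, ← map_mul, inv_mul_cancel₀ (hS.ω_pos hω).ne', map_one,
    one_smul] at h

theorem C0_eq (hS : S.Admissible) (ω : ℝ) : S.C0 ω * S.Z⁻¹ * S.Z = S.C0 ω := by
  rw [Matrix.mul_assoc, hS.Z_inv_mul, Matrix.mul_one]

theorem strict_C0 (hS : S.Admissible) (hω : ω ∈ S.Cω) : Strict (S.C0 ω) := by
  rw [← hS.C0_eq]
  exact (hS.strict_C0_mul_Z_inv hω).mul_proper (proper_Z S)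

theorem stable_C0 (hS : S.Admissible) (hω : ω ∈ S.Cω) : Stable (S.C0 ω) := by
  have h := (hS.stable ω hω).smul (C_mem_stableRing ω⁻¹)
  rwa [Design.C, smul_smul, ← map_mul, inv_mul_cancel₀ (hS.ω_pos hω).ne', map_one,
    one_smul] at h

theorem strict_C (hS : S.Admissible) (hω : ω ∈ S.Cω) : Strict (S.C ω) :=
  (hS.strict_C0 hω).smul (C_mem_properRing ω)

/-- The fixed-point form of the feedback loop around the filter `D`. -/
theorem D_eq (hS : S.Admissible) (hω : ω ∈ S.Cω) :
    S.D = S.C0 ω + RatFunc.C ω • (S.C0 ω * S.D) := by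
  have h : S.C0 ω * (1 + RatFunc.C ω • S.D) = S.D := by
    rw [Design.C0, Matrix.mul_assoc, Matrix.nonsing_inv_mul _ (hS.isUnit_loop hω), Matrix.mul_one]
  conv_lhs => rw [← h]
  rw [Matrix.mul_add, Matrix.mul_one, Matrix.mul_smul]

theorem strict_D_mul_Z_inv (hS : S.Admissible) (hω : ω ∈ S.Cω) : Strict (S.D * S.Z⁻¹) := by
  have h : (1 - S.C ω) * (1 + RatFunc.C ω • S.D) = 1 := by
    have := hS.D_eq hω
    rw [Matrix.sub_mul, Matrix.one_mul, Design.C, Matrix.mul_add, Matrix.mul_one, Matrix.smul_mul,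
      Matrix.mul_smul]
    nth_rewrite 1 [this]
    rw [smul_add]
    abel
  have hW := (hS.strict_C hω).proper_of_one_sub_mul_eq_one h
  have h' := mul_eq_one_comm.1 h
  have e : S.D * S.Z⁻¹ = (1 + RatFunc.C ω • S.D) * (S.C0 ω * S.Z⁻¹) := by
    rw [← Matrix.mul_assoc]
    congr 1
    have e1 : (1 - S.C ω) * S.D = S.C0 ω := by
      rw [Matrix.sub_mul, Matrix.one_mul, Design.C, Matrix.smul_mul]
      nth_rewrite 1 [hS.D_eq hω]
      abel
    rw [← e1, ← Matrix.mul_assoc, h', Matrix.one_mul]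
  rw [e]
  exact hW.mul_strict (hS.strict_C0_mul_Z_inv hω)

theorem stable_C0_mul_Z_inv (hS : S.Admissible) (hω : ω ∈ S.Cω) : Stable (S.C0 ω * S.Z⁻¹) :=
  (hS.stable_C0 hω).mul hS.stable_Z_inv

theorem proper_C1 (hS : S.Admissible) (hω : ω ∈ S.Cω) : Proper (S.C1 ω) := by
  have h := (hS.strict_C0_mul_Z_inv hω).mul_proper (proper_const S.CBdag)
  rw [Design.C1, add_smul]
  exact h.X_smul.add (h.proper.smul (C_mem_properRing _))

theorem stable_C1 (hS : S.Admissible) (hω : ω ∈ S.Cω) : Stable (S.C1 ω) :=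
  ((hS.stable_C0_mul_Z_inv hω).mul (stable_const S.CBdag)).smul
    (stableRing.add_mem X_mem_stableRing (C_mem_stableRing _))

theorem strict_C2 (hS : S.Admissible) (hω : ω ∈ S.Cω) : Strict (S.C2 ω) :=
  (hS.strict_C0_mul_Z_inv hω).mul_proper (proper_const _)

theorem stable_C2 (hS : S.Admissible) (hω : ω ∈ S.Cω) : Stable (S.C2 ω) :=
  (hS.stable_C0_mul_Z_inv hω).mul (stable_const _)

theorem strict_H0 (S : Design n m p nz mr) : Strict S.H0 :=
  (strict_resolvent _).mul_proper (proper_const _)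

theorem stable_H0 (hS : S.Admissible) : Stable S.H0 :=
  (stable_resolvent hS.hurwitz_Am).mul (stable_const _)

theorem strict_G (hS : S.Admissible) (hω : ω ∈ S.Cω) : Strict (S.G ω) :=
  (strict_H0 S).mul_proper (proper_one.sub (hS.strict_C hω).proper)

theorem stable_G (hS : S.Admissible) (hω : ω ∈ S.Cω) : Stable (S.G ω) :=
  hS.stable_H0.mul (stable_one.sub (hS.stable ω hω))

theorem strict_Hr (hS : S.Admissible) (hω : ω ∈ S.Cω) : Strict (S.Hr ω) :=
  ((strict_H0 S).mul_proper (hS.strict_C hω).proper).mul_proper (proper_const _)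

theorem stable_Hr (hS : S.Admissible) (hω : ω ∈ S.Cω) : Stable (S.Hr ω) :=
  (hS.stable_H0.mul (hS.stable ω hω)).mul (stable_const _)

theorem strict_H1 (hS : S.Admissible) (hω : ω ∈ S.Cω) : Strict (S.H1 ω) :=
  ((strict_H0 S).mul_proper (hS.proper_C1 hω)).smul (C_mem_properRing _)

theorem stable_H1 (hS : S.Admissible) (hω : ω ∈ S.Cω) : Stable (S.H1 ω) :=
  (hS.stable_H0.mul (hS.stable_C1 hω)).smul (C_mem_stableRing _)

theorem strict_H2 (hS : S.Admissible) (hω : ω ∈ S.Cω) : Strict (S.H2 ω) :=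
  ((strict_H0 S).mul_proper (hS.strict_C2 hω).proper).smul (C_mem_properRing _)

theorem stable_H2 (hS : S.Admissible) (hω : ω ∈ S.Cω) : Stable (S.H2 ω) :=
  (hS.stable_H0.mul (hS.stable_C2 hω)).smul (C_mem_stableRing _)

end Design.Admissible

end L1Control

end

noncomputable section

namespace L1Control

variable {n m p nz mr : ℕ} {S : Design n m p nz mr}

/-! ### Linear systems driven by continuous inputs -/

theorem exists_linear_solution {k : ℕ} (A : Matrix (Fin k) (Fin k) ℝ) {w : ℝ → Fin k → ℝ}
    (hw : Continuous w) :
    ∃ z : ℝ → Fin k → ℝ, z 0 = 0 ∧ ∀ t, HasDerivAt z (A *ᵥ z t + w t) t := by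
  set E : ℝ → Matrix (Fin k) (Fin k) ℝ := fun t => NormedSpace.exp (t • A) with hE
  have hEd : ∀ i j t, HasDerivAt (fun s => E s i j) ((A * E t) i j) t := by
    intro i j t
    have h := hasDerivAt_pi.1 (hasDerivAt_exp_mulVec A (Pi.single j 1) t) i
    simp only [Matrix.mulVec_single_one] at h
    exact h
  have hEc : Continuous E := continuous_matrix fun i j =>
    continuous_iff_continuousAt.2 fun t => (hEd i j t).continuousAt
  have hEE : ∀ t, E t * E (-t) = 1 := by
    intro t
    simp only [hE]
    rw [← Matrix.exp_add_of_commute _ _ (((Commute.refl A).smul_left t).smul_right (-t)),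
      ← add_smul, add_neg_cancel, zero_smul, NormedSpace.exp_zero]
  set g : ℝ → Fin k → ℝ := fun s => E (-s) *ᵥ w s with hg
  have hgc : ∀ j, Continuous fun s => g s j := by
    intro j
    have : Continuous fun s => ∑ l, E (-s) j l * w s l := continuous_finsetSum _ fun l _ =>
      ((hEc.comp continuous_neg).matrix_elem j l).mul ((continuous_apply l).comp hw)
    exact this
  set I : ℝ → Fin k → ℝ := fun t j => ∫ s in (0 : ℝ)..t, g s j with hI
  have hId : ∀ j t, HasDerivAt (fun s => I s j) (g t j) t := fun j t =>
    (hgc j).integral_hasStrictDerivAt 0 t |>.hasDerivAt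
  refine ⟨fun t => E t *ᵥ I t, ?_, fun t => ?_⟩
  · have : I 0 = 0 := by funext j; simp [hI]
    simp [this]
  · have hEg : E t *ᵥ g t = w t := by
      rw [hg]
      beta_reduce
      rw [Matrix.mulVec_mulVec, hEE, Matrix.one_mulVec]
    refine hasDerivAt_pi.2 fun i => ?_
    have h := HasDerivAt.fun_sum (u := Finset.univ) fun j (_ : j ∈ Finset.univ) =>
      (hEd i j t).mul (hId j t)
    refine h.congr_deriv ?_
    rw [Matrix.mulVec_mulVec, ← hEg, Finset.sum_add_distrib]
    rfl

theorem exists_linear_solution_on {k : ℕ} (A : Matrix (Fin k) (Fin k) ℝ) {w : ℝ → Fin k → ℝ}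
    {τ : ℝ} (hτ : 0 ≤ τ) (hw : ContinuousOn w (Icc 0 τ)) :
    ∃ z : ℝ → Fin k → ℝ, z 0 = 0 ∧
      ∀ t ∈ Icc 0 τ, HasDerivWithinAt z (A *ᵥ z t + w t) (Icc 0 τ) t := by
  obtain ⟨z, h0, hz⟩ := exists_linear_solution A (w := IccExtend hτ ((Icc 0 τ).domRestrict w))
    (hw.domRestrict.Icc_extend' (h := hτ))
  refine ⟨z, h0, fun t ht => (hz t).hasDerivWithinAt.congr_deriv ?_⟩
  rw [IccExtend_of_mem hτ _ ht]
  rfl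

theorem response_deriv {a k : ℕ} {F : TM a k} (hF : Strict F) {z w : ℝ → Fin k → ℝ} {t : ℝ}
    (ht : 0 ≤ t) (h0 : z 0 = 0) (hz : ∀ s ∈ Icc 0 t, HasDerivWithinAt z (w s) (Icc 0 t) s)
    (hw : IntOn w t) : response F w t = response ((RatFunc.X : RatFunc ℝ) • F) z t := by
  have e1 : ∀ s ∈ Icc 0 t, z s = response ((RatFunc.X : RatFunc ℝ)⁻¹ • (1 : TM k k)) w s :=
    fun s hs => eq_response_X_inv hs.1 h0 (fun r hr => (hz r ⟨hr.1, hr.2.trans hs.2⟩).mono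
      (Icc_subset_Icc_right hs.2)) (hw.mono hs.1 hs.2)
  have hXi : Proper ((RatFunc.X : RatFunc ℝ)⁻¹ • (1 : TM k k)) :=
    proper_one.smul X_inv_mem_properRing
  rw [response_congr _ ht e1, ← response_mul hF.X_smul hXi ht hw]
  congr 1
  rw [Matrix.smul_mul, Matrix.mul_smul, Matrix.mul_one, smul_smul,
    mul_inv_cancel₀ RatFunc.X_ne_zero, one_smul]

theorem output_eq_response_ss {k a b : ℕ} {A : Matrix (Fin k) (Fin k) ℝ}
    {B : Matrix (Fin k) (Fin a) ℝ} (C : Matrix (Fin b) (Fin k) ℝ) (D : Matrix (Fin b) (Fin a) ℝ)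
    {z : ℝ → Fin k → ℝ} {v : ℝ → Fin a → ℝ} {t : ℝ} (ht : 0 ≤ t) (h0 : z 0 = 0)
    (hz : ∀ s ∈ Icc 0 t, HasDerivWithinAt z (A *ᵥ z s + B *ᵥ v s) (Icc 0 t) s) (hv : IntOn v t) :
    C *ᵥ z t + D *ᵥ v t = response (ss A B C D) v t := by
  have hR := (strict_resolvent A).proper
  rw [ss, response_add_left (((proper_const C).mul hR).mul (proper_const B)) (proper_const D) hv,
    response_const, response_mul_const ((proper_const C).mul hR) B ht hv,
    response_mul (proper_const C) hR ht (hv.mulVec B), response_const,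
    eq_response_resolvent_of_zero ht h0 hz (hv.mulVec B)]

/-! ### Input and state in terms of the prediction errors -/

theorem Design.Admissible.intOn_r (hS : S.Admissible) {t : ℝ} (ht : 0 ≤ t) : IntOn S.r t := by
  intro j
  rw [intervalIntegrable_iff_integrableOn_Ioc_of_le ht]
  have h1 : MemLp S.r ⊤ (volume.restrict (Ioc 0 t)) :=
    hS.r_bounded.mono_measure (Measure.restrict_mono (fun s hs => hs.1.le) le_rfl)
  have h2 : Integrable S.r (volume.restrict (Ioc 0 t)) := h1.integrable le_top
  exact h2.eval j

theorem Design.Admissible.ae_norm_r_le (hS : S.Admissible) (t : ℝ) :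
    ∀ᵐ s ∂volume.restrict (Ioc 0 t), ‖S.r s‖ ≤ S.rNorm := by
  have h : ∀ᵐ s ∂volume.restrict (Ici 0), ‖S.r s‖ ≤ S.rNorm := by
    have h1 := ae_le_eLpNormEssSup (f := S.r) (μ := volume.restrict (Ici (0 : ℝ)))
    filter_upwards [h1] with s hs
    rw [Design.rNorm, eLpNorm_exponent_top, ← toReal_enorm]
    refine ENNReal.toReal_mono ?_ hs
    rw [← eLpNorm_exponent_top]
    exact hS.r_bounded.eLpNorm_ne_top
  exact ae_restrict_of_ae_restrict_of_subset (fun s hs => hs.1.le) h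

/-- The control law, solved for the input: the adaptive estimate enters through `C₀ Z⁻¹`. -/
theorem Design.Admissible.input_eq (hS : S.Admissible) {ω : ℝ} (hω : ω ∈ S.Cω)
    {u η uz : ℝ → Fin m → ℝ} {t : ℝ} (ht : 0 ≤ t) (hu : IntOn u t) (hη : IntOn η t)
    (huz : ∀ s ∈ Icc 0 t, uz s = response S.Z u s)
    (hlaw : ∀ s ∈ Icc 0 t, u s = -response (S.D * S.Z⁻¹)
      (fun τ => η τ - response S.Z (fun τ' => S.Kg *ᵥ S.r τ') τ) s) :
    u t = response (S.C0 ω) (fun s => S.Kg *ᵥ S.r s) t -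
      response (S.C0 ω * S.Z⁻¹) (fun s => η s - ω • uz s) t := by
  have hF := (hS.strict_C0_mul_Z_inv hω).proper
  have hD := (hS.strict_D_mul_Z_inv hω).proper
  have hC := (hS.strict_C0 hω).proper
  have hr : IntOn (fun s => S.Kg *ᵥ S.r s) t := (hS.intOn_r ht).mulVec _
  have hZ := proper_Z S
  have hZr := hr.response ht S.Z
  have hZu : IntOn uz t := (hu.response ht S.Z).congr ht fun s hs => (huz s hs).symm
  set e : ℝ → Fin m → ℝ := fun τ => η τ - response S.Z (fun τ' => S.Kg *ᵥ S.r τ') τ with he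
  have hei : IntOn e t := hη.sub hZr
  have hDe : S.D * S.Z⁻¹ = S.C0 ω * S.Z⁻¹ + RatFunc.C ω • (S.C0 ω * (S.D * S.Z⁻¹)) := by
    conv_lhs => rw [hS.D_eq hω]
    rw [Matrix.add_mul, Matrix.smul_mul, Matrix.mul_assoc]
  have split : ∀ {v : ℝ → Fin m → ℝ}, IntOn v t →
      response (S.C0 ω) v t = response (S.C0 ω * S.Z⁻¹) (response S.Z v) t := fun {v} hv => by
    rw [← response_mul hF hZ ht hv, hS.C0_eq]
  have h1 : response (S.C0 ω) (response (S.D * S.Z⁻¹) e) t =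
      -response (S.C0 ω * S.Z⁻¹) uz t := by
    have : ∀ s ∈ Icc 0 t, response (S.D * S.Z⁻¹) e s = (-1 : ℝ) • u s := fun s hs => by
      rw [hlaw s hs, neg_smul, one_smul, neg_neg]
    rw [response_congr _ ht this, response_smul_right, neg_smul, one_smul, split hu]
    rw [response_congr _ ht fun s hs => (huz s hs).symm]
  rw [hlaw t ⟨ht, le_rfl⟩, hDe, response_add_left hF ((hC.mul hD).smul (C_mem_properRing ω)) hei,
    response_C_smul (hC.mul hD) ω ht hei, response_mul hC hD ht hei, h1, he,
    response_sub_right _ hη hZr, ← split hr, response_sub_right _ hη (hZu.smul ω),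
    response_smul_right, smul_neg]
  abel

/-- The input in terms of the uncertainty and the prediction errors. -/
theorem Design.Admissible.input_eq_of_errors (hS : S.Admissible) {ω : ℝ} (hω : ω ∈ S.Cω)
    {u η uz w : ℝ → Fin m → ℝ} {yt yd : ℝ → Fin p → ℝ} {ξ : ℝ → Fin n → ℝ} {t : ℝ} (ht : 0 ≤ t)
    (hu : IntOn u t) (hη : IntOn η t) (hw : IntOn w t) (hξ : IntOn ξ t) (hyd : IntOn yd t)
    (huz : ∀ s ∈ Icc 0 t, uz s = response S.Z u s)
    (hlaw : ∀ s ∈ Icc 0 t, u s = -response (S.D * S.Z⁻¹)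
      (fun τ => η τ - response S.Z (fun τ' => S.Kg *ᵥ S.r τ') τ) s)
    (hy0 : yt 0 = 0) (hyt : ∀ s ∈ Icc 0 t, HasDerivWithinAt yt (yd s) (Icc 0 t) s)
    (hyde : ∀ s ∈ Icc 0 t, yd s = -(S.α • yt s) + (S.Cm * S.Am) *ᵥ ξ s +
      (S.Cm * S.Bbar) *ᵥ (η s - ω • uz s - response S.Z w s)) :
    u t = response (S.C0 ω) (fun s => S.Kg *ᵥ S.r s - w s) t - response (S.C1 ω) yt t +
      response (S.C2 ω) ξ t := by
  have hFs := hS.strict_C0_mul_Z_inv hω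
  have hF := hFs.proper
  have hr : IntOn (fun s => S.Kg *ᵥ S.r s) t := (hS.intOn_r ht).mulVec _
  have hZ := proper_Z S
  have hyc : IntOn yt t := IntOn.of_continuousOn ht fun s hs => (hyt s hs).continuousWithinAt
  have hFB := hFs.mul_proper (proper_const S.CBdag)
  have e1 : ∀ s ∈ Icc 0 t, η s - ω • uz s = response S.Z w s +
      (S.CBdag *ᵥ yd s + (S.α • (S.CBdag *ᵥ yt s) - (S.CBdag * S.Cm * S.Am) *ᵥ ξ s)) := by
    intro s hs
    rw [hyde s hs, Matrix.mulVec_add, Matrix.mulVec_add, Matrix.mulVec_mulVec,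
      Matrix.mulVec_mulVec, hS.CBdag_mul, Matrix.one_mulVec, Matrix.mulVec_neg, Matrix.mulVec_smul,
      Matrix.mul_assoc]
    abel
  have i1 := hyd.mulVec S.CBdag
  have i2 := (hyc.mulVec S.CBdag).smul S.α
  have i3 := hξ.mulVec (S.CBdag * S.Cm * S.Am)
  rw [hS.input_eq hω ht hu hη huz hlaw, response_congr _ ht e1,
    response_add_right _ (hw.response ht S.Z) (i1.add (i2.sub i3)),
    response_add_right _ i1 (i2.sub i3), response_sub_right _ i2 i3, response_smul_right,
    ← response_mul hF hZ ht hw, hS.C0_eq, ← response_mul_const hF _ ht hyd,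
    ← response_mul_const hF _ ht hyc, ← response_mul_const hF _ ht hξ,
    response_deriv hFB ht hy0 hyt hyd, response_sub_right _ hr hw, Design.C1, add_smul,
    response_add_left hFB.X_smul (hFB.proper.smul (C_mem_properRing _)) hyc,
    response_C_smul hFB.proper _ ht hyc, Design.C2]
  abel

/-- The plant state in terms of the uncertainty and the prediction errors. -/
theorem Design.Admissible.state_eq (hS : S.Admissible) {ω : ℝ} (hω : ω ∈ S.Cω)
    {x ξ : ℝ → Fin n → ℝ} {u w : ℝ → Fin m → ℝ} {yt : ℝ → Fin p → ℝ} {t : ℝ} (ht : 0 ≤ t)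
    (hw : IntOn w t) (hu : IntOn u t) (hyt : IntOn yt t) (hξ : IntOn ξ t)
    (hx : ∀ s ∈ Icc 0 t,
      HasDerivWithinAt x (S.Am *ᵥ x s + S.Bm *ᵥ (ω • u s + w s)) (Icc 0 t) s)
    (hue : ∀ s ∈ Icc 0 t, u s = response (S.C0 ω) (fun s => S.Kg *ᵥ S.r s - w s) s -
      response (S.C1 ω) yt s + response (S.C2 ω) ξ s) :
    x t = NormedSpace.exp (t • S.Am) *ᵥ x 0 + response (S.G ω) w t + response (S.Hr ω) S.r t -
      response (S.H1 ω) yt t + response (S.H2 ω) ξ t := by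
  have hH := (strict_H0 S).proper
  have hR := (strict_resolvent S.Am).proper
  have hC := (hS.strict_C0 hω).proper
  have hCC := (hS.strict_C hω).proper
  have hC1 := hS.proper_C1 hω
  have hC2 := (hS.strict_C2 hω).proper
  have hr := hS.intOn_r ht
  have hKr : IntOn (fun s => S.Kg *ᵥ S.r s) t := hr.mulVec _
  have hin := hKr.sub hw
  have j0 := hin.response ht (S.C0 ω)
  have j1 := hyt.response ht (S.C1 ω)
  have j2 := hξ.response ht (S.C2 ω)
  have eH : ∀ {a : ℕ} {F : TM m a} {v : ℝ → Fin a → ℝ}, Proper F → IntOn v t →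
      ω • response S.H0 (response F v) t = response (RatFunc.C ω • (S.H0 * F)) v t := by
    intro a F v hF hv
    rw [response_C_smul (hH.mul hF) ω ht hv, response_mul hH hF ht hv]
  have e0 : RatFunc.C ω • (S.H0 * S.C0 ω) = S.H0 * S.C ω := by rw [Design.C, Matrix.mul_smul]
  rw [eq_exp_add_response ht hx (((hu.smul ω).add hw).mulVec S.Bm),
    ← response_mul_const hR S.Bm ht ((hu.smul ω).add hw), ← Design.H0,
    response_add_right _ (hu.smul ω) hw, response_smul_right, response_congr _ ht hue,
    response_add_right _ (j0.sub j1) j2, response_sub_right _ j0 j1, smul_add, smul_sub,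
    eH hC hin, eH hC1 hyt, eH hC2 hξ, e0, response_sub_right _ hKr hw, Design.G, Matrix.mul_sub,
    Matrix.mul_one, response_sub_left hH (hH.mul hCC) hw, Design.Hr,
    response_mul_const (hH.mul hCC) S.Kg ht hr, Design.H1, Design.H2]
  abel

end L1Control

end

noncomputable section

namespace L1Control

variable {n m p nz mr : ℕ} {S : Design n m p nz mr} {f : (Fin n → ℝ) → ℝ → Fin m → ℝ}
  {c : Signals n m p nz} {K : Gains} {ω : ℝ} {x0 : Fin n → ℝ} {T : EReal}

theorem Icc_subset_timeDom {τ : ℝ} (hτ : τ ∈ timeDom T) : Icc 0 τ ⊆ timeDom T := fun _ ht =>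
  ⟨ht.1, (EReal.coe_le_coe_iff.2 ht.2).trans_lt hτ.2⟩

theorem exists_gt_mem_timeDom {t : ℝ} (ht : t ∈ timeDom T) : ∃ τ ∈ timeDom T, t < τ := by
  obtain ⟨τ, h1, h2⟩ := EReal.lt_iff_exists_real_btwn.1 ht.2
  have h3 : t < τ := EReal.coe_lt_coe_iff.1 h1
  exact ⟨τ, ⟨ht.1.trans h3.le, h2⟩, h3⟩

/-- The plant in the coordinates of the predictor. -/
theorem Design.Admissible.hasDerivWithinAt_sub_Tz (hS : S.Admissible) {I : Set ℝ} {t : ℝ}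
    {x : ℝ → Fin n → ℝ} {xu xf : ℝ → Fin nz → ℝ} {u w : Fin m → ℝ}
    (hx : HasDerivWithinAt x (S.Am *ᵥ x t + S.Bm *ᵥ (ω • u + w)) I t)
    (hxu : HasDerivWithinAt xu (S.Az *ᵥ xu t + S.Bz *ᵥ u) I t)
    (hxf : HasDerivWithinAt xf (S.Az *ᵥ xf t + S.Bz *ᵥ w) I t) :
    HasDerivWithinAt (fun s => x s - S.Tz *ᵥ (ω • xu s + xf s))
      (S.Am *ᵥ (x t - S.Tz *ᵥ (ω • xu t + xf t)) + S.Bbar *ᵥ (ω • (S.Cz *ᵥ xu t + S.Dz *ᵥ u) +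
        (S.Cz *ᵥ xf t + S.Dz *ᵥ w))) I t := by
  refine (hx.sub (HasDerivWithinAt.mulVec S.Tz ((hxu.const_smul ω).add hxf))).congr_deriv ?_
  have e1 : S.Am *ᵥ (S.Tz *ᵥ (ω • xu t + xf t)) =
      S.Tz *ᵥ (S.Az *ᵥ (ω • xu t + xf t)) + S.Bbar *ᵥ (S.Cz *ᵥ (ω • xu t + xf t)) := by
    simp only [Matrix.mulVec_mulVec, ← Matrix.add_mulVec, hS.AmTz]
  have e2 : S.Bm *ᵥ (ω • u + w) = S.Tz *ᵥ (S.Bz *ᵥ (ω • u + w)) +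
      S.Bbar *ᵥ (S.Dz *ᵥ (ω • u + w)) := by
    simp only [Matrix.mulVec_mulVec, ← Matrix.add_mulVec, ← hS.Bm_eq]
  rw [Matrix.mulVec_sub, e1, e2]
  simp only [Matrix.mulVec_add, Matrix.mulVec_smul, smul_add]
  abel

theorem Design.Admissible.Cm_mulVec_sub_Tz (hS : S.Admissible) (x : Fin n → ℝ) (z : Fin nz → ℝ) :
    S.Cm *ᵥ (x - S.Tz *ᵥ z) = S.Cm *ᵥ x := by
  rw [Matrix.mulVec_sub, Matrix.mulVec_mulVec, hS.Cm_mul_Tz, Matrix.zero_mulVec, sub_zero]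

/-- Dynamics of the output prediction error. -/
theorem output_error_deriv {I : Set ℝ} {t : ℝ}
    {x xv : ℝ → Fin n → ℝ} {yh : ℝ → Fin p → ℝ} {xvh : Fin n → ℝ} {η ηh : Fin m → ℝ}
    (hxv : HasDerivWithinAt xv (S.Am *ᵥ xv t + S.Bbar *ᵥ η) I t) (ht : t ∈ I)
    (hC : ∀ s ∈ I, S.Cm *ᵥ xv s = S.Cm *ᵥ x s)
    (hyh : HasDerivWithinAt yh (-(S.α • (yh t - S.Cm *ᵥ x t)) + (S.Cm * S.Am) *ᵥ xvh +
      (S.Cm * S.Bbar) *ᵥ ηh) I t) :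
    HasDerivWithinAt (fun s => yh s - S.Cm *ᵥ x s) (-(S.α • (yh t - S.Cm *ᵥ x t)) +
      (S.Cm * S.Am) *ᵥ (xvh - xv t) + (S.Cm * S.Bbar) *ᵥ (ηh - η)) I t := by
  refine ((hyh.sub (HasDerivWithinAt.mulVec S.Cm hxv)).congr_deriv ?_).congr
    (fun s hs => by rw [Pi.sub_apply, hC s hs]) (by rw [Pi.sub_apply, hC t ht])
  simp only [Matrix.mulVec_add, Matrix.mulVec_sub, Matrix.mulVec_mulVec]
  abel

/-- Dynamics of the state prediction error. -/
theorem Design.Admissible.state_error_deriv (hS : S.Admissible) {I : Set ℝ} {t : ℝ}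
    {x xv vh : ℝ → Fin n → ℝ} {yt : Fin p → ℝ} {η : Fin m → ℝ}
    (hxv : HasDerivWithinAt xv (S.Am *ᵥ xv t + S.Bbar *ᵥ η) I t) (ht : t ∈ I)
    (hC : ∀ s ∈ I, S.Cm *ᵥ xv s = S.Cm *ᵥ x s)
    (hvh : HasDerivWithinAt vh (S.Av *ᵥ (vh t + S.H *ᵥ (S.Cm *ᵥ x t)) - S.Kv *ᵥ (S.Cm *ᵥ x t) -
      (S.Pv⁻¹ * S.Amᵀ * S.Cmᵀ * S.Py) *ᵥ yt) I t) :
    HasDerivWithinAt (fun s => vh s + S.H *ᵥ (S.Cm *ᵥ x s) - xv s)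
      (S.Av *ᵥ (vh t + S.H *ᵥ (S.Cm *ᵥ x t) - xv t) -
        (S.Pv⁻¹ * S.Amᵀ * S.Cmᵀ * S.Py) *ᵥ yt) I t := by
  have hd := (hvh.add (HasDerivWithinAt.mulVec S.H (HasDerivWithinAt.mulVec S.Cm hxv))).sub hxv
  refine (hd.congr_deriv ?_).congr
    (fun s hs => by simp only [Pi.sub_apply, Pi.add_apply, hC s hs])
    (by simp only [Pi.sub_apply, Pi.add_apply, hC t ht])
  have e1 : S.H *ᵥ (S.Cm *ᵥ (S.Bbar *ᵥ η)) = S.Bbar *ᵥ η := by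
    rw [Matrix.mulVec_mulVec, Matrix.mulVec_mulVec, Design.H,
      Matrix.mul_assoc, Matrix.mul_assoc, hS.CBdag_mul,
      Matrix.mul_one]
  have e2 : S.Av *ᵥ xv t = S.Am *ᵥ xv t - S.H *ᵥ (S.Cm *ᵥ (S.Am *ᵥ xv t)) +
      S.Kv *ᵥ (S.Cm *ᵥ xv t) := by
    rw [Design.Av, Design.AH]
    simp only [Matrix.mulVec_mulVec, Matrix.add_mulVec, Matrix.sub_mul, Matrix.one_mul,
      Matrix.sub_mulVec, Matrix.mul_assoc]
  rw [← hC t ht, Matrix.mulVec_sub S.Av _ (xv t), e2, Matrix.mulVec_add S.Cm, Matrix.mulVec_add S.H,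
    e1]
  abel

/-- Closed-loop trajectories, in terms of the output prediction error and of a state prediction
error `ξ`, which obey the Lyapunov estimate while state and input are within their bounds. -/
theorem Signals.IsClosedLoop.exists_errors (hc : c.IsClosedLoop S K ω f x0 T) (hS : S.Admissible)
    (hω : ω ∈ S.Cω) (hf : S.Uncertainty f) {τ : ℝ} (hτ0 : 0 < τ) (hτ : τ ∈ timeDom T) :
    ∃ ξ : ℝ → Fin n → ℝ,
      (∀ t ∈ Icc 0 τ, c.u t = response (S.C0 ω) (fun s => S.Kg *ᵥ S.r s - f (c.x s) s) t -
        response (S.C1 ω) (c.ytil S) t + response (S.C2 ω) ξ t) ∧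
      (∀ t ∈ Icc 0 τ, c.x t = NormedSpace.exp (t • S.Am) *ᵥ x0 +
        response (S.G ω) (fun s => f (c.x s) s) t + response (S.Hr ω) S.r t -
        response (S.H1 ω) (c.ytil S) t + response (S.H2 ω) ξ t) ∧
      ∀ lθ lσ : ℝ, 0 ≤ lθ → 0 ≤ lσ → S.RateBounds ω f lθ lσ → K.Admissible S lθ lσ →
        (∀ t ∈ Icc 0 τ, ‖c.x t‖ ≤ S.ρx ∧ ‖c.u t‖ ≤ S.ρu ω) → ∀ t ∈ Icc 0 τ,
        S.predictionEnergy (c.ytil S t) (ξ t) ≤ Real.exp (-S.lam1 * t) *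
          S.predictionEnergy 0 ((1 - S.H * S.Cm) *ᵥ x0) + S.θ1 lθ lσ / K.Γ := by
  have hsub := Icc_subset_timeDom hτ
  have hIci : Icc 0 τ ⊆ Ici 0 := fun t ht => ht.1
  have dx := fun t ht => (hc.x_ode t (hsub ht)).mono hIci
  have dxu := fun t ht => (hc.xu_ode t (hsub ht)).mono hIci
  have dvh := fun t ht => (hc.vhat_ode t (hsub ht)).mono hIci
  have dyh := fun t ht => (hc.yhat_ode t (hsub ht)).mono hIci
  have dωh := fun t ht => (hc.ωhat_ode t (hsub ht)).mono hIci
  have dθh := fun t ht => (hc.θhat_ode t (hsub ht)).mono hIci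
  have dσh := fun t ht => (hc.σhat_ode t (hsub ht)).mono hIci
  have cx : ContinuousOn c.x (Icc 0 τ) := fun t ht => (dx t ht).continuousWithinAt
  have cw := hf.continuousOn hIci cx
  have cu : ContinuousOn c.u (Icc 0 τ) := hc.u_cont.mono hsub
  have mulc : ∀ {a b : ℕ} (B : Matrix (Fin a) (Fin b) ℝ) {g : ℝ → Fin b → ℝ},
      ContinuousOn g (Icc 0 τ) → ContinuousOn (fun t => B *ᵥ g t) (Icc 0 τ) := fun B g hg =>
    (LinearMap.toContinuousLinearMap B.mulVecLin).continuous.comp_continuousOn hg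
  obtain ⟨xf, hxf0, dxf⟩ := exists_linear_solution_on S.Az hτ0.le (mulc S.Bz cw)
  set xv : ℝ → Fin n → ℝ := fun s => c.x s - S.Tz *ᵥ (ω • c.xu s + xf s) with hxv
  set fbar : ℝ → Fin m → ℝ := fun t => S.Cz *ᵥ xf t + S.Dz *ᵥ f (c.x t) t with hfbar
  have dxv : ∀ t ∈ Icc 0 τ, HasDerivWithinAt xv
      (S.Am *ᵥ xv t + S.Bbar *ᵥ (ω • c.uz S t + fbar t)) (Icc 0 τ) t := fun t ht =>
    hS.hasDerivWithinAt_sub_Tz (dx t ht) (dxu t ht) (dxf t ht)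
  have hC : ∀ s ∈ Icc 0 τ, S.Cm *ᵥ xv s = S.Cm *ᵥ c.x s := fun s _ => hS.Cm_mulVec_sub_Tz _ _
  set ξ : ℝ → Fin n → ℝ := fun s => c.xvhat S s - xv s with hξ
  have dξ : ∀ t ∈ Icc 0 τ, HasDerivWithinAt ξ
      (S.Av *ᵥ ξ t - (S.Pv⁻¹ * S.Amᵀ * S.Cmᵀ * S.Py) *ᵥ c.ytil S t) (Icc 0 τ) t := fun t ht =>
    hS.state_error_deriv (dxv t ht) ht hC (dvh t ht)
  have dyt : ∀ t ∈ Icc 0 τ, HasDerivWithinAt (c.ytil S) (-(S.α • c.ytil S t) +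
      (S.Cm * S.Am) *ᵥ ξ t + (S.Cm * S.Bbar) *ᵥ (c.ηhat S t - (ω • c.uz S t + fbar t)))
      (Icc 0 τ) t := fun t ht => output_error_deriv (dxv t ht) ht hC (dyh t ht)
  have cξ : ContinuousOn ξ (Icc 0 τ) := fun t ht => (dξ t ht).continuousWithinAt
  have cyt : ContinuousOn (c.ytil S) (Icc 0 τ) := fun t ht => (dyt t ht).continuousWithinAt
  have cxu : ContinuousOn c.xu (Icc 0 τ) := fun t ht => (dxu t ht).continuousWithinAt
  have cxf : ContinuousOn xf (Icc 0 τ) := fun t ht => (dxf t ht).continuousWithinAt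
  have cxv : ContinuousOn xv (Icc 0 τ) := fun t ht => (dxv t ht).continuousWithinAt
  have cuz : ContinuousOn (c.uz S) (Icc 0 τ) := (mulc _ cxu).add (mulc _ cu)
  have cfb : ContinuousOn fbar (Icc 0 τ) := (mulc _ cxf).add (mulc _ cw)
  have cxvh : ContinuousOn (c.xvhat S) (Icc 0 τ) := by
    have : c.xvhat S = fun s => ξ s + xv s := by funext s; simp [hξ]
    rw [this]
    exact cξ.add cxv
  have cη : ContinuousOn (c.ηhat S) (Icc 0 τ) := by
    have cxg : ContinuousOn (c.xghat S) (Icc 0 τ) := by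
      refine continuousOn_pi.2 fun i => ?_
      rcases i with i | i
      · exact (continuous_apply i).comp_continuousOn cxvh
      · exact (continuous_apply i).comp_continuousOn cxu
    have cωh : ContinuousOn c.ωhat (Icc 0 τ) := fun t ht => (dωh t ht).continuousWithinAt
    have cθh : ContinuousOn c.θhat (Icc 0 τ) := fun t ht => (dθh t ht).continuousWithinAt
    have cσh : ContinuousOn c.σhat (Icc 0 τ) := fun t ht => (dσh t ht).continuousWithinAt
    exact ((cωh.smul cuz).add (cxg.norm.smul cθh)).add cσh
  have int : ∀ {a : ℕ} {g : ℝ → Fin a → ℝ}, ContinuousOn g (Icc 0 τ) → ∀ t ∈ Icc 0 τ, IntOn g t :=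
    fun hg t ht => IntOn.of_continuousOn ht.1 (hg.mono (Icc_subset_Icc_right ht.2))
  have restr : ∀ {a : ℕ} {g g' : ℝ → Fin a → ℝ}, (∀ t ∈ Icc 0 τ,
      HasDerivWithinAt g (g' t) (Icc 0 τ) t) → ∀ t ∈ Icc 0 τ, ∀ s ∈ Icc 0 t,
      HasDerivWithinAt g (g' s) (Icc 0 t) s := fun h t ht s hs =>
    (h s ⟨hs.1, hs.2.trans ht.2⟩).mono (Icc_subset_Icc_right ht.2)
  have huz : ∀ t ∈ Icc 0 τ, c.uz S t = response S.Z c.u t := fun t ht =>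
    output_eq_response_ss S.Cz S.Dz ht.1 hc.xu_init (restr dxu t ht) (int cu t ht)
  have hfb : ∀ t ∈ Icc 0 τ, fbar t = response S.Z (fun s => f (c.x s) s) t := fun t ht =>
    output_eq_response_ss S.Cz S.Dz ht.1 hxf0 (restr dxf t ht) (int cw t ht)
  have hyt0 : c.ytil S 0 = 0 := by
    rw [Signals.ytil, Signals.y, hc.yhat_init, hc.x_init, sub_self]
  have hξ0 : ξ 0 = -((1 - S.H * S.Cm) *ᵥ x0) := by
    simp only [hξ, hxv, Signals.xvhat, Signals.y, hc.vhat_init, hc.x_init, hc.xu_init, hxf0,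
      smul_zero, add_zero, zero_add, Matrix.mulVec_zero, sub_zero, Matrix.sub_mulVec,
      Matrix.one_mulVec, Matrix.mulVec_mulVec, neg_sub]
  have cyd : ContinuousOn (fun t => -(S.α • c.ytil S t) + (S.Cm * S.Am) *ᵥ ξ t +
      (S.Cm * S.Bbar) *ᵥ (c.ηhat S t - (ω • c.uz S t + fbar t))) (Icc 0 τ) :=
    ((cyt.const_smul S.α).neg.add (mulc _ cξ)).add
      (mulc _ (cη.sub ((cuz.const_smul ω).add cfb)))
  have hueq : ∀ t ∈ Icc 0 τ, c.u t =
      response (S.C0 ω) (fun s => S.Kg *ᵥ S.r s - f (c.x s) s) t -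
        response (S.C1 ω) (c.ytil S) t + response (S.C2 ω) ξ t := fun t ht => by
    have hs' : ∀ s ∈ Icc 0 t, s ∈ Icc 0 τ := fun s hs => ⟨hs.1, hs.2.trans ht.2⟩
    exact hS.input_eq_of_errors hω ht.1 (int cu t ht) (int cη t ht) (int cw t ht) (int cξ t ht)
      (int cyd t ht) (fun s hs => huz s (hs' s hs)) (fun s hs => hc.u_law s (hsub (hs' s hs)))
      hyt0 (restr dyt t ht) (fun s hs => by rw [hfb s (hs' s hs), sub_sub])
  refine ⟨ξ, hueq, fun t ht => ?_, ?_⟩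
  · have := hS.state_eq hω ht.1 (int cw t ht) (int cu t ht) (int cyt t ht) (int cξ t ht)
      (restr dx t ht) (fun s hs => hueq s ⟨hs.1, hs.2.trans ht.2⟩)
    rwa [hc.x_init] at this
  · intro lθ lσ hlθ hlσ hRB hK hb t ht
    obtain ⟨θ, σ, h1, h2⟩ := hRB τ hτ0 c.u xv c.x c.xu xf fbar cu hc.xu_init hxf0 fun t ht =>
      ⟨by
        rw [Design.Admissible.Tg_mulVec]
        simp only [hxv, Matrix.mulVec_add, Matrix.mulVec_smul]
        abel, rfl, dxu t ht, dxf t ht, dxv t ht, (hb t ht).1, (hb t ht).2⟩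
    have key := hS.predictionEnergy_le hω hlθ hlσ hK (τ := τ) (yt := c.ytil S) (ξ := ξ)
      (ωh := c.ωhat) (N := fun t => ‖c.xghat S t‖)
      (Δ := fun t => ‖c.xghat S t‖ - ‖(Sum.elim (xv t) (c.xu t) : Fin n ⊕ Fin nz → ℝ)‖)
      (e := c.ey S) (uz := c.uz S) (θ := θ) (θh := c.θhat) (σ := σ) (σh := c.σhat)
      (fun t _ => rfl) (fun t ht => (dyt t ht).congr_deriv ?_) dξ (fun t ht => ?_)
      (fun t ht => (h1 t ht).2.1) (fun t ht => (h1 t ht).2.2) (fun s hs t ht => (h2 s hs t ht).1)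
      (fun s hs t ht => (h2 s hs t ht).2) hc.ωhat_init hc.θhat_init hc.σhat_init dωh dθh dσh t ht
    · have e0 : S.predictionEnergy (c.ytil S 0) (ξ 0) =
          S.predictionEnergy 0 ((1 - S.H * S.Cm) *ᵥ x0) := by
        rw [hyt0, hξ0]
        simp [Design.predictionEnergy, Matrix.mulVec_neg]
      rwa [e0] at key
    · congr 2
      rw [(h1 t ht).1, Signals.ηhat]
      simp only [sub_smul, smul_sub]
      abel
    · refine (norm_sum_elim_sub_le _ _ _ _).trans (le_of_eq ?_)
      rw [sub_self, norm_zero, add_zero]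

end L1Control

end

noncomputable section

namespace L1Control

variable {n m p nz mr : ℕ} {S : Design n m p nz mr}

/-! ### Small-gain and continuation arguments -/

theorem norm_response_le_on {a b : ℕ} {G : TM a b} {μ : ℝ}
    (hμ : ∀ i j, WeightIntegrable μ (G i j)) (hp : Proper G) (hs : Stable G) {v : ℝ → Fin b → ℝ}
    {A B t : ℝ} (hA : 0 ≤ A) (hB : 0 ≤ B) (ht : 0 ≤ t)
    (hv : ∀ s ∈ Icc 0 t, ‖v s‖ ≤ A * Real.exp (-μ * s) + B) :
    ‖response G v t‖ ≤ weightedL1 μ G * (A * Real.exp (-μ * t)) + l1Norm G * B :=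
  norm_response_le hμ hp hs hA hB ht (Or.inr (hv t ⟨ht, le_rfl⟩))
    ((ae_restrict_iff' measurableSet_Ioc).2
      (Eventually.of_forall fun s hs => hv s (Ioc_subset_Icc_self hs)))

/-- Small-gain theorem, with exponentially decaying and constant components of the bound. -/
theorem norm_le_of_small_gain {G : TM n m} {μ L ρ A B τ : ℝ}
    (hμ : ∀ i j, WeightIntegrable μ (G i j)) (hp : Proper G) (hs : Stable G) (hL : 0 ≤ L)
    (hρμ : L * weightedL1 μ G ≤ ρ) (hρ0 : L * l1Norm G ≤ ρ) (hρ : ρ < 1) (hA : 0 ≤ A) (hB : 0 ≤ B)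
    {δ : ℝ → Fin n → ℝ} {w : ℝ → Fin m → ℝ} (hδ : ContinuousOn δ (Icc 0 τ))
    (hw : ∀ s ∈ Icc 0 τ, ‖w s‖ ≤ L * ‖δ s‖)
    (h : ∀ s ∈ Icc 0 τ, ‖δ s - response G w s‖ ≤ (1 - ρ) * (A * Real.exp (-μ * s) + B)) :
    ∀ t ∈ Icc 0 τ, ‖δ t‖ ≤ A * Real.exp (-μ * t) + B := by
  intro t ht
  refine le_of_forall_pos_le_add fun η hη => ?_
  set φ : ℝ → ℝ := fun s => A * Real.exp (-μ * s) + (B + η) with hφ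
  have hφ0 : ∀ s, 0 < φ s := fun s => by
    have := mul_nonneg hA (Real.exp_pos (-μ * s)).le
    simp only [hφ]
    linarith
  have hc : ContinuousOn (fun s => ‖δ s‖ / φ s) (Icc 0 τ) :=
    hδ.norm.div (by fun_prop) fun s _ => (hφ0 s).ne'
  obtain ⟨s, hs', hmax⟩ := isCompact_Icc.exists_isMaxOn ⟨t, ht⟩ hc
  set k := ‖δ s‖ / φ s with hk
  have hk0 : 0 ≤ k := div_nonneg (norm_nonneg _) (hφ0 s).le
  have hle : ∀ r ∈ Icc 0 τ, ‖δ r‖ ≤ k * φ r := fun r hr => (div_le_iff₀ (hφ0 r)).1 (hmax hr)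
  have hG : ‖response G w s‖ ≤ weightedL1 μ G * (L * k * A * Real.exp (-μ * s)) +
      l1Norm G * (L * k * (B + η)) := by
    refine norm_response_le_on hμ hp hs (by positivity) (by positivity) hs'.1 fun r hr => ?_
    have hr' : r ∈ Icc 0 τ := ⟨hr.1, hr.2.trans hs'.2⟩
    refine (hw r hr').trans ((mul_le_mul_of_nonneg_left (hle r hr') hL).trans (le_of_eq ?_))
    simp only [hφ]
    ring
  have hE := (Real.exp_pos (-μ * s)).le
  have hG' : ‖response G w s‖ ≤ ρ * (k * φ s) := by
    refine hG.trans ?_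
    have a1 := mul_le_mul_of_nonneg_right hρμ (mul_nonneg (mul_nonneg hk0 hA) hE)
    have a2 := mul_le_mul_of_nonneg_right hρ0 (mul_nonneg hk0 (add_nonneg hB hη.le))
    simp only [hφ]
    linarith
  have h1 : ‖δ s‖ ≤ ρ * (k * φ s) + (1 - ρ) * φ s := by
    have h2 := norm_add_le (δ s - response G w s) (response G w s)
    rw [sub_add_cancel] at h2
    have h3 := h s hs'
    have h4 : (1 - ρ) * (A * Real.exp (-μ * s) + B) ≤ (1 - ρ) * φ s :=
      mul_le_mul_of_nonneg_left (by simp only [hφ]; linarith) (by linarith)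
    linarith
  have h2 : ‖δ s‖ = k * φ s := by rw [hk, div_mul_cancel₀ _ (hφ0 s).ne']
  have hk1 : k ≤ 1 := by
    have h3 : (1 - ρ) * φ s * k ≤ (1 - ρ) * φ s * 1 := by linarith
    exact le_of_mul_le_mul_left h3 (mul_pos (by linarith) (hφ0 s))
  refine (hle t ht).trans ((mul_le_mul_of_nonneg_right hk1 (hφ0 t).le).trans (le_of_eq ?_))
  simp only [hφ]
  ring

/-- A continuous function stays below a level that it cannot be the first to reach. -/
theorem lt_of_first_exit {φ : ℝ → ℝ} {B τ : ℝ} (hφ : ContinuousOn φ (Icc 0 τ)) (h0 : φ 0 < B)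
    (h : ∀ t ∈ Icc 0 τ, 0 < t → (∀ s ∈ Icc 0 t, φ s ≤ B) → φ t < B) :
    ∀ t ∈ Icc 0 τ, φ t < B := by
  by_contra! hcon
  obtain ⟨t, ht, hBt⟩ := hcon
  have hK : IsCompact (Icc 0 τ ∩ φ ⁻¹' Ici B) :=
    isCompact_Icc.of_isClosed_subset (hφ.preimage_isClosed_of_isClosed isClosed_Icc isClosed_Ici)
      inter_subset_left
  obtain ⟨t₀, ⟨ht₀, hB₀⟩, hmin⟩ := hK.exists_isLeast ⟨t, ht, hBt⟩
  have hpos : 0 < t₀ := by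
    refine lt_of_le_of_ne ht₀.1 ?_
    rintro rfl
    exact absurd hB₀ (not_le.2 h0)
  have hlt : ∀ s ∈ Icc 0 t₀, s < t₀ → φ s < B := fun s hs hst => by
    by_contra! hs'
    exact absurd (hmin ⟨⟨hs.1, hs.2.trans ht₀.2⟩, hs'⟩) (not_le.2 hst)
  have hsub : Icc 0 t₀ ⊆ Icc 0 τ := Icc_subset_Icc_right ht₀.2
  obtain ⟨s, hs, hsB⟩ := intermediate_value_Icc hpos.le (hφ.mono hsub) ⟨h0.le, hB₀⟩
  have hs₀ : s = t₀ := by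
    by_contra hne
    exact absurd hsB (hlt s hs (lt_of_le_of_ne hs.2 hne)).ne
  subst hs₀
  refine absurd (h s ht₀ hpos fun r hr => ?_) (not_lt.2 hB₀)
  rcases hr.2.lt_or_eq with hr' | hr'
  · exact (hlt r hr hr').le
  · rw [hr', hsB]

/-! ### Decay of the matrix exponential -/

theorem infNorm_le_sum {ι κ : Type} [Fintype ι] [Fintype κ] (A : Matrix ι κ ℝ) :
    infNorm A ≤ ∑ i, ∑ j, |A i j| := by
  have h : infNorm A = ((Finset.univ : Finset ι).sup fun i => ∑ j, ‖A i j‖₊ : NNReal) :=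
    Matrix.linfty_opNorm_def A
  rw [h]
  have h2 : ((Finset.univ : Finset ι).sup fun i => ∑ j, ‖A i j‖₊) ≤ ∑ i, ∑ j, ‖A i j‖₊ :=
    Finset.sup_le fun i hi => Finset.single_le_sum (f := fun i => ∑ j, ‖A i j‖₊)
      (fun _ _ => zero_le) hi
  refine (NNReal.coe_le_coe.2 h2).trans (le_of_eq ?_)
  push_cast
  rfl

theorem exists_infNorm_exp_le {A : Matrix (Fin n) (Fin n) ℝ} (hA : Hurwitz A) :
    ∃ C β : ℝ, 0 ≤ C ∧ 0 < β ∧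
      ∀ t, 0 ≤ t → infNorm (NormedSpace.exp (t • A)) ≤ C * Real.exp (-β * t) := by
  have h : ∀ q : Fin n × Fin n, ∃ C β : ℝ, 0 ≤ C ∧ 0 < β ∧
      ∀ t, 0 ≤ t → |NormedSpace.exp (t • A) q.1 q.2| ≤ C * Real.exp (-β * t) := by
    intro q
    obtain ⟨C, β, hC, hβ, hb⟩ :=
      expDecay_impulse ((strict_resolvent A).proper q.1 q.2) (stable_resolvent hA q.1 q.2)
    refine ⟨C, β, hC, hβ, fun t ht => ?_⟩
    have := hb t ht
    rwa [impulse_resolvent, Real.norm_eq_abs] at this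
  choose C β hC hβ hb using h
  obtain ⟨β₀, hβ₀, hle⟩ : ∃ β₀ > 0, ∀ q, β₀ ≤ β q := by
    rcases isEmpty_or_nonempty (Fin n × Fin n) with he | he
    · exact ⟨1, one_pos, fun q => he.elim q⟩
    · obtain ⟨q, hq⟩ := Finite.exists_min β
      exact ⟨β q, hβ q, hq⟩
  refine ⟨∑ i, ∑ j, C (i, j), β₀, Finset.sum_nonneg fun i _ => Finset.sum_nonneg fun j _ => hC _,
    hβ₀, fun t ht => (infNorm_le_sum _).trans ?_⟩
  rw [Finset.sum_mul]
  refine Finset.sum_le_sum fun i _ => ?_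
  rw [Finset.sum_mul]
  refine Finset.sum_le_sum fun j _ => (hb (i, j) t ht).trans ?_
  refine mul_le_mul_of_nonneg_left (Real.exp_le_exp.2 ?_) (hC _)
  nlinarith [hle (i, j)]

namespace Design.Admissible

theorem infNorm_exp_le_κm (hS : S.Admissible) {t : ℝ} (ht : 0 ≤ t) :
    infNorm (NormedSpace.exp (t • S.Am)) ≤ S.κm := by
  obtain ⟨C, β, hC, hβ, h⟩ := exists_infNorm_exp_le hS.hurwitz_Am
  refine le_csSup ⟨C, ?_⟩ ⟨t, ht, rfl⟩
  rintro _ ⟨s, hs, rfl⟩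
  refine (h s hs).trans (mul_le_of_le_one_right hC (Real.exp_le_one_iff.2 ?_))
  have : 0 ≤ s := hs
  nlinarith

theorem one_le_κm (hS : S.Admissible) : 1 ≤ S.κm := by
  have h := hS.infNorm_exp_le_κm le_rfl
  rw [zero_smul, NormedSpace.exp_zero] at h
  have : Nonempty (Fin n) := ⟨⟨0, hS.n_pos⟩⟩
  have h1 := norm_mulVec_le (1 : Matrix (Fin n) (Fin n) ℝ) (fun _ => (1 : ℝ))
  rw [Matrix.one_mulVec, pi_norm_const, norm_one, mul_one] at h1
  exact h1.trans h

/-! ### Bounds on the prediction errors -/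

theorem predictionEnergy_init_le (hS : S.Admissible) (x0 : Fin n → ℝ) :
    S.predictionEnergy 0 ((1 - S.H * S.Cm) *ᵥ x0) ≤ n * lamMax S.Pvbar * ‖x0‖ ^ 2 := by
  have hn : 0 < n := hS.n_pos
  have hPv : S.Pvᴴ = S.Pv := hS.Pv_posDef.isHermitian
  have hH : S.Pvbar.IsHermitian := by
    rw [Matrix.IsHermitian, Design.Pvbar, Matrix.conjTranspose_mul, Matrix.conjTranspose_mul, hPv,
      Matrix.conjTranspose_eq_transpose_of_trivial, Matrix.conjTranspose_eq_transpose_of_trivial,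
      Matrix.transpose_transpose, Matrix.mul_assoc]
  have quad : ∀ v : Fin n → ℝ, v ⬝ᵥ (S.Pvbar *ᵥ v) =
      ((1 - S.H * S.Cm) *ᵥ v) ⬝ᵥ (S.Pv *ᵥ ((1 - S.H * S.Cm) *ᵥ v)) := fun v => by
    rw [Design.Pvbar, Matrix.mul_assoc, ← Matrix.mulVec_mulVec, ← Matrix.mulVec_mulVec,
      Matrix.dotProduct_mulVec, Matrix.vecMul_transpose]
  have hmax : 0 ≤ lamMax S.Pvbar := by
    have h1 := dot_le_lamMax_mul hH (Pi.single ⟨0, hn⟩ 1)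
    have h2 := lamMin_mul_dot_le hS.Pv_posDef.isHermitian
      ((1 - S.H * S.Cm) *ᵥ (Pi.single ⟨0, hn⟩ 1))
    have h3 := mul_nonneg (lamMin_pos hn hS.Pv_posDef).le
      (dot_self_nonneg ((1 - S.H * S.Cm) *ᵥ (Pi.single ⟨0, hn⟩ 1)))
    rw [← quad] at h2
    have h4 : (Pi.single ⟨0, hn⟩ 1 : Fin n → ℝ) ⬝ᵥ Pi.single ⟨0, hn⟩ 1 = 1 := by simp
    rw [h4, mul_one] at h1
    linarith
  have h1 := dot_le_lamMax_mul hH x0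
  have h2 := mul_le_mul_of_nonneg_left (dot_le_card_mul_norm_sq x0) hmax
  rw [Design.predictionEnergy, zero_dotProduct, zero_add, ← quad]
  linarith

theorem norm_le_of_energy {k : ℕ} {z : Fin k → ℝ} {lmin Λ lam t X E θ : ℝ} (hl : 0 < lmin)
    (hX : 0 ≤ X) (hθ : 0 ≤ θ) (hz : lmin * (z ⬝ᵥ z) ≤ E)
    (hE : E ≤ Real.exp (-lam * t) * (n * Λ * X ^ 2) + θ) :
    ‖z‖ ≤ √(n * (Λ / lmin)) * X * Real.exp (-(lam / 2) * t) + √θ / √lmin := by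
  set a := √(n * (Λ / lmin)) with ha
  have hexp : Real.exp (-lam * t) = Real.exp (-(lam / 2) * t) ^ 2 := by
    rw [← Real.exp_nat_mul]
    congr 1
    push_cast
    ring
  have ha2 : n * (Λ / lmin) ≤ a ^ 2 := by
    rcases le_total 0 (n * (Λ / lmin)) with h | h
    · rw [ha, Real.sq_sqrt h]
    · exact h.trans (sq_nonneg _)
  have hb2 : θ / lmin = (√θ / √lmin) ^ 2 := by
    rw [div_pow, Real.sq_sqrt hθ, Real.sq_sqrt hl.le]
  have h1 : z ⬝ᵥ z ≤ n * (Λ / lmin) * (X * Real.exp (-(lam / 2) * t)) ^ 2 + θ / lmin := by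
    have h2 := hz.trans hE
    rw [mul_comm, ← le_div_iff₀ hl] at h2
    refine h2.trans (le_of_eq ?_)
    rw [hexp]
    field_simp
  have h3 := mul_le_mul_of_nonneg_right ha2 (sq_nonneg (X * Real.exp (-(lam / 2) * t)))
  have hnn : 0 ≤ a * X * Real.exp (-(lam / 2) * t) := by positivity
  have hnn' : 0 ≤ √θ / √lmin := by positivity
  refine le_of_sq_le_sq ?_ (by positivity)
  have h4 := norm_sq_le_dot z
  rw [hb2] at h1
  nlinarith [mul_nonneg hnn hnn']

theorem norm_errors_le (hS : S.Admissible) {x0 : Fin n → ℝ} {yt : Fin p → ℝ} {ξ : Fin n → ℝ}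
    {t θ : ℝ} (hθ : 0 ≤ θ)
    (h : S.predictionEnergy yt ξ ≤ Real.exp (-S.lam1 * t) *
      S.predictionEnergy 0 ((1 - S.H * S.Cm) *ᵥ x0) + θ) :
    ‖yt‖ ≤ S.κy * ‖x0‖ * Real.exp (-(S.lam1 / 2) * t) + √θ / √(lamMin S.Py) ∧
    ‖ξ‖ ≤ S.κv * ‖x0‖ * Real.exp (-(S.lam1 / 2) * t) + √θ / √(lamMin S.Pv) := by
  have ly := lamMin_pos hS.p_pos hS.Py_posDef
  have lv := lamMin_pos hS.n_pos hS.Pv_posDef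
  have h1 := lamMin_mul_dot_le hS.Py_posDef.isHermitian yt
  have h2 := lamMin_mul_dot_le hS.Pv_posDef.isHermitian ξ
  have h3 := mul_nonneg ly.le (dot_self_nonneg yt)
  have h4 := mul_nonneg lv.le (dot_self_nonneg ξ)
  have h5 := mul_le_mul_of_nonneg_left (hS.predictionEnergy_init_le x0)
    (Real.exp_pos (-S.lam1 * t)).le
  have hE := h.trans (add_le_add_left h5 θ)
  rw [Design.predictionEnergy] at hE
  exact ⟨norm_le_of_energy ly (norm_nonneg _) hθ (by linarith) hE,
    norm_le_of_energy lv (norm_nonneg _) hθ (by linarith) hE⟩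

end Design.Admissible

end L1Control

end

noncomputable section

namespace L1Control

variable {n m p nz mr : ℕ} {S : Design n m p nz mr} {f : (Fin n → ℝ) → ℝ → Fin m → ℝ}
  {c : Signals n m p nz} {K : Gains} {ω : ℝ} {x0 : Fin n → ℝ} {T : EReal}
  {xref : ℝ → Fin n → ℝ} {uref : ℝ → Fin m → ℝ}

namespace Design.Admissible

/-! ### The constants of the design -/

theorem d_le_L (hS : S.Admissible) : S.d S.ρx ≤ S.L S.ρr := by
  have hd := hS.d_pos _ hS.ρx_pos
  have hr := hS.ρr_pos
  have h1 : 1 ≤ (S.ρr + S.γbar) / S.ρr := by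
    rw [one_le_div hr]
    linarith [hS.γbar_pos]
  exact le_mul_of_one_le_left hd.le h1

theorem L_pos (hS : S.Admissible) : 0 < S.L S.ρr := (hS.d_pos _ hS.ρx_pos).trans_le hS.d_le_L

theorem κx_nonneg (S : Design n m p nz mr) (ω : ℝ) : 0 ≤ S.κx ω :=
  add_nonneg (mul_nonneg (l1Norm_nonneg _) (Real.sqrt_nonneg _))
    (mul_nonneg (l1Norm_nonneg _) (Real.sqrt_nonneg _))

theorem ρint_nonneg (hS : S.Admissible) (ω : ℝ) : 0 ≤ S.ρint ω :=
  mul_nonneg (add_nonneg (zero_le_one.trans hS.one_le_κm) (κx_nonneg S ω)) hS.ρ0_pos.le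

theorem ρext_nonneg (hS : S.Admissible) (ω : ℝ) : 0 ≤ S.ρext ω :=
  add_nonneg (mul_nonneg (l1Norm_nonneg _) ENNReal.toReal_nonneg)
    (mul_nonneg (l1Norm_nonneg _) hS.b0_pos.le)

theorem gain_lt (hS : S.Admissible) (hω : ω ∈ S.Cω) :
    l1Norm (S.G ω) * S.L S.ρr * S.ρr < S.ρr - S.ρext ω - S.ρint ω := by
  have h := hS.small_gain ω hω
  rw [lt_div_iff₀ (mul_pos hS.L_pos hS.ρr_pos)] at h
  linarith

theorem q_pos (hS : S.Admissible) (hω : ω ∈ S.Cω) : 0 < 1 - l1Norm (S.G ω) * S.L S.ρr := by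
  have h := hS.gain_lt hω
  have h1 := hS.ρext_nonneg ω
  have h2 := hS.ρint_nonneg ω
  have h3 : l1Norm (S.G ω) * S.L S.ρr * S.ρr < 1 * S.ρr := by linarith
  have := lt_of_mul_lt_mul_right h3 hS.ρr_pos.le
  linarith

theorem reference_gain_lt (hS : S.Admissible) (hω : ω ∈ S.Cω) :
    l1Norm (S.Hr ω) * S.rNorm + l1Norm (S.G ω) * (S.L S.ρr * S.ρrx ω + S.b0) < S.ρrx ω := by
  have h := hS.gain_lt hω
  have hq := hS.q_pos hω
  have e : (1 - l1Norm (S.G ω) * S.L S.ρr) * S.ρrx ω =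
      (1 - l1Norm (S.G ω) * S.L S.ρr) * S.ρr - S.ρint ω := by
    rw [Design.ρrx]
    field_simp
  have e2 : S.ρext ω = l1Norm (S.Hr ω) * S.rNorm + l1Norm (S.G ω) * S.b0 := rfl
  linarith

theorem ρrx_pos (hS : S.Admissible) (hω : ω ∈ S.Cω) : 0 < S.ρrx ω := by
  have h := hS.reference_gain_lt hω
  have hq := hS.q_pos hω
  have h1 := hS.ρext_nonneg ω
  have e2 : S.ρext ω = l1Norm (S.Hr ω) * S.rNorm + l1Norm (S.G ω) * S.b0 := rfl
  have : 0 < (1 - l1Norm (S.G ω) * S.L S.ρr) * S.ρrx ω := by linarith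
  exact pos_of_mul_pos_right this hq.le

theorem ρrx_le (hS : S.Admissible) (hω : ω ∈ S.Cω) : S.ρrx ω ≤ S.ρr :=
  sub_le_self _ (div_nonneg (hS.ρint_nonneg ω) (hS.q_pos hω).le)

theorem ρrx_add (S : Design n m p nz mr) (ω : ℝ) : S.ρrx ω + S.ρdx ω = S.ρx := by
  rw [Design.ρrx, Design.ρdx, Design.ρx, Design.γx0, Design.ρint, add_comm (S.κx ω)]
  ring

theorem γx0_nonneg (hS : S.Admissible) (hω : ω ∈ S.Cω) : 0 ≤ S.γx0 ω :=
  div_nonneg (add_nonneg (κx_nonneg S ω) (zero_le_one.trans hS.one_le_κm)) (hS.q_pos hω).le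

theorem γx_nonneg (hS : S.Admissible) (hω : ω ∈ S.Cω) : 0 ≤ S.γx ω :=
  div_nonneg (add_nonneg (div_nonneg (l1Norm_nonneg _) (Real.sqrt_nonneg _))
    (div_nonneg (l1Norm_nonneg _) (Real.sqrt_nonneg _))) (hS.q_pos hω).le

theorem γu_nonneg (hS : S.Admissible) (hω : ω ∈ S.Cω) : 0 ≤ S.γu ω :=
  add_nonneg (add_nonneg (mul_nonneg (mul_nonneg (l1Norm_nonneg _) hS.L_pos.le)
    (hS.γx_nonneg hω)) (div_nonneg (l1Norm_nonneg _) (Real.sqrt_nonneg _)))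
    (div_nonneg (l1Norm_nonneg _) (Real.sqrt_nonneg _))

theorem γu0_nonneg (hS : S.Admissible) (hω : ω ∈ S.Cω) : 0 ≤ S.γu0 ω :=
  add_nonneg (mul_nonneg (mul_nonneg (l1Norm_nonneg _) hS.L_pos.le) (hS.γx0_nonneg hω))
    (add_nonneg (mul_nonneg (l1Norm_nonneg _) (Real.sqrt_nonneg _))
      (mul_nonneg (l1Norm_nonneg _) (Real.sqrt_nonneg _)))

theorem ρru_nonneg (hS : S.Admissible) (hω : ω ∈ S.Cω) : 0 ≤ S.ρru ω :=
  add_nonneg (mul_nonneg (l1Norm_nonneg _)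
    (add_nonneg (mul_nonneg hS.L_pos.le (hS.ρrx_pos hω).le) hS.b0_pos.le))
    (mul_nonneg (l1Norm_nonneg _) ENNReal.toReal_nonneg)

theorem ρ0_lt (hS : S.Admissible) (hω : ω ∈ S.Cω) : S.ρ0 < S.ρx := by
  have h := hS.gain_lt hω
  have h1 := hS.ρext_nonneg ω
  have h2 : 0 ≤ l1Norm (S.G ω) * S.L S.ρr * S.ρr :=
    mul_nonneg (mul_nonneg (l1Norm_nonneg _) hS.L_pos.le) hS.ρr_pos.le
  have h3 : 1 * S.ρ0 ≤ (S.κm + S.κx ω) * S.ρ0 :=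
    mul_le_mul_of_nonneg_right (by linarith [hS.one_le_κm, κx_nonneg S ω]) hS.ρ0_pos.le
  have h4 : S.ρint ω = (S.κm + S.κx ω) * S.ρ0 := rfl
  have h5 : S.ρx = S.ρr + S.γbar := rfl
  linarith [hS.γbar_pos]

end Design.Admissible

/-! ### The reference system -/

theorem response_zero_right {a b : ℕ} (G : TM a b) (t : ℝ) : response G (fun _ => 0) t = 0 := by
  have := response_smul_right G 0 (fun _ => 0) t
  simpa using this

theorem IsReference.continuousOn (hr : IsReference S ω f xref uref T) {τ : ℝ}
    (hτ : τ ∈ timeDom T) : ContinuousOn xref (Icc 0 τ) := fun t ht =>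
  ((hr.x_ode t (Icc_subset_timeDom hτ ht)).mono fun _ h => h.1).continuousWithinAt

theorem IsReference.state_eq (hr : IsReference S ω f xref uref T) (hS : S.Admissible)
    (hω : ω ∈ S.Cω) (hf : S.Uncertainty f) {t : ℝ} (ht : t ∈ timeDom T) :
    xref t = response (S.G ω) (fun s => f (xref s) s) t + response (S.Hr ω) S.r t := by
  have hsub := Icc_subset_timeDom ht
  have hIci : Icc 0 t ⊆ Ici 0 := fun s hs => hs.1
  have hw : IntOn (fun s => f (xref s) s) t :=
    IntOn.of_continuousOn ht.1 (hf.continuousOn hIci (hr.continuousOn ht))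
  have hz : ∀ k : ℕ, IntOn (fun _ => (0 : Fin k → ℝ)) t := fun k =>
    IntOn.of_continuousOn ht.1 continuousOn_const
  have hu : IntOn uref t :=
    ((((hS.intOn_r ht.1).mulVec S.Kg).sub hw).response ht.1 (S.C0 ω)).congr ht.1
      fun s hs => (hr.u_law s (hsub hs)).symm
  have := hS.state_eq hω ht.1 hw hu (hz p) (hz n)
    (fun s hs => (hr.x_ode s (hsub hs)).mono hIci) (fun s hs => by
      rw [response_zero_right, response_zero_right, sub_zero, add_zero]
      exact hr.u_law s (hsub hs))
  rwa [hr.x_init, Matrix.mulVec_zero, response_zero_right, response_zero_right, sub_zero, add_zero,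
    zero_add] at this

theorem Design.Uncertainty.norm_le_L (hf : S.Uncertainty f) (hS : S.Admissible)
    {x : Fin n → ℝ} (hx : ‖x‖ ≤ S.ρx) {t : ℝ} (ht : 0 ≤ t) :
    ‖f x t‖ ≤ S.L S.ρr * ‖x‖ + S.b0 :=
  (hf.norm_le hS.ρx_pos hx ht).trans
    (add_le_add_left (mul_le_mul_of_nonneg_right hS.d_le_L (norm_nonneg _)) _)

theorem Design.Uncertainty.norm_sub_le_L (hf : S.Uncertainty f) (hS : S.Admissible)
    {x z : Fin n → ℝ} (hx : ‖x‖ ≤ S.ρx) (hz : ‖z‖ ≤ S.ρx) {t : ℝ} (ht : 0 ≤ t) :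
    ‖f x t - f z t‖ ≤ S.L S.ρr * ‖x - z‖ :=
  (hf.norm_sub_le hS.ρx_pos hx hz ht).trans
    (mul_le_mul_of_nonneg_right hS.d_le_L (norm_nonneg _))

theorem IsReference.norm_state_lt (hr : IsReference S ω f xref uref T) (hS : S.Admissible)
    (hω : ω ∈ S.Cω) (hf : S.Uncertainty f) {t : ℝ} (ht : t ∈ timeDom T) :
    ‖xref t‖ < S.ρrx ω := by
  have hsub := Icc_subset_timeDom ht
  refine lt_of_first_exit (φ := fun s => ‖xref s‖) (hr.continuousOn ht).norm ?_ ?_ t ⟨ht.1, le_rfl⟩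
  · rw [hr.x_init, norm_zero]
    exact hS.ρrx_pos hω
  · intro s hs _ hb
    refine lt_of_le_of_lt ?_ (hS.reference_gain_lt hω)
    rw [hr.state_eq hS hω hf (hsub hs), add_comm]
    refine norm_add_le_of_le (norm_response_le_of_ae (hS.strict_Hr hω) (hS.stable_Hr hω)
      ENNReal.toReal_nonneg hs.1 (hS.ae_norm_r_le s)) (norm_response_le_const
      (hS.strict_G hω).proper (hS.stable_G hω) hs.1 fun r hr' => ?_)
    have h1 : ‖xref r‖ ≤ S.ρrx ω := hb r hr'
    have h2 : S.ρr ≤ S.ρx := le_add_of_nonneg_right hS.γbar_pos.le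
    exact (hf.norm_le_L hS ((h1.trans (hS.ρrx_le hω)).trans h2) hr'.1).trans
      (add_le_add_left (mul_le_mul_of_nonneg_left h1 hS.L_pos.le) _)

theorem IsReference.norm_state_le (hr : IsReference S ω f xref uref T) (hS : S.Admissible)
    (hω : ω ∈ S.Cω) (hf : S.Uncertainty f) {t : ℝ} (ht : t ∈ timeDom T) : ‖xref t‖ ≤ S.ρx :=
  ((hr.norm_state_lt hS hω hf ht).le.trans (hS.ρrx_le hω)).trans
    (le_add_of_nonneg_right hS.γbar_pos.le)

theorem IsReference.norm_input_le (hr : IsReference S ω f xref uref T) (hS : S.Admissible)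
    (hω : ω ∈ S.Cω) (hf : S.Uncertainty f) {t : ℝ} (ht : t ∈ timeDom T) :
    ‖uref t‖ ≤ S.ρru ω := by
  have hsub := Icc_subset_timeDom ht
  have hC := hS.strict_C0 hω
  have hw : IntOn (fun s => f (xref s) s) t :=
    IntOn.of_continuousOn ht.1 (hf.continuousOn (fun s hs => hs.1) (hr.continuousOn ht))
  have hi := hS.intOn_r ht.1
  rw [hr.u_law t ht, response_sub_right _ (hi.mulVec S.Kg) hw,
    ← response_mul_const hC.proper S.Kg ht.1 hi, Design.ρru, add_comm]
  refine norm_sub_le_of_le (norm_response_le_of_ae (hC.mul_proper (proper_const _))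
    ((hS.stable_C0 hω).mul (stable_const _)) ENNReal.toReal_nonneg ht.1 (hS.ae_norm_r_le t))
    (norm_response_le_const hC.proper (hS.stable_C0 hω) ht.1 fun s hs => ?_)
  exact (hf.norm_le_L hS (hr.norm_state_le hS hω hf (hsub hs)) hs.1).trans (add_le_add_left
    (mul_le_mul_of_nonneg_left (hr.norm_state_lt hS hω hf (hsub hs)).le hS.L_pos.le) _)

/-! ### The distance to the reference system -/

/-- While state and input are within their bounds, the closed loop differs from the reference
system by the responses to the initial state and to decaying prediction errors. -/
theorem Signals.IsClosedLoop.exists_difference (hc : c.IsClosedLoop S K ω f x0 T)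
    (hr : IsReference S ω f xref uref T) (hS : S.Admissible) (hω : ω ∈ S.Cω)
    (hf : S.Uncertainty f) {lθ lσ : ℝ} (hlθ : 0 ≤ lθ) (hlσ : 0 ≤ lσ)
    (hRB : S.RateBounds ω f lθ lσ) (hK : K.Admissible S lθ lσ) {τ : ℝ} (hτ0 : 0 < τ)
    (hτ : τ ∈ timeDom T) (hb : ∀ t ∈ Icc 0 τ, ‖c.x t‖ ≤ S.ρx ∧ ‖c.u t‖ ≤ S.ρu ω) :
    ∃ (yt : ℝ → Fin p → ℝ) (ξ : ℝ → Fin n → ℝ),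
      (∀ t ∈ Icc 0 τ,
        ‖yt t‖ ≤ S.κy * ‖x0‖ * Real.exp (-(S.lam1 / 2) * t) +
          √(S.θ1 lθ lσ / K.Γ) / √(lamMin S.Py) ∧
        ‖ξ t‖ ≤ S.κv * ‖x0‖ * Real.exp (-(S.lam1 / 2) * t) +
          √(S.θ1 lθ lσ / K.Γ) / √(lamMin S.Pv)) ∧
      (∀ t ∈ Icc 0 τ, xref t - c.x t -
        response (S.G ω) (fun s => f (xref s) s - f (c.x s) s) t =
          response (S.H1 ω) yt t - response (S.H2 ω) ξ t - NormedSpace.exp (t • S.Am) *ᵥ x0) ∧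
      ∀ t ∈ Icc 0 τ, uref t - c.u t = response (S.C1 ω) yt t - response (S.C2 ω) ξ t -
        response (S.C0 ω) (fun s => f (xref s) s - f (c.x s) s) t := by
  obtain ⟨ξ, hu, hx, hE⟩ := hc.exists_errors hS hω hf hτ0 hτ
  have hsub := Icc_subset_timeDom hτ
  have hIci : Icc 0 τ ⊆ Ici 0 := fun s hs => hs.1
  have hΓ : 0 < K.Γ := lt_min hK.Γω_pos (lt_min hK.Γθ_pos hK.Γσ_pos)
  have cx : ContinuousOn c.x (Icc 0 τ) := fun t ht =>
    ((hc.x_ode t (hsub ht)).mono hIci).continuousWithinAt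
  have cw := hf.continuousOn hIci cx
  have cr := hf.continuousOn hIci (hr.continuousOn hτ)
  have int : ∀ {a : ℕ} {g : ℝ → Fin a → ℝ}, ContinuousOn g (Icc 0 τ) → ∀ t ∈ Icc 0 τ, IntOn g t :=
    fun hg t ht => IntOn.of_continuousOn ht.1 (hg.mono (Icc_subset_Icc_right ht.2))
  refine ⟨c.ytil S, ξ, fun t ht => hS.norm_errors_le
    (div_nonneg (hS.θ1_pos hlθ hlσ).le hΓ.le) (hE lθ lσ hlθ hlσ hRB hK hb t ht), fun t ht => ?_,
    fun t ht => ?_⟩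
  · rw [hr.state_eq hS hω hf (hsub ht), hx t ht,
      response_sub_right _ (int cr t ht) (int cw t ht)]
    abel
  · have hi := (hS.intOn_r ht.1).mulVec S.Kg
    rw [hr.u_law t (hsub ht), hu t ht, response_sub_right _ (int cr t ht) (int cw t ht),
      response_sub_right _ hi (int cr t ht), response_sub_right _ hi (int cw t ht)]
    abel

end L1Control

end

noncomputable section

namespace L1Control

variable {n m p nz mr : ℕ} {S : Design n m p nz mr} {f : (Fin n → ℝ) → ℝ → Fin m → ℝ}
  {c : Signals n m p nz} {K : Gains} {ω : ℝ} {x0 : Fin n → ℝ} {T : EReal}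
  {xref : ℝ → Fin n → ℝ} {uref : ℝ → Fin m → ℝ} {lθ lσ : ℝ}

theorem Gains.Admissible.Γ_pos (hK : K.Admissible S lθ lσ) : 0 < K.Γ :=
  lt_min hK.Γω_pos (lt_min hK.Γθ_pos hK.Γσ_pos)

theorem Gains.Admissible.sqrt_lt (hK : K.Admissible S lθ lσ) (hS : S.Admissible) :
    √(S.θ1 lθ lσ / K.Γ) < S.εγ := by
  have hε := hS.εγ_pos
  rw [Real.sqrt_lt' hε, div_lt_iff₀ hK.Γ_pos, mul_comm, ← div_lt_iff₀ (pow_pos hε 2)]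
  exact hK.large

theorem Signals.IsClosedLoop.continuousOn (hc : c.IsClosedLoop S K ω f x0 T) {τ : ℝ}
    (hτ : τ ∈ timeDom T) : ContinuousOn c.x (Icc 0 τ) := fun t ht =>
  ((hc.x_ode t (Icc_subset_timeDom hτ ht)).mono fun _ h => h.1).continuousWithinAt

/-- Uniform bounds on the distance to the reference system. -/
theorem Signals.IsClosedLoop.norm_difference_le (hc : c.IsClosedLoop S K ω f x0 T)
    (hr : IsReference S ω f xref uref T) (hS : S.Admissible) (hω : ω ∈ S.Cω)
    (hf : S.Uncertainty f) (hlθ : 0 ≤ lθ) (hlσ : 0 ≤ lσ)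
    (hRB : S.RateBounds ω f lθ lσ) (hK : K.Admissible S lθ lσ) {τ : ℝ} (hτ0 : 0 < τ)
    (hτ : τ ∈ timeDom T) (hb : ∀ t ∈ Icc 0 τ, ‖c.x t‖ ≤ S.ρx ∧ ‖c.u t‖ ≤ S.ρu ω) :
    ∀ t ∈ Icc 0 τ, ‖xref t - c.x t‖ ≤ S.γx0 ω * ‖x0‖ + S.γx ω * √(S.θ1 lθ lσ / K.Γ) ∧
      ‖uref t - c.u t‖ ≤ S.γu0 ω * ‖x0‖ + S.γu ω * √(S.θ1 lθ lσ / K.Γ) := by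
  obtain ⟨yt, ξ, hyξ, hx, hu⟩ := hc.exists_difference hr hS hω hf hlθ hlσ hRB hK hτ0 hτ hb
  have hsub := Icc_subset_timeDom hτ
  set ε := √(S.θ1 lθ lσ / K.Γ)
  have hε : 0 ≤ ε := Real.sqrt_nonneg _
  have hq := hS.q_pos hω
  have hL := hS.L_pos
  have hexp : ∀ t ∈ Icc 0 τ, Real.exp (-(S.lam1 / 2) * t) ≤ 1 := fun t ht =>
    Real.exp_le_one_iff.2 (by nlinarith [ht.1, hS.lam1_pos])
  have hκy : 0 ≤ S.κy * ‖x0‖ := mul_nonneg (Real.sqrt_nonneg _) (norm_nonneg _)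
  have hκv : 0 ≤ S.κv * ‖x0‖ := mul_nonneg (Real.sqrt_nonneg _) (norm_nonneg _)
  have byt : ∀ t ∈ Icc 0 τ, ‖yt t‖ ≤ S.κy * ‖x0‖ + ε / √(lamMin S.Py) := fun t ht =>
    (hyξ t ht).1.trans (add_le_add_left (mul_le_of_le_one_right hκy (hexp t ht)) _)
  have bξ : ∀ t ∈ Icc 0 τ, ‖ξ t‖ ≤ S.κv * ‖x0‖ + ε / √(lamMin S.Pv) := fun t ht =>
    (hyξ t ht).2.trans (add_le_add_left (mul_le_of_le_one_right hκv (hexp t ht)) _)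
  have resp : ∀ {a b : ℕ} {F : TM a b} {v : ℝ → Fin b → ℝ} {B : ℝ}, Proper F → Stable F →
      (∀ t ∈ Icc 0 τ, ‖v t‖ ≤ B) → ∀ t ∈ Icc 0 τ, ‖response F v t‖ ≤ l1Norm F * B :=
    fun hp hs hv t ht => norm_response_le_const hp hs ht.1 fun s hs' =>
      hv s ⟨hs'.1, hs'.2.trans ht.2⟩
  have hw : ∀ t ∈ Icc 0 τ, ‖f (xref t) t - f (c.x t) t‖ ≤ S.L S.ρr * ‖xref t - c.x t‖ :=
    fun t ht => hf.norm_sub_le_L hS (hr.norm_state_le hS hω hf (hsub ht)) (hb t ht).1 ht.1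
  have hA : 0 ≤ S.γx0 ω * ‖x0‖ := mul_nonneg (hS.γx0_nonneg hω) (norm_nonneg _)
  have hB : 0 ≤ S.γx ω * ε := mul_nonneg (hS.γx_nonneg hω) hε
  have hδ : ∀ t ∈ Icc 0 τ, ‖xref t - c.x t‖ ≤ S.γx0 ω * ‖x0‖ + S.γx ω * ε := by
    have key := norm_le_of_small_gain (G := S.G ω) (μ := 0) (L := S.L S.ρr)
      (ρ := l1Norm (S.G ω) * S.L S.ρr) (A := S.γx0 ω * ‖x0‖) (B := S.γx ω * ε) (τ := τ)
      (fun i j => weightIntegrable_zero ((hS.strict_G hω).proper i j) (hS.stable_G hω i j))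
      (hS.strict_G hω).proper (hS.stable_G hω) hL.le (by rw [← l1Norm_eq, mul_comm])
      (by rw [mul_comm]) (by linarith) hA hB
      (δ := fun t => xref t - c.x t) ((hr.continuousOn hτ).sub (hc.continuousOn hτ)) hw
      (fun t ht => ?_)
    · simpa using key
    · rw [hx t ht]
      refine (norm_sub_le_of_le (norm_sub_le_of_le
        (resp (hS.strict_H1 hω).proper (hS.stable_H1 hω) byt t ht)
        (resp (hS.strict_H2 hω).proper (hS.stable_H2 hω) bξ t ht))
        ((norm_mulVec_le _ _).trans (mul_le_mul_of_nonneg_right (hS.infNorm_exp_le_κm ht.1)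
          (norm_nonneg _)))).trans (le_of_eq ?_)
      have g1 : (1 - l1Norm (S.G ω) * S.L S.ρr) * S.γx0 ω = S.κx ω + S.κm :=
        mul_div_cancel₀ _ hq.ne'
      have g2 : (1 - l1Norm (S.G ω) * S.L S.ρr) * S.γx ω =
          l1Norm (S.H1 ω) / √(lamMin S.Py) + l1Norm (S.H2 ω) / √(lamMin S.Pv) :=
        mul_div_cancel₀ _ hq.ne'
      have g3 : S.κx ω = l1Norm (S.H1 ω) * S.κy + l1Norm (S.H2 ω) * S.κv := rfl
      rw [neg_zero, zero_mul, Real.exp_zero, mul_one]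
      linear_combination -‖x0‖ * g1 - ε * g2 - ‖x0‖ * g3
  intro t ht
  refine ⟨hδ t ht, ?_⟩
  rw [hu t ht]
  refine (norm_sub_le_of_le (norm_sub_le_of_le
    (resp (hS.proper_C1 hω) (hS.stable_C1 hω) byt t ht)
    (resp (hS.strict_C2 hω).proper (hS.stable_C2 hω) bξ t ht))
    (resp (hS.strict_C0 hω).proper (hS.stable_C0 hω) (fun s hs => (hw s hs).trans
      (mul_le_mul_of_nonneg_left (hδ s hs) hL.le)) t ht)).trans (le_of_eq ?_)
  rw [Design.γu0, Design.γu]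
  ring

/-- State and input of the closed loop never leave the region of validity of the estimates. -/
theorem Signals.IsClosedLoop.norm_le (hc : c.IsClosedLoop S K ω f x0 T)
    (hr : IsReference S ω f xref uref T) (hS : S.Admissible) (hω : ω ∈ S.Cω)
    (hf : S.Uncertainty f) (hlθ : 0 ≤ lθ) (hlσ : 0 ≤ lσ)
    (hRB : S.RateBounds ω f lθ lσ) (hK : K.Admissible S lθ lσ) (hx0 : ‖x0‖ ≤ S.ρ0) :
    ∀ t ∈ timeDom T, ‖c.x t‖ ≤ S.ρx ∧ ‖c.u t‖ ≤ S.ρu ω := by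
  intro τ hτ
  have hsub := Icc_subset_timeDom hτ
  have hρdu : 0 < S.ρdu ω :=
    add_pos_of_nonneg_of_pos (mul_nonneg (hS.γu0_nonneg hω) hS.ρ0_pos.le) hS.γbar_pos
  have key : ∀ t ∈ Icc 0 τ, max (‖c.x t‖ - S.ρx) (‖c.u t‖ - S.ρu ω) < 0 := by
    refine lt_of_first_exit (φ := fun t => max (‖c.x t‖ - S.ρx) (‖c.u t‖ - S.ρu ω))
      (((hc.continuousOn hτ).norm.sub continuousOn_const).sup
        ((hc.u_cont.mono hsub).norm.sub continuousOn_const)) ?_ ?_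
    · have hu0 : c.u 0 = 0 := by
        rw [hc.u_law 0 ⟨le_rfl, (EReal.coe_le_coe_iff.2 hτ.1).trans_lt hτ.2⟩, neg_eq_zero]
        funext i
        simp [response, markov_zero_of_strict (hS.strict_D_mul_Z_inv hω i _)]
      rw [hc.x_init, hu0, norm_zero, max_lt_iff]
      have h1 := hS.ρ0_lt hω
      have h2 := hS.ρru_nonneg hω
      have h3 : S.ρu ω = S.ρru ω + S.ρdu ω := rfl
      constructor <;> linarith
    · intro t ht ht0 hle
      have hb : ∀ s ∈ Icc 0 t, ‖c.x s‖ ≤ S.ρx ∧ ‖c.u s‖ ≤ S.ρu ω := fun s hs =>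
        ⟨sub_nonpos.1 ((le_max_left _ _).trans (hle s hs)),
          sub_nonpos.1 ((le_max_right _ _).trans (hle s hs))⟩
      obtain ⟨h1, h2⟩ := hc.norm_difference_le hr hS hω hf hlθ hlσ hRB hK ht0 (hsub ht) hb t
        ⟨ht.1, le_rfl⟩
      have h3 := hr.norm_state_lt hS hω hf (hsub ht)
      have h4 := hr.norm_input_le hS hω hf (hsub ht)
      have h5 := norm_sub_le (xref t) (xref t - c.x t)
      have h6 := norm_sub_le (uref t) (uref t - c.u t)
      rw [sub_sub_cancel] at h5 h6
      have h7 := mul_le_mul_of_nonneg_left (hK.sqrt_lt hS).le (hS.γx_nonneg hω)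
      have h8 := mul_le_mul_of_nonneg_left (hK.sqrt_lt hS).le (hS.γu_nonneg hω)
      have h9 := mul_le_mul_of_nonneg_left hx0 (hS.γx0_nonneg hω)
      have h10 := mul_le_mul_of_nonneg_left hx0 (hS.γu0_nonneg hω)
      have h11 := hS.εγ_x ω hω
      have h12 := hS.εγ_u ω hω
      have h13 := Design.Admissible.ρrx_add S ω
      have h14 : S.ρdx ω = S.γx0 ω * S.ρ0 + S.γbar := rfl
      have h15 : S.ρdu ω = S.γu0 ω * S.ρ0 + S.γbar := rfl
      have h16 : S.ρu ω = S.ρru ω + S.ρdu ω := rfl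
      rw [max_lt_iff]
      constructor <;> linarith
  have h := max_lt_iff.1 (key τ ⟨hτ.1, le_rfl⟩)
  exact ⟨(sub_neg.1 h.1).le, (sub_neg.1 h.2).le⟩

/-- A common decay rate for the transfer matrices and the matrix exponential. -/
theorem Design.Admissible.exists_decay_rate (hS : S.Admissible) (hω : ω ∈ S.Cω) :
    ∃ μ CA ρ : ℝ, 0 < μ ∧ μ ≤ S.lam1 / 2 ∧ 0 ≤ CA ∧ ρ < 1 ∧
      (∀ t, 0 ≤ t → infNorm (NormedSpace.exp (t • S.Am)) ≤ CA * Real.exp (-μ * t)) ∧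
      S.L S.ρr * weightedL1 μ (S.G ω) ≤ ρ ∧ S.L S.ρr * l1Norm (S.G ω) ≤ ρ ∧
      (∀ i j, WeightIntegrable μ (S.G ω i j)) ∧ (∀ i j, WeightIntegrable μ (S.H1 ω i j)) ∧
      ∀ i j, WeightIntegrable μ (S.H2 ω i j) := by
  have hL := hS.L_pos
  have hq := hS.q_pos hω
  have hg := l1Norm_nonneg (S.G ω)
  obtain ⟨CA, β, hCA, hβ, hexp⟩ := exists_infNorm_exp_le hS.hurwitz_Am
  obtain ⟨r, hr1, hr2⟩ := exists_between (show l1Norm (S.G ω) < 1 / S.L S.ρr by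
    rw [lt_div_iff₀ hL]; linarith)
  have hr3 : S.L S.ρr * r < 1 := by
    rw [lt_div_iff₀ hL] at hr2
    linarith
  have hl := hS.lam1_pos
  have e1 := eventually_weightedL1_lt (hS.strict_G hω).proper (hS.stable_G hω)
    (hg.trans_lt hr1) hr1
  have e2 := eventually_weightIntegrable_matrix (hS.strict_G hω).proper (hS.stable_G hω)
  have e3 := eventually_weightIntegrable_matrix (hS.strict_H1 hω).proper (hS.stable_H1 hω)
  have e4 := eventually_weightIntegrable_matrix (hS.strict_H2 hω).proper (hS.stable_H2 hω)
  have e5 : ∀ᶠ μ in 𝓝[>] (0 : ℝ), μ ∈ Ioo 0 (min (S.lam1 / 2) β) :=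
    Ioo_mem_nhdsGT (lt_min (by linarith) hβ)
  obtain ⟨μ, h1, h2, h3, h4, h5⟩ := (e1.and (e2.and (e3.and (e4.and e5)))).exists
  refine ⟨μ, CA, S.L S.ρr * r, h5.1, h5.2.le.trans (min_le_left _ _), hCA, hr3, fun t ht => ?_,
    mul_le_mul_of_nonneg_left h1.le hL.le, mul_le_mul_of_nonneg_left hr1.le hL.le, h2, h3, h4⟩
  refine (hexp t ht).trans (mul_le_mul_of_nonneg_left (Real.exp_le_exp.2 ?_) hCA)
  have := h5.2.le.trans (min_le_right _ _)
  nlinarith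

/-- The distance to the reference system decays, up to a term of order `1 / √Γ`. -/
theorem Design.Admissible.exists_decay_bound (hS : S.Admissible) (hω : ω ∈ S.Cω)
    (hlθ : 0 ≤ lθ) (hlσ : 0 ≤ lσ) :
    ∃ μ a b : ℝ, 0 < μ ∧ 0 ≤ a ∧ 0 ≤ b ∧
      ∀ f : (Fin n → ℝ) → ℝ → Fin m → ℝ, S.Uncertainty f → S.RateBounds ω f lθ lσ →
      ∀ K : Gains, K.Admissible S lθ lσ → ∀ x0 : Fin n → ℝ, ‖x0‖ ≤ S.ρ0 →
      ∀ (T : EReal) (c : Signals n m p nz), c.IsClosedLoop S K ω f x0 T →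
      ∀ (xref : ℝ → Fin n → ℝ) (uref : ℝ → Fin m → ℝ), IsReference S ω f xref uref T →
      ∀ t ∈ timeDom T, ‖xref t - c.x t‖ ≤ a * Real.exp (-μ * t) * ‖x0‖ + b / √K.Γ := by
  obtain ⟨μ, CA, ρ, hμ, hμl, hCA, hρ, hexp, hρμ, hρ0, iG, i1, i2⟩ := hS.exists_decay_rate hω
  have hq : 0 < 1 - ρ := by linarith
  have hL := hS.L_pos
  have hκy : 0 ≤ S.κy := Real.sqrt_nonneg _
  have hκv : 0 ≤ S.κv := Real.sqrt_nonneg _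
  obtain ⟨a, ha⟩ : ∃ a, a = weightedL1 μ (S.H1 ω) * S.κy + weightedL1 μ (S.H2 ω) * S.κv + CA :=
    ⟨_, rfl⟩
  obtain ⟨b, hb⟩ : ∃ b, b = l1Norm (S.H1 ω) / √(lamMin S.Py) + l1Norm (S.H2 ω) / √(lamMin S.Pv) :=
    ⟨_, rfl⟩
  have ha0 : 0 ≤ a := ha ▸ add_nonneg (add_nonneg (mul_nonneg (weightedL1_nonneg _ _) hκy)
    (mul_nonneg (weightedL1_nonneg _ _) hκv)) hCA
  have hb0 : 0 ≤ b := hb ▸ add_nonneg (div_nonneg (l1Norm_nonneg _) (Real.sqrt_nonneg _))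
    (div_nonneg (l1Norm_nonneg _) (Real.sqrt_nonneg _))
  refine ⟨μ, a / (1 - ρ), b / (1 - ρ) * √(S.θ1 lθ lσ), hμ, by positivity, by positivity, ?_⟩
  intro f hf hRB K hK x0 hx0 T c hc xref uref hr t ht
  obtain ⟨τ, hτ, hlt⟩ := exists_gt_mem_timeDom ht
  have hsub := Icc_subset_timeDom hτ
  have hbd := hc.norm_le hr hS hω hf hlθ hlσ hRB hK hx0
  obtain ⟨yt, ξ, hyξ, hx, -⟩ := hc.exists_difference hr hS hω hf hlθ hlσ hRB hK
    (ht.1.trans_lt hlt) hτ fun s hs => hbd s (hsub hs)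
  have hεe : √(S.θ1 lθ lσ / K.Γ) = √(S.θ1 lθ lσ) / √K.Γ :=
    Real.sqrt_div (hS.θ1_pos hlθ hlσ).le _
  obtain ⟨ε, hε⟩ : ∃ ε, ε = √(S.θ1 lθ lσ / K.Γ) := ⟨_, rfl⟩
  have hε0 : 0 ≤ ε := hε ▸ Real.sqrt_nonneg _
  rw [← hε] at hyξ
  have hmono : ∀ s ∈ Icc 0 τ, Real.exp (-(S.lam1 / 2) * s) ≤ Real.exp (-μ * s) := fun s hs =>
    Real.exp_le_exp.2 (by nlinarith [hs.1])
  have hyx : 0 ≤ S.κy * ‖x0‖ := mul_nonneg hκy (norm_nonneg _)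
  have hvx : 0 ≤ S.κv * ‖x0‖ := mul_nonneg hκv (norm_nonneg _)
  have hεy : 0 ≤ ε / √(lamMin S.Py) := div_nonneg hε0 (Real.sqrt_nonneg _)
  have hεv : 0 ≤ ε / √(lamMin S.Pv) := div_nonneg hε0 (Real.sqrt_nonneg _)
  have key := norm_le_of_small_gain (A := a / (1 - ρ) * ‖x0‖) (B := b / (1 - ρ) * ε) iG
    (hS.strict_G hω).proper (hS.stable_G hω) hL.le hρμ hρ0 hρ
    (by positivity) (by positivity) (δ := fun t => xref t - c.x t)
    ((hr.continuousOn hτ).sub (hc.continuousOn hτ))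
    (fun s hs => hf.norm_sub_le_L hS (hr.norm_state_le hS hω hf (hsub hs))
      (hbd s (hsub hs)).1 hs.1) (fun s hs => ?_) t ⟨ht.1, hlt.le⟩
  · refine key.trans (le_of_eq ?_)
    rw [hε, hεe]
    ring
  · rw [hx s hs]
    have hr' : ∀ r ∈ Icc 0 s, r ∈ Icc 0 τ := fun r hr => ⟨hr.1, hr.2.trans hs.2⟩
    refine (norm_sub_le_of_le (norm_sub_le_of_le
      (norm_response_le_on i1 (hS.strict_H1 hω).proper (hS.stable_H1 hω) hyx hεy hs.1
        fun r hr => (hyξ r (hr' r hr)).1.trans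
          (add_le_add_left (mul_le_mul_of_nonneg_left (hmono r (hr' r hr)) hyx) _))
      (norm_response_le_on i2 (hS.strict_H2 hω).proper (hS.stable_H2 hω) hvx hεv hs.1
        fun r hr => (hyξ r (hr' r hr)).2.trans
          (add_le_add_left (mul_le_mul_of_nonneg_left (hmono r (hr' r hr)) hvx) _)))
      ((norm_mulVec_le _ _).trans (mul_le_mul_of_nonneg_right (hexp s hs.1)
        (norm_nonneg x0)))).trans (le_of_eq ?_)
    have e1 : (1 - ρ) * (a / (1 - ρ) * ‖x0‖ * Real.exp (-μ * s) + b / (1 - ρ) * ε) =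
        a * ‖x0‖ * Real.exp (-μ * s) + b * ε := by
      field_simp
    rw [e1, ha, hb]
    ring

theorem strictAntiOn_exp {a μ : ℝ} (ha : 0 < a) (hμ : 0 < μ) :
    StrictAntiOn (fun t : ℝ => a * Real.exp (-μ * t)) (Ici 0) := fun s _ t _ hst =>
  mul_lt_mul_of_pos_left (Real.exp_lt_exp.2 (by nlinarith)) ha

theorem tendsto_exp_zero (a : ℝ) {μ : ℝ} (hμ : 0 < μ) :
    Tendsto (fun t : ℝ => a * Real.exp (-μ * t)) atTop (𝓝 0) := by
  have h : Tendsto (fun t : ℝ => -μ * t) atTop atBot := tendsto_id.const_mul_atTop_of_neg (by linarith)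
  simpa using (Real.tendsto_exp_atBot.comp h).const_mul a

end L1Control

end

theorem theorem2 {n m p nz mr : ℕ} (S : L1Control.Design n m p nz mr) (hS : S.Admissible)
    (ω : ℝ) (hω : ω ∈ S.Cω) :
    (∃ lθ lσ : ℝ, 0 ≤ lθ ∧ 0 ≤ lσ ∧ ∀ f, S.Uncertainty f → S.RateBounds ω f lθ lσ) ∧
    ∀ lθ lσ : ℝ, 0 ≤ lθ → 0 ≤ lσ →
      ∃ (γdx γdy : ℝ) (vdx vdy : ℝ → ℝ), 0 < γdx ∧ 0 < γdy ∧
        StrictAntiOn vdx (Set.Ici 0) ∧ StrictAntiOn vdy (Set.Ici 0) ∧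
        Filter.Tendsto vdx Filter.atTop (nhds 0) ∧ Filter.Tendsto vdy Filter.atTop (nhds 0) ∧
        ∀ f : (Fin n → ℝ) → ℝ → Fin m → ℝ, S.Uncertainty f → S.RateBounds ω f lθ lσ →
        ∀ K : L1Control.Gains, K.Admissible S lθ lσ →
        ∀ x0 : Fin n → ℝ, ‖x0‖ ≤ S.ρ0 →
        ∀ (T : EReal) (c : L1Control.Signals n m p nz), c.IsClosedLoop S K ω f x0 T →
        ∀ (xref : ℝ → Fin n → ℝ) (uref : ℝ → Fin m → ℝ),
          L1Control.IsReference S ω f xref uref T →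
        ∀ t ∈ L1Control.timeDom T,
          ‖xref t - c.x t‖ ≤ S.ρdx ω ∧ ‖uref t - c.u t‖ ≤ S.ρdu ω ∧
          ‖S.Cm *ᵥ xref t - c.y S t‖ ≤ L1Control.infNorm S.Cm * S.ρdx ω ∧
          ‖c.x t‖ ≤ S.ρx ∧ ‖c.u t‖ ≤ S.ρu ω ∧
          ‖xref t - c.x t‖ ≤ vdx t * ‖x0‖ + γdx / √K.Γ ∧
          ‖S.Cm *ᵥ xref t - c.y S t‖ ≤ vdy t * ‖x0‖ + γdy / √K.Γ := by
  refine ⟨hS.exists_rateBounds hω, fun lθ lσ hlθ hlσ => ?_⟩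
  obtain ⟨μ, a, b, hμ, ha, hb, hdecay⟩ := hS.exists_decay_bound hω hlθ hlσ
  have hC := L1Control.infNorm_nonneg S.Cm
  set k := L1Control.infNorm S.Cm
  refine ⟨b + 1, k * (b + 1) + 1, fun t => (a + 1) * Real.exp (-μ * t),
    fun t => ((k + 1) * (a + 1)) * Real.exp (-μ * t), by positivity, by positivity,
    L1Control.strictAntiOn_exp (by positivity) hμ, L1Control.strictAntiOn_exp (by positivity) hμ,
    L1Control.tendsto_exp_zero _ hμ, L1Control.tendsto_exp_zero _ hμ, ?_⟩
  intro f hf hRB K hK x0 hx0 T c hc xref uref hr t ht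
  have hbd := hc.norm_le hr hS hω hf hlθ hlσ hRB hK hx0
  obtain ⟨τ, hτ, hlt⟩ := L1Control.exists_gt_mem_timeDom ht
  obtain ⟨h1, h2⟩ := hc.norm_difference_le hr hS hω hf hlθ hlσ hRB hK (ht.1.trans_lt hlt) hτ
    (fun s hs => hbd s (L1Control.Icc_subset_timeDom hτ hs)) t ⟨ht.1, hlt.le⟩
  have hΓ := Real.sqrt_pos.2 hK.Γ_pos
  have hx : ‖xref t - c.x t‖ ≤ S.ρdx ω := by
    have e1 := mul_le_mul_of_nonneg_left hx0 (hS.γx0_nonneg hω)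
    have e2 := mul_le_mul_of_nonneg_left (hK.sqrt_lt hS).le (hS.γx_nonneg hω)
    have e3 := hS.εγ_x ω hω
    have e4 : S.ρdx ω = S.γx0 ω * S.ρ0 + S.γbar := rfl
    linarith
  have hu : ‖uref t - c.u t‖ ≤ S.ρdu ω := by
    have e1 := mul_le_mul_of_nonneg_left hx0 (hS.γu0_nonneg hω)
    have e2 := mul_le_mul_of_nonneg_left (hK.sqrt_lt hS).le (hS.γu_nonneg hω)
    have e3 := hS.εγ_u ω hω
    have e4 : S.ρdu ω = S.γu0 ω * S.ρ0 + S.γbar := rfl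
    linarith
  have hy : ‖S.Cm *ᵥ xref t - c.y S t‖ ≤ k * ‖xref t - c.x t‖ := by
    rw [L1Control.Signals.y, ← Matrix.mulVec_sub]
    exact L1Control.norm_mulVec_le _ _
  have hd : ‖xref t - c.x t‖ ≤ (a + 1) * Real.exp (-μ * t) * ‖x0‖ + (b + 1) / √K.Γ := by
    refine (hdecay f hf hRB K hK x0 hx0 T c hc xref uref hr t ht).trans ?_
    gcongr <;> linarith
  refine ⟨hx, hu, hy.trans (mul_le_mul_of_nonneg_left hx hC), (hbd t ht).1, (hbd t ht).2, hd, ?_⟩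
  refine (hy.trans (mul_le_mul_of_nonneg_left hd hC)).trans ?_
  have e1 : 0 ≤ (a + 1) * Real.exp (-μ * t) * ‖x0‖ := by positivity
  have e2 : 0 ≤ 1 / √K.Γ := by positivity
  have e3 : (k * (b + 1) + 1) / √K.Γ = k * ((b + 1) / √K.Γ) + 1 / √K.Γ := by ring
  rw [e3]
  linarith
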